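/- Let $\mathfrak g$ be a finite-dimensional simple Lie algebra over $\mathbb C$, let $(\cdot|\cdot)$ be its normalized invariant form (long roots have squared length $2$), and let $k\in\mathbb C$. Let $\widehat{\mathfrak g}=\mathfrak g[t,t^{-1}]\oplus\mathbb CK$ be the affine Lie algebra, with $K$ central and $[xt^m,yt^n]=[x,y]t^{m+n}+m\,\delta_{m+n,0}(x|y)K$. Let $V^k(\mathfrak g)=U(\widehat{\mathfrak g})\otimes_{U(\mathfrak g[t]\oplus\mathbb CK)}\mathbb C_k$ be the universal affine vertex algebra of level $k$, and let $V_k(\mathfrak g)$ be its unique simple graded quotient, that is, the quotient of $V^k(\mathfrak g)$ by its largest proper graded ideal. For a vertex algebra $V$ with fields $a(z)=\sum_{n\in\mathbb Z} a_{(n)}z^{-n-1}$ put $C_2(V)=\mathrm{span}_{\mathbb C}\{a_{(-2)}b\mid a,b\in V\}$ and $R_V=V/C_2(V)$. This is a Poisson algebra with $\bar a\cdot\bar b=\overline{a_{(-1)}b}$ and $\{\bar a,\bar b\}=\overline{a_{(0)}b}$. The associated variety of $V$ is $X_V=\operatorname{Specm}(R_V)$. The vertex algebra $V$ is called quasi-lisse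 if it is finitely strongly generated (that is, $R_V$ is a finitely generated algebra) and $X_V$ has only finitely many symplectic leaves, where two points of $X_V$ lie in the same symplectic leaf if and only if they can be joined by a curve that is piecewise an integral curve of a Hamiltonian vector field $\{f,\cdot\}$, $f\in R_V$. A point $\chi\in X_{V_k(\mathfrak g)}$ determines the linear form $y\mapsto\chi\bigl(\overline{(yt^{-1})|0\rangle}\bigr)$ on $\mathfrak g$; in this way, and through the identification $\mathfrak g\cong\mathfrak g^*$, $x\mapsto(x|\cdot)$, the variety $X_{V_k(\mathfrak g)}$ is regarded as a subset of $\mathfrak g$. Let $\mathcal N=\{x\in\mathfrak g\mid \operatorname{ad}x\text{ is nilpotent}\}$ be the nilpotent cone. **Lemma.** The simple affine vertex algebra $V_k(\mathfrak g)$ is quasi-lisse if and only if $X_{V_k(\mathfrak g)}\subset\mathcal N$. -/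

import Mathlib

noncomputable section

namespace FieldCalculus

variable {V : Type*} [AddCommGroup V]

/-- The coefficient `(-1)^j * binom(n, j)` of `z^(n-j) w^j` in the expansion of `(z - w)^n`. -/
def binomSign (n : ℤ) (j : ℕ) : ℤ := (-1) ^ j * Ring.choose n j

lemma binomSign_zero_right (n : ℤ) : binomSign n 0 = 1 := by simp [binomSign]

lemma binomSign_succ (n : ℤ) (j : ℕ) :
    binomSign (n + 1) (j + 1) = binomSign n (j + 1) - binomSign n j := by
  simp only [binomSign, Ring.choose_succ_succ, pow_succ]; ring

lemma binomSign_zero_succ (j : ℕ) : binomSign 0 (j + 1) = 0 := by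
  simp [binomSign, Ring.choose_zero_succ]

lemma choose_mul_succ (n : ℤ) (j : ℕ) :
    ((j : ℤ) + 1) * Ring.choose n (j + 1) = (n - j) * Ring.choose n j := by
  have h := Ring.choose_smul_choose n (Nat.le_succ j)
  simp at h
  linarith

lemma binomSign_mul_succ (n : ℤ) (j : ℕ) :
    ((j : ℤ) + 1) * binomSign n (j + 1) + (n - j) * binomSign n j = 0 := by
  simp only [binomSign, pow_succ]
  linear_combination (-(-1) ^ j) * choose_mul_succ n j

/-- The expansion of `(z - w)^n` in the domain `|z| > |w|`, applied to `f`. -/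
def expand (f : ℤ → ℤ → V) (n l m : ℤ) : V :=
  ∑ᶠ j : ℕ, binomSign n j • f (l + n - j) (m + j)

/-- Truncation in the second variable. -/
def Trunc (f : ℤ → ℤ → V) : Prop := ∃ Q : ℤ, ∀ p q, Q ≤ q → f p q = 0

lemma expand_eq_sum {f : ℤ → ℤ → V} {Q : ℤ} (hQ : ∀ p q, Q ≤ q → f p q = 0) (n l m : ℤ) (N : ℕ)
    (hN : Q ≤ m + N) :
    expand f n l m = ∑ j ∈ Finset.range N, binomSign n j • f (l + n - j) (m + j) := by
  apply finsum_eq_sum_of_support_subset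
  intro j hj
  by_contra h
  simp only [Finset.coe_range, Set.mem_Iio, not_lt] at h
  exact hj (by simp [hQ _ (m + j) (by omega)])

lemma Trunc.exists_nat {f : ℤ → ℤ → V} (hf : Trunc f) (m : ℤ) :
    ∃ (Q : ℤ) (N : ℕ), (∀ p q, Q ≤ q → f p q = 0) ∧ Q ≤ m + N := by
  obtain ⟨Q, hQ⟩ := hf
  exact ⟨Q, (Q - m).toNat, hQ, by omega⟩

lemma expand_sub {f g : ℤ → ℤ → V} (hf : Trunc f) (hg : Trunc g) (n l m : ℤ) :
    expand (fun p q => f p q - g p q) n l m = expand f n l m - expand g n l m := by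
  obtain ⟨Q, hQ⟩ := hf
  obtain ⟨Q', hQ'⟩ := hg
  have h1 : ∀ p q, max Q Q' ≤ q → f p q = 0 := fun p q h => hQ p q (by omega)
  have h2 : ∀ p q, max Q Q' ≤ q → g p q = 0 := fun p q h => hQ' p q (by omega)
  have h3 : ∀ p q, max Q Q' ≤ q → f p q - g p q = 0 := fun p q h => by simp [h1 p q h, h2 p q h]
  have hN : max Q Q' ≤ m + ((max Q Q' - m).toNat : ℤ) := by omega
  rw [expand_eq_sum h1 n l m _ hN, expand_eq_sum h2 n l m _ hN, expand_eq_sum h3 n l m _ hN]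
  simp [smul_sub]

lemma expand_add {f g : ℤ → ℤ → V} (hf : Trunc f) (hg : Trunc g) (n l m : ℤ) :
    expand (fun p q => f p q + g p q) n l m = expand f n l m + expand g n l m := by
  obtain ⟨Q, hQ⟩ := hf
  obtain ⟨Q', hQ'⟩ := hg
  have h1 : ∀ p q, max Q Q' ≤ q → f p q = 0 := fun p q h => hQ p q (by omega)
  have h2 : ∀ p q, max Q Q' ≤ q → g p q = 0 := fun p q h => hQ' p q (by omega)
  have h3 : ∀ p q, max Q Q' ≤ q → f p q + g p q = 0 := fun p q h => by simp [h1 p q h, h2 p q h]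
  have hN : max Q Q' ≤ m + ((max Q Q' - m).toNat : ℤ) := by omega
  rw [expand_eq_sum h1 n l m _ hN, expand_eq_sum h2 n l m _ hN, expand_eq_sum h3 n l m _ hN]
  simp [smul_add, Finset.sum_add_distrib]

lemma expand_map {W : Type*} [AddCommGroup W] (φ : V →+ W) {f : ℤ → ℤ → V} (hf : Trunc f)
    (n l m : ℤ) : φ (expand f n l m) = expand (fun p q => φ (f p q)) n l m := by
  obtain ⟨Q, N, hQ, hN⟩ := hf.exists_nat m
  have h2 : ∀ p q, Q ≤ q → φ (f p q) = 0 := fun p q h => by simp [hQ p q h]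
  rw [expand_eq_sum hQ n l m _ hN, expand_eq_sum h2 n l m _ hN]
  simp

lemma expand_zero (f : ℤ → ℤ → V) (l m : ℤ) : expand f 0 l m = f l m := by
  unfold expand
  rw [finsum_eq_single _ 0]
  · simp [binomSign_zero_right]
  · rintro (_ | j) hj
    · exact absurd rfl hj
    · simp [binomSign_zero_succ]

lemma expand_pascal {f : ℤ → ℤ → V} (hf : Trunc f) (n l m : ℤ) :
    expand f (n + 1) l m = expand f n (l + 1) m - expand f n l (m + 1) := by
  obtain ⟨Q, N, hQ, hN⟩ := hf.exists_nat m
  rw [expand_eq_sum hQ (n + 1) l m (N + 1) (by push_cast; omega),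
    expand_eq_sum hQ n (l + 1) m (N + 1) (by push_cast; omega),
    expand_eq_sum hQ n l (m + 1) N (by omega),
    Finset.sum_range_succ', Finset.sum_range_succ']
  have key : ∀ a b c d e : V, a = c - e → b = d → a + b = c + d - e := by
    rintro a b c d e rfl rfl; abel
  apply key
  · rw [← Finset.sum_sub_distrib]
    refine Finset.sum_congr rfl fun j _ => ?_
    rw [binomSign_succ, sub_smul]
    congr 3 <;> push_cast <;> ring
  · simp only [binomSign_zero_right]
    congr 2 <;> push_cast <;> ring

/-- Euler-type identity: `(∂_z + ∂_w)` commutes with multiplication by `(z - w)^n`. -/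
lemma expand_deriv {f : ℤ → ℤ → V} (hf : Trunc f) (n l m : ℤ) :
    expand (fun p q => p • f (p - 1) q + q • f p (q - 1)) n l m =
      l • expand f n (l - 1) m + m • expand f n l (m - 1) := by
  obtain ⟨Q, N, hQ, hN⟩ := hf.exists_nat m
  have h1 : ∀ p q, Q + 1 ≤ q → p • f (p - 1) q + q • f p (q - 1) = 0 := fun p q h => by
    rw [hQ _ q (by omega), hQ _ (q - 1) (by omega)]; simp
  rw [expand_eq_sum h1 n l m (N + 1) (by push_cast; omega),
    expand_eq_sum hQ n (l - 1) m N (by omega),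
    expand_eq_sum hQ n l (m - 1) (N + 1) (by push_cast; omega)]
  simp only [smul_add, Finset.sum_add_distrib]
  rw [Finset.sum_range_succ _ N, Finset.sum_range_succ' _ N, Finset.sum_range_succ' _ N,
    hQ _ (m + (N : ℤ)) hN, Finset.smul_sum, smul_add m, Finset.smul_sum]
  simp only [smul_zero, add_zero, ← add_assoc, ← Finset.sum_add_distrib]
  congr 1
  · refine Finset.sum_congr rfl fun j _ => ?_
    rw [show l + n - (j : ℤ) - 1 = l - 1 + n - j by ring,
      show l + n - ((j + 1 : ℕ) : ℤ) = l - 1 + n - j by push_cast; ring,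
      show m + ((j + 1 : ℕ) : ℤ) - 1 = m + j by push_cast; ring,
      show m - 1 + ((j + 1 : ℕ) : ℤ) = m + j by push_cast; ring]
    simp only [smul_smul, ← add_smul]
    congr 1
    have := binomSign_mul_succ n j
    push_cast
    linear_combination this
  · simp only [smul_smul, binomSign_zero_right]
    congr 1 
    · push_cast; ring
    · congr 1; push_cast; ring

/-- `(z - w)^n` times the commutator-like expression built from `f = A(z)B(w)` and
`g = B(w)A(z)`, each expanded in its own domain. -/
def bracketSum (f g : ℤ → ℤ → V) (n l m : ℤ) : V :=
  expand f n l m - (n.negOnePow : ℤ) • expand g n m l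

lemma bracketSum_zero (f g : ℤ → ℤ → V) (l m : ℤ) : bracketSum f g 0 l m = f l m - g m l := by
  simp [bracketSum, expand_zero]

lemma bracketSum_pascal {f g : ℤ → ℤ → V} (hf : Trunc f) (hg : Trunc g) (n l m : ℤ) :
    bracketSum f g (n + 1) l m = bracketSum f g n (l + 1) m - bracketSum f g n l (m + 1) := by
  simp only [bracketSum, expand_pascal hf, expand_pascal hg, Int.negOnePow_succ, Units.val_neg,
    neg_smul, smul_sub]
  abel

lemma bracketSum_symm (f g : ℤ → ℤ → V) (n l m : ℤ) :
    bracketSum g f n m l = -((n.negOnePow : ℤ) • bracketSum f g n l m) := by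
  have : (n.negOnePow : ℤ) * n.negOnePow = 1 := by
    rw [← Units.val_mul]; simp
  simp only [bracketSum, smul_sub, smul_smul, this, one_smul]
  abel

/-- Cancelling a factor `z - w` on distributions whose `z`-modes are bounded. -/
lemma eq_zero_of_shift {h : ℤ → ℤ → V} {L : ℤ} (hL : ∀ l m, L ≤ l → h l m = 0)
    (hs : ∀ l m, h (l + 1) m = h l (m + 1)) : ∀ l m, h l m = 0 := by
  have key : ∀ (k : ℕ) (l m : ℤ), L ≤ l + k → h l m = 0 := by
    intro k
    induction k with
    | zero => intro l m hl; exact hL l m (by simpa using hl)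
    | succ k ih =>
      intro l m hl
      have := hs l (m - 1)
      rw [sub_add_cancel] at this
      rw [← this]
      exact ih _ _ (by push_cast at hl; omega)
  intro l m
  exact key (L - l).toNat l m (by omega)

/-- The general Borcherds recursion: `bracketSum` is determined by its values at `l = 0`. -/
lemma borcherds_aux {R : ℤ → ℤ → ℤ → V} {N : ℤ} (hN : ∀ n l m, N ≤ n → R n l m = 0)
    (hR : ∀ n l m, R (n + 1) l m = R n (l + 1) m - R n l (m + 1)) (n l m : ℤ) :
    ∑ᶠ j : ℕ, (Ring.choose l j : ℤ) • R (n + j) 0 (l + m - j) = R n l m := by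
  set U : ℤ → ℤ → ℤ → V := fun n l m =>
    ∑ᶠ j : ℕ, (Ring.choose l j : ℤ) • R (n + j) 0 (l + m - j) with hU
  have hsum : ∀ n l m (K : ℕ), N ≤ n + K → U n l m =
      ∑ j ∈ Finset.range K, (Ring.choose l j : ℤ) • R (n + j) 0 (l + m - j) := by
    intro n l m K hK
    apply finsum_eq_sum_of_support_subset
    intro j hj
    by_contra h
    simp only [Finset.coe_range, Set.mem_Iio, not_lt] at h
    exact hj (by simp [hN (n + j) _ _ (by omega)])
  have hUrec : ∀ n l m, U (n + 1) l m = U n (l + 1) m - U n l (m + 1) := by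
    intro n l m
    obtain ⟨K, hK⟩ : ∃ K : ℕ, N ≤ n + K := ⟨(N - n).toNat, by omega⟩
    rw [hsum (n + 1) l m K (by omega), hsum n (l + 1) m (K + 1) (by push_cast; omega),
      hsum n l (m + 1) (K + 1) (by push_cast; omega), Finset.sum_range_succ', Finset.sum_range_succ' _ K,
      add_sub_add_comm, ← Finset.sum_sub_distrib]
    simp only [Ring.choose_zero_right]
    rw [show l + 1 + m - ((0 : ℕ) : ℤ) = l + (m + 1) - ((0 : ℕ) : ℤ) by ring, sub_self, add_zero]
    refine Finset.sum_congr rfl fun j _ => ?_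
    rw [Ring.choose_succ_succ, add_smul,
      show l + 1 + m - ((j + 1 : ℕ) : ℤ) = l + m - j by push_cast; ring,
      show l + (m + 1) - ((j + 1 : ℕ) : ℤ) = l + m - j by push_cast; ring,
      show n + ((j + 1 : ℕ) : ℤ) = n + 1 + j by push_cast; ring]
    abel
  have hU0 : ∀ n m, U n 0 m = R n 0 m := by
    intro n m
    simp only [hU]
    rw [finsum_eq_single _ 0]
    · simp
    · rintro (_ | j) hj
      · exact absurd rfl hj
      · simp [Ring.choose_zero_succ]
  have key : ∀ (k : ℕ) (n : ℤ), N ≤ n + k → ∀ l m, U n l m = R n l m := by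
    intro k
    induction k with
    | zero =>
      intro n hn l m
      rw [hsum n l m 0 hn, hN n l m (by simpa using hn)]; simp
    | succ k ih =>
      intro n hn
      have h1 : ∀ l m, U n (l + 1) m - R n (l + 1) m = U n l (m + 1) - R n l (m + 1) := by
        intro l m
        have h := ih (n + 1) (by push_cast at hn; omega) l m
        rw [hUrec, hR] at h
        rw [sub_eq_sub_iff_add_eq_add] at h ⊢
        rw [h]; abel
      have h2 : ∀ l m, U n l m - R n l m = 0 := by
        intro l
        induction l using Int.induction_on with
        | zero => intro m; rw [hU0, sub_self]
        | succ i hi => intro m; rw [h1]; exact hi _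
        | pred i hi =>
          intro m
          have := h1 (-(i : ℤ) - 1) (m - 1)
          rw [sub_add_cancel, sub_add_cancel] at this
          rw [← this]; exact hi _
      exact fun l m => sub_eq_zero.mp (h2 l m)
  exact key (N - n).toNat n (by omega) l m

end FieldCalculus

/-- The `n`-th mode `A₍ₙ₎` of a field `A(z) = ∑ A₍ₙ₎ z^(-n-1)`. -/
abbrev mode {V : Type*} [AddCommGroup V] [Module ℂ V] (A : VertexOperator ℂ V) (n : ℤ) :
    Module.End ℂ V :=
  VertexOperator.ncoeff A n

/-- A vertex algebra over `ℂ`: a vacuum vector `|0⟩` and a linear state-field correspondence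
`a ↦ Y(a, z) = ∑ a₍ₙ₎ z^(-n-1)`, with the vacuum and creation axioms and the Borcherds identity.
Here `mode (Y a) n` is the `n`-th mode `a₍ₙ₎`; all sums are finite because `Y a` takes its values
in Laurent series. -/
class VertexAlgebra (V : Type*) [AddCommGroup V] [Module ℂ V] where
  /-- The vacuum vector. -/
  vacuum : V
  /-- The state-field correspondence. -/
  Y : V →ₗ[ℂ] VertexOperator ℂ V
  vacuum_mode : ∀ (n : ℤ) (b : V), mode (Y vacuum) n b = if n = -1 then b else 0
  mode_vacuum : ∀ (a : V) (n : ℤ), 0 ≤ n → mode (Y a) n vacuum = 0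
  creation : ∀ a : V, mode (Y a) (-1) vacuum = a
  borcherds : ∀ (a b c : V) (l m n : ℤ),
    ∑ᶠ j : ℕ, Ring.choose l j • mode (Y (mode (Y a) (n + j) b)) (l + m - j) c =
      ∑ᶠ j : ℕ, ((-1) ^ j * Ring.choose n j) •
        (mode (Y a) (l + n - j) (mode (Y b) (m + j) c) -
          (n.negOnePow : ℤ) • mode (Y b) (m + n - j) (mode (Y a) (l + j) c))

namespace FieldCalculus

lemma Trunc.of_comp {V : Type*} [AddCommGroup V] {W : Type*} [AddCommGroup W]
    (φ : ℤ → V →+ W) {g : ℤ → V} (hg : ∃ Q : ℤ, ∀ q, Q ≤ q → g q = 0) :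
    Trunc (fun p q => φ p (g q)) := by
  obtain ⟨Q, hQ⟩ := hg
  exact ⟨Q, fun p q h => by simp [hQ q h]⟩

lemma bracketSum_add {V : Type*} [AddCommGroup V] {f f' g g' : ℤ → ℤ → V} (hf : Trunc f)
    (hf' : Trunc f') (hg : Trunc g) (hg' : Trunc g') (n l m : ℤ) :
    bracketSum (fun p q => f p q + f' p q) (fun p q => g p q + g' p q) n l m =
      bracketSum f g n l m + bracketSum f' g' n l m := by
  simp only [bracketSum, expand_add hf hf', expand_add hg hg', smul_add]
  abel

lemma bracketSum_map {V : Type*} [AddCommGroup V] {W : Type*} [AddCommGroup W] (φ : V →+ W)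
    {f g : ℤ → ℤ → V} (hf : Trunc f) (hg : Trunc g) (n l m : ℤ) :
    φ (bracketSum f g n l m) =
      bracketSum (fun p q => φ (f p q)) (fun p q => φ (g p q)) n l m := by
  simp only [bracketSum, map_sub, map_zsmul, expand_map φ hf, expand_map φ hg]

lemma bracketSum_eq_finsum {V : Type*} [AddCommGroup V] {f g : ℤ → ℤ → V} (hf : Trunc f)
    (hg : Trunc g) (n l m : ℤ) :
    bracketSum f g n l m = ∑ᶠ j : ℕ, ((-1) ^ j * Ring.choose n j) •
      (f (l + n - j) (m + j) - (n.negOnePow : ℤ) • g (m + n - j) (l + j)) := by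
  obtain ⟨Q, N, hQ, hN⟩ := hf.exists_nat m
  obtain ⟨Q', N', hQ', hN'⟩ := hg.exists_nat l
  rw [bracketSum, expand_eq_sum hQ n l m (max N N') (by push_cast; omega),
    expand_eq_sum hQ' n m l (max N N') (by push_cast; omega)]
  rw [finsum_eq_sum_of_support_subset (s := Finset.range (max N N'))]
  · rw [Finset.smul_sum, ← Finset.sum_sub_distrib]
    refine Finset.sum_congr rfl fun j _ => ?_
    rw [smul_sub, smul_comm]; rfl
  · intro j hj
    by_contra h
    simp only [Finset.coe_range, Set.mem_Iio, not_lt] at h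
    exact hj (by simp [hQ _ (m + j) (by omega), hQ' _ (l + j) (by omega)])

variable {V : Type*} [AddCommGroup V] [Module ℂ V]

lemma exists_mode_eq_zero (A : VertexOperator ℂ V) (v : V) :
    ∃ N : ℤ, ∀ n, N ≤ n → mode A n v = 0 :=
  ⟨-((HahnModule.of ℂ).symm (A v)).order, fun n hn =>
    VertexOperator.ncoeff_eq_zero_of_lt_order A n v (by omega)⟩

/-- The field with given modes. -/
def ofModes (f : ℤ → Module.End ℂ V) (hf : ∀ v, ∃ N : ℤ, ∀ n, N ≤ n → f n v = 0) :
    VertexOperator ℂ V :=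
  VertexOperator.of_coeff (fun i => f (-i - 1)) fun v => by
    obtain ⟨N, hN⟩ := hf v
    refine ⟨-N, fun i hi => ?_⟩
    by_contra h
    exact hi (hN _ (by omega))

@[simp] lemma ofModes_mode (f : ℤ → Module.End ℂ V) (hf) (n : ℤ) : mode (ofModes f hf) n = f n := by
  unfold mode
  rw [ofModes, VertexOperator.ncoeff_of_coeff]
  congr 1; ring

lemma ext_modes {A B : VertexOperator ℂ V} (h : ∀ n v, mode A n v = mode B n v) : A = B := by
  apply HVertexOperator.coeff_inj
  ext n v
  rw [VertexOperator.coeff_eq_ncoeff, VertexOperator.coeff_eq_ncoeff, h]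

/-- The identity field. -/
def idField : VertexOperator ℂ V :=
  ofModes (fun n => if n = -1 then 1 else 0) fun v => ⟨0, fun n hn => by
    rw [if_neg (by omega)]; rfl⟩

lemma idField_mode (n : ℤ) (v : V) : mode (idField : VertexOperator ℂ V) n v =
    if n = -1 then v else 0 := by
  simp only [idField, ofModes_mode]
  split_ifs <;> rfl

lemma trunc_comp (A B : VertexOperator ℂ V) (v : V) : Trunc (fun p q => mode A p (mode B q v)) :=
  Trunc.of_comp (fun p => (mode A p).toAddMonoidHom) (exists_mode_eq_zero B v)

/-- The coefficient of `z^(-l-1) w^(-m-1)` in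
`A(z)B(w) i_{z,w}(z - w)^n - B(w)A(z) i_{w,z}(z - w)^n`, applied to `v`. -/
def opProd (A B : VertexOperator ℂ V) (n l m : ℤ) (v : V) : V :=
  bracketSum (fun p q => mode A p (mode B q v)) (fun q p => mode B q (mode A p v)) n l m

lemma opProd_pascal (A B : VertexOperator ℂ V) (n l m : ℤ) (v : V) :
    opProd A B (n + 1) l m v = opProd A B n (l + 1) m v - opProd A B n l (m + 1) v :=
  bracketSum_pascal (trunc_comp A B v) (trunc_comp B A v) n l m

lemma opProd_zero (A B : VertexOperator ℂ V) (l m : ℤ) (v : V) :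
    opProd A B 0 l m v = mode A l (mode B m v) - mode B m (mode A l v) :=
  bracketSum_zero _ _ l m

/-- `opProd` as a linear operator. -/
def opProdEnd (A B : VertexOperator ℂ V) (n l m : ℤ) : Module.End ℂ V where
  toFun := opProd A B n l m
  map_add' v w := by
    simp only [opProd, map_add]
    exact bracketSum_add (trunc_comp A B v) (trunc_comp A B w) (trunc_comp B A v)
      (trunc_comp B A w) n l m
  map_smul' r v := by
    have := bracketSum_map (DistribSMul.toAddMonoidHom V r) (trunc_comp A B v) (trunc_comp B A v)
      n l m
    simp only [DistribSMul.toAddMonoidHom_apply] at this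
    simp only [opProd, map_smul, RingHom.id_apply, this]

/-- The residue product `A₍ₙ₎B` of two fields. -/
def resProd (A : VertexOperator ℂ V) (n : ℤ) (B : VertexOperator ℂ V) : VertexOperator ℂ V :=
  ofModes (fun m => opProdEnd A B n 0 m) fun v => by
    obtain ⟨Q, hQ⟩ := exists_mode_eq_zero B v
    obtain ⟨P, hP⟩ := exists_mode_eq_zero A v
    choose F hF using fun p : ℤ => exists_mode_eq_zero B (mode A p v)
    refine ⟨max Q (∑ j ∈ Finset.range P.toNat, |F j| + P.toNat - n), fun m hm => ?_⟩
    have h1 : ∀ p q, Q ≤ q → mode A p (mode B q v) = 0 := fun p q h => by rw [hQ q h, map_zero]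
    have h2 : ∀ q p, P ≤ p → mode B q (mode A p v) = 0 := fun p q h => by rw [hP q h, map_zero]
    change bracketSum _ _ n 0 m = 0
    rw [bracketSum, expand_eq_sum h1 n 0 m 0 (by push_cast; omega),
      expand_eq_sum h2 n m 0 P.toNat (by omega)]
    rw [Finset.range_zero, Finset.sum_empty, zero_sub, neg_eq_zero]
    apply smul_eq_zero_of_right
    apply Finset.sum_eq_zero
    intro j hj
    have h3 : |F j| ≤ ∑ j ∈ Finset.range P.toNat, |F j| :=
      Finset.single_le_sum (f := fun j : ℕ => |F j|) (fun i _ => abs_nonneg _) hj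
    have h4 := le_abs_self (F j)
    have h5 := Finset.mem_range.mp hj
    apply smul_eq_zero_of_right
    rw [zero_add]
    exact hF j _ (by omega)

lemma resProd_mode (A B : VertexOperator ℂ V) (n m : ℤ) (v : V) :
    mode (resProd A n B) m v = opProd A B n 0 m v := by
  simp only [resProd, ofModes_mode]; rfl

/-- Mutual locality: `(z - w)^N [A(z), B(w)] = 0` for some `N`. -/
def IsLocal (A B : VertexOperator ℂ V) : Prop :=
  ∃ N : ℕ, ∀ l m v, opProd A B N l m v = 0

lemma IsLocal.exists_forall {A B : VertexOperator ℂ V} (h : IsLocal A B) :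
    ∃ N : ℕ, ∀ n : ℤ, N ≤ n → ∀ l m v, opProd A B n l m v = 0 := by
  obtain ⟨N, hN⟩ := h
  refine ⟨N, fun n hn => ?_⟩
  induction n, hn using Int.leInduction with
  | base => exact hN
  | succ n hn ih => intro l m v; rw [opProd_pascal, ih, ih, sub_zero]

lemma IsLocal.symm {A B : VertexOperator ℂ V} (h : IsLocal A B) : IsLocal B A := by
  obtain ⟨N, hN⟩ := h
  refine ⟨N, fun l m v => ?_⟩
  have := bracketSum_symm (fun p q => mode A p (mode B q v)) (fun q p => mode B q (mode A p v)) N m l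
  have h2 : bracketSum (fun p q => mode A p (mode B q v)) (fun q p => mode B q (mode A p v)) N m l = 0 :=
    hN m l v
  rw [h2, smul_zero, neg_zero] at this
  exact this

lemma isLocal_of_commute {A B : VertexOperator ℂ V}
    (h : ∀ l m v, mode A l (mode B m v) = mode B m (mode A l v)) : IsLocal A B :=
  ⟨0, fun l m v => by rw [Nat.cast_zero, opProd_zero, h, sub_self]⟩

lemma isLocal_id (A : VertexOperator ℂ V) : IsLocal idField A :=
  isLocal_of_commute fun l m v => by
    simp only [idField_mode]; split_ifs <;> simp

end FieldCalculus

namespace FieldCalculus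

section Dong

variable {V : Type*} [AddCommGroup V]

/-- Multiplication by `z - w` on distributions in `z, u, w`. -/
def mulZW (V : Type*) [AddCommGroup V] : Module.End ℤ (ℤ → ℤ → ℤ → V) where
  toFun f l m q := f (l + 1) m q - f l m (q + 1)
  map_add' f g := by ext; simp; abel
  map_smul' r f := by ext; simp [smul_sub]

/-- Multiplication by `u - w` on distributions in `z, u, w`. -/
def mulUW (V : Type*) [AddCommGroup V] : Module.End ℤ (ℤ → ℤ → ℤ → V) where
  toFun f l m q := f l (m + 1) q - f l m (q + 1)
  map_add' f g := by ext; simp; abel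
  map_smul' r f := by ext; simp [smul_sub]

/-- Multiplication by `z - u` on distributions in `z, u, w`. -/
def mulZU (V : Type*) [AddCommGroup V] : Module.End ℤ (ℤ → ℤ → ℤ → V) where
  toFun f l m q := f (l + 1) m q - f l (m + 1) q
  map_add' f g := by ext; simp; abel
  map_smul' r f := by ext; simp [smul_sub]

lemma mulUW_eq : (mulUW V : Module.End ℤ (ℤ → ℤ → ℤ → V)) = (mulZW V) + -(mulZU V) := by
  ext f l m q
  simp [mulUW, mulZW, mulZU]

lemma commute_mulZW_mulZU : Commute (mulZW V : Module.End ℤ (ℤ → ℤ → ℤ → V)) (mulZU V) := by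
  ext f l m q
  simp [mulZW, mulZU]
  abel

lemma commute_mulZW_mulUW : Commute (mulZW V : Module.End ℤ (ℤ → ℤ → ℤ → V)) (mulUW V) := by
  rw [mulUW_eq]
  exact (Commute.refl _).add_right commute_mulZW_mulZU.neg_right

lemma commute_mulZU_mulUW : Commute (mulZU V : Module.End ℤ (ℤ → ℤ → ℤ → V)) (mulUW V) := by
  rw [mulUW_eq]
  exact commute_mulZW_mulZU.symm.add_right (Commute.refl _).neg_right

lemma mulUW_pow_eq_zero {D : ℤ → ℤ → ℤ → V} {N K : ℕ}
    (h1 : ((mulZW V) ^ N) (((mulUW V) ^ N) D) = 0) (h2 : ((mulZU V) ^ K) D = 0) :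
    ((mulUW V) ^ (N + K + N)) D = 0 := by
  have hc : Commute (mulZW V) (-(mulZU V)) := commute_mulZW_mulZU.neg_right
  have h3 : ((mulZU V) ^ K) (((mulUW V) ^ N) D) = 0 := by
    rw [← Module.End.mul_apply, (commute_mulZU_mulUW.pow_pow K N).eq, Module.End.mul_apply, h2,
      map_zero]
  rw [pow_add, Module.End.mul_apply]
  generalize ((mulUW V) ^ N) D = E at h1 h3
  rw [mulUW_eq, hc.add_pow, LinearMap.sum_apply]
  refine Finset.sum_eq_zero fun i hi => ?_
  rw [← (Nat.cast_commute _ _).eq, Module.End.mul_apply]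
  suffices h : ((mulZW V) ^ i * (-(mulZU V)) ^ (N + K - i)) E = 0 by rw [h, map_zero]
  by_cases hiN : N ≤ i
  · obtain ⟨k, rfl⟩ := Nat.exists_eq_add_of_le' hiN
    rw [(hc.pow_pow _ _).eq, pow_add, ← mul_assoc, Module.End.mul_apply, h1, map_zero]
  · obtain ⟨k, hk⟩ := Nat.exists_eq_add_of_le' (show K ≤ N + K - i by omega)
    have h4 : ((-(mulZU V)) ^ K) E = 0 := by
      rw [neg_pow, Module.End.mul_apply, h3, map_zero]
    rw [hk, pow_add, ← mul_assoc, Module.End.mul_apply, h4, map_zero]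

lemma trunc_mulZW {F : ℤ → ℤ → ℤ → V} (h : ∀ q, Trunc fun p p' => F p p' q) (q : ℤ) :
    Trunc fun p p' => (mulZW V) F p p' q := by
  obtain ⟨Q, hQ⟩ := h q
  obtain ⟨Q', hQ'⟩ := h (q + 1)
  exact ⟨max Q Q', fun p p' hp => by simp [mulZW, hQ _ p' (by omega), hQ' _ p' (by omega)]⟩

lemma trunc_mulUW {F : ℤ → ℤ → ℤ → V} (h : ∀ q, Trunc fun p p' => F p p' q) (q : ℤ) :
    Trunc fun p p' => (mulUW V) F p p' q := by
  obtain ⟨Q, hQ⟩ := h q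
  obtain ⟨Q', hQ'⟩ := h (q + 1)
  exact ⟨max Q Q', fun p p' hp => by
    simp [mulUW, hQ _ (p' + 1) (by omega), hQ' _ p' (by omega)]⟩

lemma trunc_mulZW' {F : ℤ → ℤ → ℤ → V} (h : ∀ q, Trunc fun p' p => F p p' q) (q : ℤ) :
    Trunc fun p' p => (mulZW V) F p p' q := by
  obtain ⟨Q, hQ⟩ := h q
  obtain ⟨Q', hQ'⟩ := h (q + 1)
  exact ⟨max Q Q', fun p p' hp => by
    simp [mulZW, hQ _ (p' + 1) (by omega), hQ' _ p' (by omega)]⟩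

lemma trunc_mulUW' {F : ℤ → ℤ → ℤ → V} (h : ∀ q, Trunc fun p' p => F p p' q) (q : ℤ) :
    Trunc fun p' p => (mulUW V) F p p' q := by
  obtain ⟨Q, hQ⟩ := h q
  obtain ⟨Q', hQ'⟩ := h (q + 1)
  exact ⟨max Q Q', fun p p' hp => by simp [mulUW, hQ _ p' (by omega), hQ' _ p' (by omega)]⟩

/-- `expand` in the variables `z, u`, with `w` as a parameter. -/
def expandZU (n : ℤ) (F : ℤ → ℤ → ℤ → V) (l m q : ℤ) : V := expand (fun p p' => F p p' q) n l m

/-- `expand` in the variables `u, z`, with `w` as a parameter. -/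
def expandUZ (n : ℤ) (F : ℤ → ℤ → ℤ → V) (l m q : ℤ) : V := expand (fun p' p => F p p' q) n m l

lemma expandZU_mul {n : ℤ} {F : ℤ → ℤ → ℤ → V} (h : ∀ q, Trunc fun p p' => F p p' q) :
    expandZU n ((mulZW V) F) = (mulZW V) (expandZU n F) ∧ expandZU n ((mulUW V) F) = (mulUW V) (expandZU n F) := by
  constructor
  · ext l m q
    have h1 : Trunc fun p p' => F (p + 1) p' q := by
      obtain ⟨Q, hQ⟩ := h q
      exact ⟨Q, fun p p' hp => hQ _ _ hp⟩
    refine (expand_sub h1 (h (q + 1)) n l m).trans ?_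
    simp only [mulZW, LinearMap.coe_mk, AddHom.coe_mk, expandZU, expand]
    simp only [show ∀ j : ℕ, l + n - (j : ℤ) + 1 = l + 1 + n - j from fun j => by ring]
  · ext l m q
    have h1 : Trunc fun p p' => F p (p' + 1) q := by
      obtain ⟨Q, hQ⟩ := h q
      exact ⟨Q, fun p p' hp => hQ _ _ (by omega)⟩
    refine (expand_sub h1 (h (q + 1)) n l m).trans ?_
    simp only [mulUW, LinearMap.coe_mk, AddHom.coe_mk, expandZU, expand]
    simp only [show ∀ j : ℕ, m + (j : ℤ) + 1 = m + 1 + j from fun j => by ring]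

lemma expandUZ_mul {n : ℤ} {F : ℤ → ℤ → ℤ → V} (h : ∀ q, Trunc fun p' p => F p p' q) :
    expandUZ n ((mulZW V) F) = (mulZW V) (expandUZ n F) ∧ expandUZ n ((mulUW V) F) = (mulUW V) (expandUZ n F) := by
  constructor
  · ext l m q
    have h1 : Trunc fun p' p => F (p + 1) p' q := by
      obtain ⟨Q, hQ⟩ := h q
      exact ⟨Q, fun p p' hp => hQ _ _ (by omega)⟩
    refine (expand_sub h1 (h (q + 1)) n m l).trans ?_
    simp only [mulZW, LinearMap.coe_mk, AddHom.coe_mk, expandUZ, expand]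
    simp only [show ∀ j : ℕ, l + (j : ℤ) + 1 = l + 1 + j from fun j => by ring]
  · ext l m q
    have h1 : Trunc fun p' p => F p (p' + 1) q := by
      obtain ⟨Q, hQ⟩ := h q
      exact ⟨Q, fun p p' hp => hQ _ _ hp⟩
    refine (expand_sub h1 (h (q + 1)) n m l).trans ?_
    simp only [mulUW, LinearMap.coe_mk, AddHom.coe_mk, expandUZ, expand]
    simp only [show ∀ j : ℕ, m + n - (j : ℤ) + 1 = m + 1 + n - j from fun j => by ring]

lemma mul_pow_expandZU {n : ℤ} (N M : ℕ) {F : ℤ → ℤ → ℤ → V}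
    (h : ∀ q, Trunc fun p p' => F p p' q) :
    ((mulZW V) ^ N) (((mulUW V) ^ M) (expandZU n F)) = expandZU n (((mulZW V) ^ N) (((mulUW V) ^ M) F)) := by
  have key : ∀ M : ℕ, ((mulUW V) ^ M) (expandZU n F) = expandZU n (((mulUW V) ^ M) F) ∧
      ∀ q, Trunc fun p p' => ((mulUW V) ^ M) F p p' q := by
    intro M
    induction M with
    | zero => exact ⟨rfl, h⟩
    | succ M ih =>
      simp only [pow_succ', Module.End.mul_apply]
      exact ⟨by rw [ih.1, (expandZU_mul ih.2).2], fun q => trunc_mulUW ih.2 q⟩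
  have key2 : ((mulZW V) ^ N) (expandZU n (((mulUW V) ^ M) F)) =
      expandZU n (((mulZW V) ^ N) (((mulUW V) ^ M) F)) ∧
      ∀ q, Trunc fun p p' => ((mulZW V) ^ N) (((mulUW V) ^ M) F) p p' q := by
    induction N with
    | zero => exact ⟨rfl, (key M).2⟩
    | succ N ih =>
      simp only [pow_succ', Module.End.mul_apply]
      exact ⟨by rw [ih.1, (expandZU_mul ih.2).1], fun q => trunc_mulZW ih.2 q⟩
  rw [(key M).1, key2.1]

lemma mul_pow_expandUZ {n : ℤ} (N M : ℕ) {F : ℤ → ℤ → ℤ → V}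
    (h : ∀ q, Trunc fun p' p => F p p' q) :
    ((mulZW V) ^ N) (((mulUW V) ^ M) (expandUZ n F)) = expandUZ n (((mulZW V) ^ N) (((mulUW V) ^ M) F)) := by
  have key : ∀ M : ℕ, ((mulUW V) ^ M) (expandUZ n F) = expandUZ n (((mulUW V) ^ M) F) ∧
      ∀ q, Trunc fun p' p => ((mulUW V) ^ M) F p p' q := by
    intro M
    induction M with
    | zero => exact ⟨rfl, h⟩
    | succ M ih =>
      simp only [pow_succ', Module.End.mul_apply]
      exact ⟨by rw [ih.1, (expandUZ_mul ih.2).2], fun q => trunc_mulUW' ih.2 q⟩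
  have key2 : ((mulZW V) ^ N) (expandUZ n (((mulUW V) ^ M) F)) =
      expandUZ n (((mulZW V) ^ N) (((mulUW V) ^ M) F)) ∧
      ∀ q, Trunc fun p' p => ((mulZW V) ^ N) (((mulUW V) ^ M) F) p p' q := by
    induction N with
    | zero => exact ⟨rfl, (key M).2⟩
    | succ N ih =>
      simp only [pow_succ', Module.End.mul_apply]
      exact ⟨by rw [ih.1, (expandUZ_mul ih.2).1], fun q => trunc_mulZW' ih.2 q⟩
  rw [(key M).1, key2.1]

end Dong

variable {V : Type*} [AddCommGroup V] [Module ℂ V]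

lemma mulUW_pow_opProd (A C : VertexOperator ℂ V) (φ : ℤ → V →+ V) (v : V) (N : ℕ) :
    ((mulUW V) ^ N) (fun p p' q => φ p (opProd A C 0 p' q v)) =
      fun p p' q => φ p (opProd A C N p' q v) := by
  induction N with
  | zero => rfl
  | succ N ih =>
    rw [pow_succ', Module.End.mul_apply, ih]
    ext p p' q
    push_cast
    rw [opProd_pascal, map_sub]
    rfl

lemma mulZW_pow_opProd (A C : VertexOperator ℂ V) (φ : ℤ → V →+ V) (w : ℤ → V) (N : ℕ) :
    ((mulZW V) ^ N) (fun p p' q => φ p' (opProd A C 0 p q (w p'))) =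
      fun p p' q => φ p' (opProd A C N p q (w p')) := by
  induction N with
  | zero => rfl
  | succ N ih =>
    rw [pow_succ', Module.End.mul_apply, ih]
    ext p p' q
    push_cast
    rw [opProd_pascal, map_sub]
    rfl

lemma mulUW_pow_opProd' (A C : VertexOperator ℂ V) (w : ℤ → V) (N : ℕ) :
    ((mulUW V) ^ N) (fun p p' q => opProd A C 0 p' q (w p)) =
      fun p p' q => opProd A C N p' q (w p) := by
  induction N with
  | zero => rfl
  | succ N ih =>
    rw [pow_succ', Module.End.mul_apply, ih]
    ext p p' q
    push_cast
    rw [opProd_pascal]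
    rfl

/-- Dong's lemma. -/
lemma IsLocal.resProd {A B C : VertexOperator ℂ V} (hAB : IsLocal A B) (hAC : IsLocal A C)
    (hBC : IsLocal B C) (n : ℤ) : IsLocal (resProd A n B) C := by
  obtain ⟨N₀, hN₀⟩ := hAB.exists_forall
  obtain ⟨N₁, hN₁⟩ := hAC.exists_forall
  obtain ⟨N₂, hN₂⟩ := hBC.exists_forall
  set N := max N₁ N₂ with hN
  have hAC' : ∀ l m v, opProd A C N l m v = 0 := hN₁ N (by simp [hN])
  have hBC' : ∀ l m v, opProd B C N l m v = 0 := hN₂ N (by simp [hN])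
  obtain ⟨K, hK⟩ : ∃ K : ℕ, (N₀ : ℤ) ≤ n + K := ⟨(N₀ - n).toNat, by omega⟩
  refine ⟨N + K + N, fun m q v => ?_⟩
  set D : ℤ → ℤ → ℤ → V := fun l m q =>
    opProd A B n l m (mode C q v) - mode C q (opProd A B n l m v) with hD
  -- the two halves of `D`
  set F : ℤ → ℤ → ℤ → V := fun p p' q =>
    mode A p (mode B p' (mode C q v)) - mode C q (mode A p (mode B p' v)) with hF
  set G : ℤ → ℤ → ℤ → V := fun p p' q =>
    mode B p' (mode A p (mode C q v)) - mode C q (mode B p' (mode A p v)) with hG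
  have tF : ∀ q, Trunc fun p p' => F p p' q := by
    intro q
    obtain ⟨Q, hQ⟩ := exists_mode_eq_zero B (mode C q v)
    obtain ⟨Q', hQ'⟩ := exists_mode_eq_zero B v
    exact ⟨max Q Q', fun p p' h => by simp [hF, hQ p' (by omega), hQ' p' (by omega)]⟩
  have tG : ∀ q, Trunc fun p' p => G p p' q := by
    intro q
    obtain ⟨Q, hQ⟩ := exists_mode_eq_zero A (mode C q v)
    obtain ⟨Q', hQ'⟩ := exists_mode_eq_zero A v
    exact ⟨max Q Q', fun p' p h => by simp [hG, hQ p (by omega), hQ' p (by omega)]⟩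
  have hDFG : D = expandZU n F - (n.negOnePow : ℤ) • expandUZ n G := by
    ext l m q
    have h1 := bracketSum_map (mode C q).toAddMonoidHom (trunc_comp A B v) (trunc_comp B A v) n l m
    have e1 := expand_sub (trunc_comp A B (mode C q v))
      (Trunc.of_comp (fun p => ((mode C q) ∘ₗ (mode A p)).toAddMonoidHom)
        (exists_mode_eq_zero B v)) n l m
    have e2 := expand_sub (trunc_comp B A (mode C q v))
      (Trunc.of_comp (fun p => ((mode C q) ∘ₗ (mode B p)).toAddMonoidHom)
        (exists_mode_eq_zero A v)) n m l
    simp only [LinearMap.toAddMonoidHom_coe, LinearMap.comp_apply] at h1 e1 e2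
    simp only [hD, opProd, h1, Pi.sub_apply, Pi.smul_apply, expandZU, expandUZ, hF, hG, e1, e2]
    simp only [bracketSum, smul_sub]
    abel
  have zF : ((mulZW V) ^ N) (((mulUW V) ^ N) F) = 0 := by
    have : F = (fun p p' q => (mode A p).toAddMonoidHom (opProd B C 0 p' q v)) +
        fun p p' q => (AddMonoidHom.id V) (opProd A C 0 p q (mode B p' v)) := by
      ext p p' q; simp [hF, opProd_zero]
    rw [this, map_add, map_add, mulUW_pow_opProd B C (fun p => (mode A p).toAddMonoidHom),
      ← Module.End.mul_apply _ _ (fun p p' q => (AddMonoidHom.id V) _),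
      (commute_mulZW_mulUW.pow_pow N N).eq, Module.End.mul_apply,
      mulZW_pow_opProd A C (fun _ => AddMonoidHom.id V)]
    simp only [hBC', hAC', map_zero]
    change ((mulZW V) ^ N) 0 + ((mulUW V) ^ N) 0 = 0
    simp
  have zG : ((mulZW V) ^ N) (((mulUW V) ^ N) G) = 0 := by
    have : G = (fun p p' q => (mode B p').toAddMonoidHom (opProd A C 0 p q v)) +
        fun p p' q => opProd B C 0 p' q (mode A p v) := by
      ext p p' q; simp [hG, opProd_zero]
    rw [this, map_add, map_add, mulUW_pow_opProd' B C,
      ← Module.End.mul_apply _ _ (fun p p' q => (mode B p').toAddMonoidHom _),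
      (commute_mulZW_mulUW.pow_pow N N).eq, Module.End.mul_apply,
      mulZW_pow_opProd A C (fun p' => (mode B p').toAddMonoidHom) (fun _ => v)]
    simp only [hBC', hAC', map_zero]
    change ((mulUW V) ^ N) 0 + ((mulZW V) ^ N) 0 = 0
    simp
  have zD : ((mulZW V) ^ N) (((mulUW V) ^ N) D) = 0 := by
    rw [hDFG, map_sub, map_sub, map_zsmul, map_zsmul, mul_pow_expandZU N N tF,
      mul_pow_expandUZ N N tG, zF, zG]
    ext l m q
    simp [expandZU, expandUZ, expand]
  have bD : ((mulZU V) ^ K) D = 0 := by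
    have : ∀ K : ℕ, ((mulZU V) ^ K) D = fun l m q =>
        opProd A B (n + K) l m (mode C q v) - mode C q (opProd A B (n + K) l m v) := by
      intro K
      induction K with
      | zero => ext l m q; simp [hD]
      | succ K ih =>
        rw [pow_succ', Module.End.mul_apply, ih]
        ext l m q
        push_cast
        rw [← add_assoc, opProd_pascal, opProd_pascal, map_sub]
        simp only [mulZU, LinearMap.coe_mk, AddHom.coe_mk]
        abel
    rw [this]
    ext l m q
    simp [hN₀ (n + K) hK]
  have hfin := congrFun (congrFun (congrFun (mulUW_pow_eq_zero zD bD) 0) m) q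
  have : ∀ (M : ℕ) (m q : ℤ), ((mulUW V) ^ M) D 0 m q =
      opProd (FieldCalculus.resProd A n B) C M m q v := by
    intro M
    induction M with
    | zero => intro m q; simp [opProd_zero, resProd_mode, hD]
    | succ M ih =>
      intro m q
      rw [pow_succ', Module.End.mul_apply]
      push_cast
      rw [opProd_pascal, ← ih, ← ih]
      rfl
  rw [← this, hfin]; rfl

end FieldCalculus

namespace FieldCalculus

variable {V : Type*} [AddCommGroup V] [Module ℂ V]

/-- `A(z)|0⟩` has no negative powers of `z`. -/
def IsCreative (v₀ : V) (A : VertexOperator ℂ V) : Prop := ∀ n : ℤ, 0 ≤ n → mode A n v₀ = 0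

/-- `[T, A(z)] = ∂_z A(z)`. -/
def IsCovariant (T : Module.End ℂ V) (A : VertexOperator ℂ V) : Prop :=
  ∀ (n : ℤ) (v : V), T (mode A n v) = mode A n (T v) - n • mode A (n - 1) v

/-- The fields generated from `S` by linear combinations and residue products with members of `S`. -/
inductive Generated (S : Set (VertexOperator ℂ V)) : VertexOperator ℂ V → Prop
  | id : Generated S idField
  | add (A B : VertexOperator ℂ V) : Generated S A → Generated S B → Generated S (A + B)
  | smul (r : ℂ) (A : VertexOperator ℂ V) : Generated S A → Generated S (r • A)
  | prod (A : VertexOperator ℂ V) (n : ℤ) (B : VertexOperator ℂ V) :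
      A ∈ S → Generated S B → Generated S (resProd A n B)

lemma mode_add (A B : VertexOperator ℂ V) (n : ℤ) (v : V) :
    mode (A + B) n v = mode A n v + mode B n v := by
  simp only [mode, map_add]; rfl

lemma mode_smul (r : ℂ) (A : VertexOperator ℂ V) (n : ℤ) (v : V) :
    mode (r • A) n v = r • mode A n v := by
  simp only [mode, map_smul]; rfl

lemma opProd_add_left (A A' B : VertexOperator ℂ V) (n l m : ℤ) (v : V) :
    opProd (A + A') B n l m v = opProd A B n l m v + opProd A' B n l m v := by
  simp only [opProd, mode_add, map_add]
  exact bracketSum_add (trunc_comp A B v) (trunc_comp A' B v) (trunc_comp B A v)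
      (trunc_comp B A' v) n l m

lemma opProd_smul_left (r : ℂ) (A B : VertexOperator ℂ V) (n l m : ℤ) (v : V) :
    opProd (r • A) B n l m v = r • opProd A B n l m v := by
  have := bracketSum_map (DistribSMul.toAddMonoidHom V r) (trunc_comp A B v) (trunc_comp B A v)
      n l m
  simp only [DistribSMul.toAddMonoidHom_apply] at this
  simp only [opProd, mode_smul, map_smul, this]

lemma IsLocal.add {A A' B : VertexOperator ℂ V} (h : IsLocal A B) (h' : IsLocal A' B) :
    IsLocal (A + A') B := by
  obtain ⟨N, hN⟩ := h.exists_forall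
  obtain ⟨N', hN'⟩ := h'.exists_forall
  exact ⟨max N N', fun l m v => by
    rw [opProd_add_left, hN _ (by simp), hN' _ (by simp), add_zero]⟩

lemma IsLocal.smul (r : ℂ) {A B : VertexOperator ℂ V} (h : IsLocal A B) : IsLocal (r • A) B := by
  obtain ⟨N, hN⟩ := h
  exact ⟨N, fun l m v => by rw [opProd_smul_left, hN, smul_zero]⟩

lemma generated_isLocal_base {S : Set (VertexOperator ℂ V)}
    (hS : ∀ A ∈ S, ∀ B ∈ S, IsLocal A B) {B : VertexOperator ℂ V} (hB : Generated S B) :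
    ∀ C ∈ S, IsLocal B C := by
  induction hB with
  | id => exact fun C _ => isLocal_id C
  | add A A' _ _ h1 h2 => exact fun C hC => (h1 C hC).add (h2 C hC)
  | smul r A _ h1 => exact fun C hC => (h1 C hC).smul r
  | prod A n A' hA _ h2 => exact fun C hC => (h2 A hA).symm.resProd (hS A hA C hC) (h2 C hC) n

lemma generated_isLocal {S : Set (VertexOperator ℂ V)}
    (hS : ∀ A ∈ S, ∀ B ∈ S, IsLocal A B) {A B : VertexOperator ℂ V} (hA : Generated S A)
    (hB : Generated S B) : IsLocal A B := by
  induction hA with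
  | id => exact isLocal_id B
  | add A A' _ _ h1 h2 => exact h1.add h2
  | smul r A _ h1 => exact h1.smul r
  | prod A n A' hA hA' h2 =>
    exact (generated_isLocal_base hS hA' A hA).symm.resProd
      (generated_isLocal_base hS hB A hA).symm h2 n

lemma opProd_vacuum {v₀ : V} {A B : VertexOperator ℂ V} (hA : IsCreative v₀ A)
    (hB : IsCreative v₀ B) (n l : ℤ) {m : ℤ} (hm : 0 ≤ m) (hl : 0 ≤ l) :
    opProd A B n l m v₀ = 0 := by
  have h1 : ∀ p q, 0 ≤ q → mode A p (mode B q v₀) = 0 := fun p q h => by rw [hB q h, map_zero]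
  have h2 : ∀ p q, 0 ≤ q → mode B p (mode A q v₀) = 0 := fun p q h => by rw [hA q h, map_zero]
  rw [opProd, bracketSum, expand_eq_sum h1 n l m 0 (by simpa using hm),
    expand_eq_sum h2 n m l 0 (by simpa using hl)]
  simp

lemma IsCreative.resProd {v₀ : V} {A B : VertexOperator ℂ V} (hA : IsCreative v₀ A)
    (hB : IsCreative v₀ B) (n : ℤ) : IsCreative v₀ (resProd A n B) := fun m hm => by
  rw [resProd_mode, opProd_vacuum hA hB n 0 hm le_rfl]

lemma resProd_vacuum {v₀ : V} {A B : VertexOperator ℂ V} (hA : IsCreative v₀ A)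
    (hB : IsCreative v₀ B) (n : ℤ) :
    mode (resProd A n B) (-1) v₀ = mode A n (mode B (-1) v₀) := by
  have h1 : ∀ p q, 0 ≤ q → mode A p (mode B q v₀) = 0 := fun p q h => by rw [hB q h, map_zero]
  have h2 : ∀ p q, 0 ≤ q → mode B p (mode A q v₀) = 0 := fun p q h => by rw [hA q h, map_zero]
  rw [resProd_mode, opProd, bracketSum, expand_eq_sum h1 n 0 (-1) 1 (by simp),
    expand_eq_sum h2 n (-1) 0 0 (by simp)]
  simp [binomSign_zero_right]

lemma IsCovariant.resProd {T : Module.End ℂ V} {A B : VertexOperator ℂ V} (hA : IsCovariant T A)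
    (hB : IsCovariant T B) (n : ℤ) : IsCovariant T (resProd A n B) := by
  have key : ∀ A B : VertexOperator ℂ V, IsCovariant T A → IsCovariant T B → ∀ n l m v,
      T (expand (fun p q => mode A p (mode B q v)) n l m) =
        expand (fun p q => mode A p (mode B q (T v))) n l m -
        (l • expand (fun p q => mode A p (mode B q v)) n (l - 1) m +
          m • expand (fun p q => mode A p (mode B q v)) n l (m - 1)) := by
    intro A B hA hB n l m v
    have t := trunc_comp A B v
    have t' : Trunc fun p q => p • mode A (p - 1) (mode B q v) +
        q • mode A p (mode B (q - 1) v) := by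
      obtain ⟨Q, hQ⟩ := exists_mode_eq_zero B v
      exact ⟨Q + 1, fun p q h => by simp [hQ q (by omega), hQ (q - 1) (by omega)]⟩
    rw [← expand_deriv t, ← expand_sub (trunc_comp A B (T v)) t']
    refine (expand_map T.toAddMonoidHom t n l m).trans ?_
    congr 1
    ext p q
    simp only [LinearMap.toAddMonoidHom_coe]
    rw [hA, hB, map_sub, map_zsmul]
    abel
  intro m v
  rw [resProd_mode, resProd_mode, resProd_mode]
  simp only [opProd, bracketSum, map_sub, map_zsmul, key A B hA hB, key B A hB hA, zero_smul,
    zero_add, add_zero, smul_sub, smul_comm m]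
  abel

lemma idField_isCreative (v₀ : V) : IsCreative v₀ (idField : VertexOperator ℂ V) := fun n hn => by
  rw [idField_mode, if_neg (by omega)]

lemma idField_isCovariant (T : Module.End ℂ V) :
    IsCovariant T (idField : VertexOperator ℂ V) := fun n v => by
  rw [idField_mode, idField_mode, idField_mode]
  rcases eq_or_ne n 0 with rfl | hn
  · simp
  · rw [if_neg (show ¬ n - 1 = -1 by omega)]; split_ifs <;> simp

/-- Fields that are creative, translation covariant, and local with respect to `S`. -/
def goodFields (v₀ : V) (T : Module.End ℂ V) (S : Set (VertexOperator ℂ V)) :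
    Submodule ℂ (VertexOperator ℂ V) where
  carrier := {A | IsCreative v₀ A ∧ IsCovariant T A ∧ ∀ C ∈ S, IsLocal A C}
  add_mem' {A B} hA hB := by
    refine ⟨fun n hn => ?_, fun n v => ?_, fun C hC => (hA.2.2 C hC).add (hB.2.2 C hC)⟩
    · rw [mode_add, hA.1 n hn, hB.1 n hn, add_zero]
    · simp only [mode_add, map_add, smul_add, hA.2.1 n v, hB.2.1 n v]; abel
  zero_mem' := by
    refine ⟨fun n hn => ?_, fun n v => ?_, fun C hC => ?_⟩
    · simp [mode]
    · simp [mode]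
    · exact isLocal_of_commute fun l m v => by simp [mode]
  smul_mem' r A hA := by
    refine ⟨fun n hn => ?_, fun n v => ?_, fun C hC => (hA.2.2 C hC).smul r⟩
    · rw [mode_smul, hA.1 n hn, smul_zero]
    · simp only [mode_smul, map_smul, hA.2.1 n v, smul_sub, smul_comm r n]

/-- Goddard's uniqueness principle. -/
lemma goddard {v₀ : V} {T : Module.End ℂ V} {S : Set (VertexOperator ℂ V)} (hT : T v₀ = 0)
    (hgen : ∀ W : Submodule ℂ V, v₀ ∈ W → (∀ A ∈ S, ∀ n, ∀ w ∈ W, mode A n w ∈ W) → W = ⊤)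
    {D : VertexOperator ℂ V} (hD : D ∈ goodFields v₀ T S) (h0 : mode D (-1) v₀ = 0) : D = 0 := by
  obtain ⟨h1, h2, h3⟩ := hD
  have hvac : ∀ k : ℕ, mode D (-1 - k) v₀ = 0 := by
    intro k
    induction k with
    | zero => simpa using h0
    | succ k ih =>
      have := h2 (-1 - k) v₀
      rw [ih, hT, map_zero, map_zero, zero_sub, eq_comm, neg_eq_zero, ← Int.cast_smul_eq_zsmul ℂ,
        smul_eq_zero] at this
      rcases this with h | h
      · exfalso
        have : (-1 - (k : ℤ)) = 0 := by exact_mod_cast h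
        omega
      · push_cast; rw [← sub_sub]; exact h
  have hvac' : ∀ n : ℤ, mode D n v₀ = 0 := by
    intro n
    rcases le_or_gt 0 n with hn | hn
    · exact h1 n hn
    · have := hvac (-1 - n).toNat
      rwa [show -1 - ((-1 - n).toNat : ℤ) = n by omega] at this
  set W : Submodule ℂ V := ⨅ n : ℤ, LinearMap.ker (mode D n) with hW
  have hWm : ∀ u, u ∈ W ↔ ∀ n, mode D n u = 0 := by
    intro u; simp [hW, Submodule.mem_iInf]
  have hWtop : W = ⊤ := by
    refine hgen W ((hWm _).2 hvac') fun A hA m u hu => (hWm _).2 fun n => ?_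
    rw [hWm] at hu
    obtain ⟨N, hN⟩ := (h3 A hA).symm
    obtain ⟨L, hL⟩ := exists_mode_eq_zero A u
    have hbound : ∀ k : ℕ, ∀ l m, L ≤ l → opProd A D k l m u = 0 := by
      intro k
      induction k with
      | zero => intro l m hl; rw [Nat.cast_zero, opProd_zero, hu, hL l hl]; simp
      | succ k ih =>
        intro l m hl
        push_cast
        rw [opProd_pascal, ih _ _ (by omega), ih _ _ hl, sub_zero]
    have hdown : ∀ k : ℕ, (∀ l m, opProd A D k l m u = 0) → ∀ l m, opProd A D 0 l m u = 0 := by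
      intro k
      induction k with
      | zero => exact fun h => h
      | succ k ih =>
        intro h
        refine ih (eq_zero_of_shift (hbound k) fun l m => ?_)
        have := h l m
        push_cast at this
        rwa [opProd_pascal, sub_eq_zero] at this
    have := hdown N (fun l m => hN l m u) m n
    rw [opProd_zero, hu, map_zero, zero_sub, neg_eq_zero] at this
    exact this
  refine ext_modes fun n v => ?_
  have hv : v ∈ W := by rw [hWtop]; trivial
  rw [(hWm v).1 hv n]
  simp [mode]

section Reconstruction

variable {v₀ : V} {T : Module.End ℂ V} {S : Set (VertexOperator ℂ V)}

lemma goodFields_of_generated (hTS : ∀ A ∈ S, IsCovariant T A) (hvac : ∀ A ∈ S, IsCreative v₀ A)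
    (hloc : ∀ A ∈ S, ∀ B ∈ S, IsLocal A B) {A : VertexOperator ℂ V} (hA : Generated S A) :
    A ∈ goodFields v₀ T S := by
  refine ⟨?_, ?_, generated_isLocal_base hloc hA⟩
  · induction hA with
    | id => exact idField_isCreative v₀
    | add A A' _ _ h1 h2 => exact fun n hn => by rw [mode_add, h1 n hn, h2 n hn, add_zero]
    | smul r A _ h1 => exact fun n hn => by rw [mode_smul, h1 n hn, smul_zero]
    | prod A n A' hA _ h2 => exact (hvac A hA).resProd h2 n
  · induction hA with
    | id => exact idField_isCovariant T
    | add A A' _ _ h1 h2 =>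
      exact fun n v => by simp only [mode_add, map_add, smul_add, h1 n v, h2 n v]; abel
    | smul r A _ h1 =>
      exact fun n v => by simp only [mode_smul, map_smul, h1 n v, smul_sub, smul_comm r n]
    | prod A n A' hA _ h2 => exact (hTS A hA).resProd h2 n

lemma exists_generated (hTS : ∀ A ∈ S, IsCovariant T A) (hvac : ∀ A ∈ S, IsCreative v₀ A)
    (hloc : ∀ A ∈ S, ∀ B ∈ S, IsLocal A B)
    (hgen : ∀ W : Submodule ℂ V, v₀ ∈ W → (∀ A ∈ S, ∀ n, ∀ w ∈ W, mode A n w ∈ W) → W = ⊤)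
    (a : V) : ∃ A, Generated S A ∧ mode A (-1) v₀ = a := by
  let W : Submodule ℂ V :=
    { carrier := {a | ∃ A, Generated S A ∧ mode A (-1) v₀ = a}
      add_mem' := by
        rintro a b ⟨A, hA, rfl⟩ ⟨B, hB, rfl⟩
        exact ⟨A + B, .add A B hA hB, mode_add A B _ _⟩
      zero_mem' := ⟨(0 : ℂ) • idField, .smul 0 _ .id, by rw [mode_smul, zero_smul]⟩
      smul_mem' := by
        rintro r a ⟨A, hA, rfl⟩
        exact ⟨r • A, .smul r A hA, mode_smul r A _ _⟩ }
  have : W = ⊤ := by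
    refine hgen W ⟨idField, .id, by simp [idField_mode]⟩ ?_
    rintro A hA n w ⟨B, hB, rfl⟩
    exact ⟨resProd A n B, .prod A n B hA hB,
      resProd_vacuum (hvac A hA) (goodFields_of_generated hTS hvac hloc hB).1 n⟩
  have ha : a ∈ W := by rw [this]; trivial
  exact ha

/-- Evaluation of a field on the vacuum. -/
def evalVacuum (v₀ : V) (T : Module.End ℂ V) (S : Set (VertexOperator ℂ V)) :
    goodFields v₀ T S →ₗ[ℂ] V where
  toFun A := mode A.1 (-1) v₀
  map_add' A B := mode_add A.1 B.1 _ _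
  map_smul' r A := mode_smul r A.1 _ _

lemma evalVacuum_bijective (hT : T v₀ = 0) (hTS : ∀ A ∈ S, IsCovariant T A)
    (hvac : ∀ A ∈ S, IsCreative v₀ A) (hloc : ∀ A ∈ S, ∀ B ∈ S, IsLocal A B)
    (hgen : ∀ W : Submodule ℂ V, v₀ ∈ W → (∀ A ∈ S, ∀ n, ∀ w ∈ W, mode A n w ∈ W) → W = ⊤) :
    Function.Bijective (evalVacuum v₀ T S) := by
  have hinj : Function.Injective (evalVacuum v₀ T S) := by
    rw [injective_iff_map_eq_zero]
    exact fun D hD => Subtype.ext (goddard hT hgen D.2 hD)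
  have hsurj : Function.Surjective (evalVacuum v₀ T S) := fun a => by
    obtain ⟨A, hA, h⟩ := exists_generated hTS hvac hloc hgen a
    exact ⟨⟨A, goodFields_of_generated hTS hvac hloc hA⟩, h⟩
  exact ⟨hinj, hsurj⟩

/-- The reconstruction theorem: mutually local, creative, translation covariant fields that
generate `V` from the vacuum make `V` a vertex algebra. The field `Y a` is the unique creative,
translation covariant field that is local with respect to `S` and sends the vacuum to `a`. -/
@[reducible] def reconstruct (hT : T v₀ = 0) (hTS : ∀ A ∈ S, IsCovariant T A)
    (hvac : ∀ A ∈ S, IsCreative v₀ A) (hloc : ∀ A ∈ S, ∀ B ∈ S, IsLocal A B)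
    (hgen : ∀ W : Submodule ℂ V, v₀ ∈ W → (∀ A ∈ S, ∀ n, ∀ w ∈ W, mode A n w ∈ W) → W = ⊤) :
    VertexAlgebra V :=
  let e := LinearEquiv.ofBijective (evalVacuum v₀ T S) (evalVacuum_bijective hT hTS hvac hloc hgen)
  have he : ∀ a, mode (e.symm a).1 (-1) v₀ = a := fun a => e.apply_symm_apply a
  have huniq : ∀ A ∈ goodFields v₀ T S, (e.symm (mode A (-1) v₀)).1 = A := fun A hA =>
    congrArg Subtype.val (e.symm_apply_apply ⟨A, hA⟩)
  have hgen' : ∀ a, Generated S (e.symm a).1 := fun a => by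
    obtain ⟨A, hA, h⟩ := exists_generated hTS hvac hloc hgen a
    rw [← h, huniq A (goodFields_of_generated hTS hvac hloc hA)]
    exact hA
  have hlocal : ∀ a b, IsLocal (e.symm a).1 (e.symm b).1 := fun a b =>
    generated_isLocal hloc (hgen' a) (hgen' b)
  { vacuum := v₀
    Y := (goodFields v₀ T S).subtype ∘ₗ e.symm.toLinearMap
    vacuum_mode := fun n b => by
      have h := huniq idField (goodFields_of_generated hTS hvac hloc .id)
      rw [idField_mode, if_pos rfl] at h
      change mode (e.symm v₀).1 n b = _
      rw [h, idField_mode]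
    mode_vacuum := fun a n hn => (e.symm a).2.1 n hn
    creation := he
    borcherds := fun a b c l m n => by
      change ∑ᶠ j : ℕ, Ring.choose l j •
        mode (e.symm (mode (e.symm a).1 (n + j) b)).1 (l + m - j) c = _
      have hprod : ∀ k : ℤ, (e.symm (mode (e.symm a).1 k b)).1 =
          resProd (e.symm a).1 k (e.symm b).1 := fun k => by
        have hg : resProd (e.symm a).1 k (e.symm b).1 ∈ goodFields v₀ T S :=
          ⟨(e.symm a).2.1.resProd (e.symm b).2.1 k, (e.symm a).2.2.1.resProd (e.symm b).2.2.1 k,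
            fun C hC => (hlocal a b).resProd ((e.symm a).2.2.2 C hC) ((e.symm b).2.2.2 C hC) k⟩
        rw [← huniq _ hg, resProd_vacuum (e.symm a).2.1 (e.symm b).2.1, he]
      simp only [hprod, resProd_mode]
      obtain ⟨N, hN⟩ := (hlocal a b).exists_forall
      rw [borcherds_aux (R := fun n l m => opProd (e.symm a).1 (e.symm b).1 n l m c)
        (fun n l m hn => hN n hn l m c) (fun n l m => opProd_pascal _ _ n l m c)]
      exact bracketSum_eq_finsum (trunc_comp _ _ c) (trunc_comp _ _ c) n l m }

/-- The reconstructed vertex algebra has the given fields among its fields. -/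
lemma reconstruct_Y (hT : T v₀ = 0) (hTS : ∀ A ∈ S, IsCovariant T A)
    (hvac : ∀ A ∈ S, IsCreative v₀ A) (hloc : ∀ A ∈ S, ∀ B ∈ S, IsLocal A B)
    (hgen : ∀ W : Submodule ℂ V, v₀ ∈ W → (∀ A ∈ S, ∀ n, ∀ w ∈ W, mode A n w ∈ W) → W = ⊤)
    {A : VertexOperator ℂ V} (hA : A ∈ S) :
    (reconstruct hT hTS hvac hloc hgen).Y (mode A (-1) v₀) = A :=
  have h : A ∈ goodFields v₀ T S := ⟨hvac A hA, hTS A hA, fun B hB => hloc A hA B hB⟩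
  congrArg Subtype.val ((LinearEquiv.ofBijective (evalVacuum v₀ T S)
    (evalVacuum_bijective hT hTS hvac hloc hgen)).symm_apply_apply ⟨A, h⟩)

end Reconstruction

end FieldCalculus

namespace VertexAlgebra

open FieldCalculus

lemma finsum_sub_zero_mem {V : Type*} [AddCommGroup V] [Module ℂ V] {M : Submodule ℂ V} {f : ℕ → V} (hf : (Function.support f).Finite)
    (h : ∀ j, f (j + 1) ∈ M) : (∑ᶠ j, f j) - f 0 ∈ M := by
  obtain ⟨N, hN⟩ : ∃ N : ℕ, Function.support f ⊆ (Finset.range (N + 1) : Set ℕ) := by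
    obtain ⟨N, hN⟩ := hf.bddAbove
    exact ⟨N, fun j hj => by simpa [Nat.lt_succ_iff] using hN hj⟩
  rw [finsum_eq_sum_of_support_subset _ hN, Finset.sum_range_succ', add_sub_cancel_right]
  exact M.sum_mem fun j _ => h j

lemma finsum_mem' {V : Type*} [AddCommGroup V] [Module ℂ V] {M : Submodule ℂ V} {f : ℕ → V} (h : ∀ j, f j ∈ M) : (∑ᶠ j, f j) ∈ M :=
  finsum_induction (· ∈ M) M.zero_mem (fun _ _ => M.add_mem) h

variable {V : Type*} [AddCommGroup V] [Module ℂ V] [VertexAlgebra V]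

/-- The `n`-th product `a₍ₙ₎b`, as a bilinear map. -/
def nthProd (n : ℤ) : V →ₗ[ℂ] V →ₗ[ℂ] V :=
  LinearMap.proj n ∘ₗ VertexOperator.ncoeff ∘ₗ (Y : V →ₗ[ℂ] VertexOperator ℂ V)

lemma nthProd_apply (n : ℤ) (a b : V) : nthProd n a b = mode (Y a) n b := rfl

lemma borcherds_left_finite (a b c : V) (l m n : ℤ) :
    (Function.support fun j : ℕ =>
      Ring.choose l j • mode (Y (mode (Y a) (n + j) b)) (l + m - j) c).Finite := by
  obtain ⟨N, hN⟩ := exists_mode_eq_zero (Y a) b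
  refine (Set.finite_Iio (N - n).toNat).subset fun j hj => ?_
  by_contra h
  simp only [Set.mem_Iio, not_lt] at h
  exact hj (by simp [mode, hN (n + j) (by omega)])

lemma borcherds_right_finite (a b c : V) (l m n : ℤ) :
    (Function.support fun j : ℕ => ((-1) ^ j * Ring.choose n j) •
        (mode (Y a) (l + n - j) (mode (Y b) (m + j) c) -
          (n.negOnePow : ℤ) • mode (Y b) (m + n - j) (mode (Y a) (l + j) c))).Finite := by
  obtain ⟨N, hN⟩ := exists_mode_eq_zero (Y b) c
  obtain ⟨N', hN'⟩ := exists_mode_eq_zero (Y a) c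
  refine (Set.finite_Iio (max (N - m).toNat (N' - l).toNat)).subset fun j hj => ?_
  by_contra h
  simp only [Set.mem_Iio, not_lt] at h
  exact hj (by simp [hN (m + j) (by omega), hN' (l + j) (by omega)])

/-- The commutator formula. -/
lemma commutator (a b c : V) (l m : ℤ) :
    mode (Y a) l (mode (Y b) m c) - mode (Y b) m (mode (Y a) l c) =
      ∑ᶠ j : ℕ, Ring.choose l j • mode (Y (mode (Y a) j b)) (l + m - j) c := by
  have h := borcherds a b c l m 0
  rw [finsum_eq_single (fun j : ℕ => ((-1) ^ j * Ring.choose (0 : ℤ) j) • _) 0] at h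
  · simp only [zero_add] at h
    rw [h]
    simp
  · rintro (_ | j) hj
    · exact absurd rfl hj
    · simp [Ring.choose_zero_succ]

/-- The iterate formula. -/
lemma iterate (a b c : V) (m n : ℤ) :
    mode (Y (mode (Y a) n b)) m c = ∑ᶠ j : ℕ, ((-1) ^ j * Ring.choose n j) •
      (mode (Y a) (n - j) (mode (Y b) (m + j) c) -
        (n.negOnePow : ℤ) • mode (Y b) (m + n - j) (mode (Y a) j c)) := by
  have h := borcherds a b c 0 m n
  rw [finsum_eq_single (fun j : ℕ => Ring.choose (0 : ℤ) j • _) 0] at h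
  · simp only [zero_add] at h
    rw [← h]
    simp
  · rintro (_ | j) hj
    · exact absurd rfl hj
    · simp [Ring.choose_zero_succ]

variable (V) in
/-- `C₂(V)`, the linear span of all `a₍₋₂₎b`. -/
def C2 : Submodule ℂ V := Submodule.span ℂ {x | ∃ a b : V, nthProd (-2) a b = x}

lemma mode_neg_mem_C2 (k : ℕ) (a b : V) : mode (Y a) (-2 - k) b ∈ C2 V := by
  induction k generalizing a with
  | zero => exact Submodule.subset_span ⟨a, b, by simp [nthProd_apply]⟩
  | succ k ih =>
    have h := ih (mode (Y a) (-2) vacuum)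
    rw [iterate, finsum_eq_single _ (k + 1)] at h
    · rw [vacuum_mode, vacuum_mode, if_pos (by push_cast; omega), if_neg (by push_cast; omega),
        smul_zero, sub_zero, ← Int.cast_smul_eq_zsmul ℂ] at h
      have hne : ∀ j : ℕ, binomSign (-2) j = j + 1 := by
        intro j
        induction j with
        | zero => simp [binomSign_zero_right]
        | succ j ih =>
          have := binomSign_mul_succ (-2) j
          rw [ih] at this
          have h2 : ((j : ℤ) + 1) * (binomSign (-2) (j + 1) - (j + 2)) = 0 := by
            linear_combination this
          rcases mul_eq_zero.mp h2 with h3 | h3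
          · omega
          · push_cast; linarith
      refine (Submodule.smul_mem_iff _ ?_).mp h
      have := hne (k + 1)
      unfold binomSign at this
      rw [this]
      exact_mod_cast (by omega : k + 1 + 1 ≠ 0)
    · intro j hj
      rw [vacuum_mode, vacuum_mode, if_neg (by omega), if_neg (by omega)]
      simp

lemma mode_mem_C2 {n : ℤ} (hn : n ≤ -2) (a b : V) : mode (Y a) n b ∈ C2 V := by
  have := mode_neg_mem_C2 (-2 - n).toNat a b
  rwa [show -2 - ((-2 - n).toNat : ℤ) = n by omega] at this

/-- `C₂(V)` is stable under `a₍ₗ₎` for `l = -1, 0`. -/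
lemma mode_left_mem_C2 {l : ℤ} (hl : l = -1 ∨ l = 0) (a : V) {x : V} (hx : x ∈ C2 V) :
    mode (Y a) l x ∈ C2 V := by
  induction hx using Submodule.span_induction with
  | mem x hx =>
    obtain ⟨u, v, rfl⟩ := hx
    have h := commutator a u v l (-2)
    rw [sub_eq_iff_eq_add] at h
    rw [nthProd_apply, h]
    refine (C2 V).add_mem (finsum_mem' fun j => ?_) (mode_mem_C2 le_rfl _ _)
    exact (C2 V).toAddSubgroup.zsmul_mem (mode_mem_C2 (by omega) _ _) _
  | zero => rw [map_zero]; exact (C2 V).zero_mem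
  | add x y _ _ hx hy => rw [map_add]; exact (C2 V).add_mem hx hy
  | smul r x _ hx => rw [map_smul]; exact (C2 V).smul_mem r hx

/-- `C₂(V)₍ₘ₎V ⊆ C₂(V)` for `m = -1, 0`. -/
lemma mode_right_mem_C2 {m : ℤ} (hm : m = -1 ∨ m = 0) {x : V} (hx : x ∈ C2 V) (c : V) :
    mode (Y x) m c ∈ C2 V := by
  rw [← nthProd_apply]
  induction hx using Submodule.span_induction with
  | mem x hx =>
    obtain ⟨u, v, rfl⟩ := hx
    rw [nthProd_apply, nthProd_apply, iterate]
    refine finsum_mem' fun j => (C2 V).toAddSubgroup.zsmul_mem ?_ _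
    refine (C2 V).sub_mem (mode_mem_C2 (by omega) _ _) ?_
    exact (C2 V).toAddSubgroup.zsmul_mem (mode_mem_C2 (by omega) _ _) _
  | zero => rw [map_zero]; exact (C2 V).zero_mem
  | add x y _ _ hx hy => rw [map_add]; exact (C2 V).add_mem hx hy
  | smul r x _ hx => rw [map_smul]; exact (C2 V).smul_mem r hx

variable (V) in
/-- Zhu's `C₂`-algebra `R_V = V / C₂(V)`. -/
def ZhuC2 : Type _ := V ⧸ C2 V

namespace ZhuC2

instance : AddCommGroup (ZhuC2 V) := inferInstanceAs (AddCommGroup (V ⧸ C2 V))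

instance : Module ℂ (ZhuC2 V) := inferInstanceAs (Module ℂ (V ⧸ C2 V))

variable (V) in
/-- The projection `V → R_V`, `a ↦ ā`. -/
def mk : V →ₗ[ℂ] ZhuC2 V := (C2 V).mkQ

lemma mk_surjective : Function.Surjective (mk V) := (C2 V).mkQ_surjective

lemma mk_eq_mk {a b : V} : mk V a = mk V b ↔ a - b ∈ C2 V := Submodule.Quotient.eq _

/-- The bilinear map on `R_V` induced by the `n`-th product, for `n = -1, 0`. -/
def descend (n : ℤ) (hn : n = -1 ∨ n = 0) : ZhuC2 V →ₗ[ℂ] ZhuC2 V →ₗ[ℂ] ZhuC2 V :=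
  ((C2 V).liftQ ((C2 V).liftQ ((nthProd n).compr₂ (mk V)) fun x hx => by
      ext c
      exact (Submodule.Quotient.mk_eq_zero _).mpr (mode_right_mem_C2 hn hx c)).flip
    fun x hx => by
      ext a
      exact (Submodule.Quotient.mk_eq_zero _).mpr (mode_left_mem_C2 hn a hx)).flip

lemma descend_mk (n : ℤ) (hn : n = -1 ∨ n = 0) (a b : V) :
    descend n hn (mk V a) (mk V b) = mk V (nthProd n a b) := rfl

/-- The product `ā · b̄` is the class of `a₍₋₁₎b`. -/
instance : Mul (ZhuC2 V) := ⟨fun x y => descend (-1) (Or.inl rfl) x y⟩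

instance : One (ZhuC2 V) := ⟨mk V vacuum⟩

/-- The Poisson bracket: `{ā, b̄}` is the class of `a₍₀₎b`. -/
def poisson : ZhuC2 V →ₗ[ℂ] ZhuC2 V →ₗ[ℂ] ZhuC2 V := descend 0 (Or.inr rfl)

lemma mk_mul_mk (a b : V) : mk V a * mk V b = mk V (nthProd (-1) a b) := rfl

lemma poisson_mk (a b : V) : poisson (mk V a) (mk V b) = mk V (nthProd 0 a b) := rfl

protected lemma mul_comm (x y : ZhuC2 V) : x * y = y * x := by
  obtain ⟨a, rfl⟩ := mk_surjective x
  obtain ⟨b, rfl⟩ := mk_surjective y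
  rw [mk_mul_mk, mk_mul_mk, mk_eq_mk, nthProd_apply, nthProd_apply]
  have h := commutator a b vacuum (-1) (-1)
  rw [creation, creation] at h
  rw [h]
  exact finsum_mem' fun j => (C2 V).toAddSubgroup.zsmul_mem (mode_mem_C2 (by omega) _ _) _

protected lemma mul_assoc (x y z : ZhuC2 V) : x * y * z = x * (y * z) := by
  obtain ⟨a, rfl⟩ := mk_surjective x
  obtain ⟨b, rfl⟩ := mk_surjective y
  obtain ⟨c, rfl⟩ := mk_surjective z
  simp only [mk_mul_mk, nthProd_apply]
  rw [mk_eq_mk]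
  have hfin := borcherds_right_finite a b c 0 (-1) (-1)
  simp only [zero_add] at hfin
  have h := finsum_sub_zero_mem (M := C2 V) hfin fun j =>
    (C2 V).toAddSubgroup.zsmul_mem ((C2 V).sub_mem (mode_mem_C2 (by push_cast; omega) _ _)
      ((C2 V).toAddSubgroup.zsmul_mem (mode_mem_C2 (by push_cast; omega) _ _) _)) _
  rw [← iterate] at h
  have h0 : mode (Y b) (-1 + -1 - ((0 : ℕ) : ℤ)) (mode (Y a) ((0 : ℕ) : ℤ) c) ∈ C2 V :=
    mode_mem_C2 (by simp) _ _
  have h1 := (C2 V).add_mem h h0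
  simp only [pow_zero, Ring.choose_zero_right, mul_one, one_smul, Int.negOnePow_neg,
    Int.negOnePow_one, Nat.cast_zero, sub_zero, add_zero, Units.val_neg, Units.val_one, neg_smul,
    sub_neg_eq_add] at h1
  convert h1 using 1
  abel

protected lemma one_mul (x : ZhuC2 V) : 1 * x = x := by
  obtain ⟨a, rfl⟩ := mk_surjective x
  change mk V (mode (Y vacuum) (-1) a) = _
  rw [vacuum_mode, if_pos rfl]

instance : CommRing (ZhuC2 V) :=
  { (inferInstance : AddCommGroup (ZhuC2 V)) with
    mul := (· * ·)
    one := 1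
    left_distrib := fun x y z => map_add (descend (-1) (Or.inl rfl) x) y z
    right_distrib := fun x y z => LinearMap.map_add₂ (descend (-1) (Or.inl rfl)) x y z
    zero_mul := fun x => LinearMap.map_zero₂ (descend (-1) (Or.inl rfl)) x
    mul_zero := fun x => map_zero (descend (-1) (Or.inl rfl) x)
    mul_assoc := ZhuC2.mul_assoc
    one_mul := ZhuC2.one_mul
    mul_one := fun x => by rw [ZhuC2.mul_comm, ZhuC2.one_mul]
    mul_comm := ZhuC2.mul_comm }

instance : Algebra ℂ (ZhuC2 V) :=
  Algebra.ofModule (fun r x y => LinearMap.map_smul₂ (descend (-1) (Or.inl rfl)) r x y)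
    fun r x y => map_smul (descend (-1) (Or.inl rfl) x) r y

end ZhuC2

variable (V) in
/-- The closed points of the associated variety `X_V = Specm R_V`. For the finitely generated
`ℂ`-algebra `R_V` a maximal ideal is the same as a `ℂ`-algebra homomorphism `R_V → ℂ`. -/
abbrev AssociatedVariety : Type _ := ZhuC2 V →ₐ[ℂ] ℂ

/-- `x` and `y` are the end points of an integral curve of the Hamiltonian vector field `{f, ·}` of
some `f ∈ R_V`: a curve `γ` in `X_V` with `d/dt h(γ(t)) = {f, h}(γ(t))` for all `h ∈ R_V`. -/
def HamiltonianPath (x y : AssociatedVariety V) : Prop :=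
  ∃ (f : ZhuC2 V) (γ : ℝ → AssociatedVariety V), γ 0 = x ∧ γ 1 = y ∧
    ∀ t ∈ Set.Icc (0 : ℝ) 1, ∀ h : ZhuC2 V,
      HasDerivWithinAt (fun s => γ s h) (γ t (ZhuC2.poisson f h)) (Set.Icc 0 1) t

variable (V) in
/-- The symplectic leaves of `X_V`: two points lie in the same leaf if and only if they can be
joined by a path that is piecewise an integral curve of a Hamiltonian vector field. (`Quot`
divides by the equivalence relation generated by `HamiltonianPath`.) -/
def SymplecticLeaf : Type _ := Quot (HamiltonianPath (V := V))

variable (V) in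
/-- `V` is finitely strongly generated, that is, `R_V` is finitely generated. -/
def IsFinitelyStronglyGenerated : Prop := Algebra.FiniteType ℂ (ZhuC2 V)

variable (V) in
/-- A finitely strongly generated vertex algebra is quasi-lisse if its associated variety has only
finitely many symplectic leaves. -/
def IsQuasiLisse : Prop := IsFinitelyStronglyGenerated V ∧ Finite (SymplecticLeaf V)

/-- Two-sided ideals of a vertex algebra. -/
structure IsIdeal (I : Submodule ℂ V) : Prop where
  left : ∀ (n : ℤ) (a : V), ∀ x ∈ I, nthProd n a x ∈ I
  right : ∀ (n : ℤ), ∀ x ∈ I, ∀ a : V, nthProd n x a ∈ I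

/-- The sum of a family of ideals is an ideal. -/
lemma isIdeal_sSup {𝓘 : Set (Submodule ℂ V)} (h : ∀ I ∈ 𝓘, IsIdeal I) : IsIdeal (sSup 𝓘) where
  left n a := by
    change sSup 𝓘 ≤ (sSup 𝓘).comap (nthProd n a)
    exact sSup_le fun I hI x hx => (le_sSup hI : I ≤ _) ((h I hI).left n a x hx)
  right n x hx a := by
    have : sSup 𝓘 ≤ (sSup 𝓘).comap ((nthProd n).flip a) :=
      sSup_le fun I hI x hx => (le_sSup hI : I ≤ _) ((h I hI).right n x hx a)
    exact this hx

section Quotient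

variable {I : Submodule ℂ V} (hI : IsIdeal I)

/-- The field on `V / I` induced by `Y(a, z)`. -/
def quotientField (a : V) : VertexOperator ℂ (V ⧸ I) :=
  ofModes (fun n => I.mapQ I (nthProd n a) fun x hx => hI.left n a x hx) fun v => by
    obtain ⟨v, rfl⟩ := I.mkQ_surjective v
    obtain ⟨N, hN⟩ := exists_mode_eq_zero (Y a) v
    exact ⟨N, fun n hn => (congrArg I.mkQ (hN n hn)).trans (map_zero _)⟩

lemma quotientField_mode (a : V) (n : ℤ) (b : V) :
    mode (quotientField hI a) n (I.mkQ b) = I.mkQ (mode (Y a) n b) := by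
  rw [quotientField, ofModes_mode]; rfl

/-- The state-field correspondence of `V / I`. -/
def quotientY : V ⧸ I →ₗ[ℂ] VertexOperator ℂ (V ⧸ I) :=
  I.liftQ
    { toFun := quotientField hI
      map_add' := fun a b => ext_modes fun n v => by
        obtain ⟨v, rfl⟩ := I.mkQ_surjective v
        rw [mode_add, quotientField_mode, quotientField_mode, quotientField_mode, map_add,
          mode_add, map_add]
      map_smul' := fun r a => ext_modes fun n v => by
        obtain ⟨v, rfl⟩ := I.mkQ_surjective v
        rw [RingHom.id_apply, mode_smul, quotientField_mode, quotientField_mode, map_smul,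
          mode_smul, map_smul] }
    fun x hx => ext_modes fun n v => by
      obtain ⟨v, rfl⟩ := I.mkQ_surjective v
      refine (quotientField_mode hI x n v).trans ?_
      have h : I.mkQ (mode (Y x) n v) = 0 :=
        (Submodule.Quotient.mk_eq_zero _).mpr (hI.right n x hx v)
      rw [h]
      simp [mode]

lemma quotientY_mode (a : V) (n : ℤ) (b : V) :
    mode (quotientY hI (I.mkQ a)) n (I.mkQ b) = I.mkQ (mode (Y a) n b) :=
  quotientField_mode hI a n b

/-- The quotient vertex algebra `V / I`. -/
@[reducible] def quotient : VertexAlgebra (V ⧸ I) where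
  vacuum := I.mkQ vacuum
  Y := quotientY hI
  vacuum_mode n b := by
    obtain ⟨b, rfl⟩ := I.mkQ_surjective b
    rw [quotientY_mode, vacuum_mode]
    split_ifs <;> simp
  mode_vacuum a n hn := by
    obtain ⟨a, rfl⟩ := I.mkQ_surjective a
    rw [quotientY_mode, mode_vacuum a n hn, map_zero]
  creation a := by
    obtain ⟨a, rfl⟩ := I.mkQ_surjective a
    rw [quotientY_mode, creation]
  borcherds a b c l m n := by
    obtain ⟨a, rfl⟩ := I.mkQ_surjective a
    obtain ⟨b, rfl⟩ := I.mkQ_surjective b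
    obtain ⟨c, rfl⟩ := I.mkQ_surjective c
    simp only [quotientY_mode]
    have h1 := I.mkQ.toAddMonoidHom.map_finsum (borcherds_left_finite a b c l m n)
    have h2 := I.mkQ.toAddMonoidHom.map_finsum (borcherds_right_finite a b c l m n)
    rw [borcherds, h2] at h1
    simp only [LinearMap.toAddMonoidHom_coe, map_zsmul, map_sub] at h1
    exact h1.symm

end Quotient

end VertexAlgebra

namespace AffineVertexAlgebra

open scoped TensorProduct
open FieldCalculus

variable (𝔤 : Type*) [LieRing 𝔤] [LieAlgebra ℂ 𝔤] [FiniteDimensional ℂ 𝔤] [LieAlgebra.IsSimple ℂ 𝔤]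

/-- The minimum of `κ(α^∨, α^∨)` over all roots `α` with respect to Cartan subalgebras, where `κ` is
the Killing form; these numbers are positive integers. The minimum is attained at the coroots of the
long roots. -/
def minCorootNorm : ℕ :=
  sInf {n : ℕ | ∃ (H : LieSubalgebra ℂ 𝔤) (_ : H.IsCartanSubalgebra) (α : LieModule.Weight ℂ H 𝔤),
    α.IsNonZero ∧ killingForm ℂ 𝔤 (LieAlgebra.IsKilling.coroot α) (LieAlgebra.IsKilling.coroot α) = n}

/-- The normalized invariant form `(· | ·)`: the multiple of the Killing form for which the long roots
have squared length `2`. Since `(α^∨ | α^∨) = 4 / (α | α)`, this says that the smallest value of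
`(α^∨ | α^∨)` is `2`. -/
def normalizedForm : LinearMap.BilinForm ℂ 𝔤 := (2 / (minCorootNorm 𝔤 : ℂ)) • killingForm ℂ 𝔤

lemma neg_normalizedForm_lieInvariant : (-normalizedForm 𝔤).lieInvariant 𝔤 := by
  intro x y z
  have := LieModule.traceForm_lieInvariant ℂ 𝔤 𝔤 x y z
  simp only [normalizedForm, LinearMap.neg_apply, LinearMap.smul_apply, this, smul_neg]

lemma neg_normalizedForm_isSymm : (-normalizedForm 𝔤).IsSymm := by
  constructor
  intro x y
  simp [normalizedForm, LieModule.traceForm_comm ℂ 𝔤 𝔤 x y]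

/-- The affine Lie algebra `𝔤[t, t⁻¹] ⊕ ℂ K`, with
`[x tᵐ, y tⁿ] = [x, y] tᵐ⁺ⁿ + m δ_{m+n,0} (x | y) K` and `K` central. (Mathlib's residue cocycle of a
form `Φ` is `(x tᵐ, y tⁿ) ↦ n δ_{m+n,0} Φ(x, y)`, whence the sign.) -/
def AffineLieAlgebra : Type _ :=
  LieAlgebra.ofTwoCocycle (LieAlgebra.LoopAlgebra.twoCocycleOfBilinear ℂ ℤ 𝔤 (-normalizedForm 𝔤)
    (neg_normalizedForm_lieInvariant 𝔤) (neg_normalizedForm_isSymm 𝔤))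

instance : LieRing (AffineLieAlgebra 𝔤) :=
  inferInstanceAs (LieRing (LieAlgebra.ofTwoCocycle _))

instance : LieAlgebra ℂ (AffineLieAlgebra 𝔤) :=
  inferInstanceAs (LieAlgebra ℂ (LieAlgebra.ofTwoCocycle _))

/-- The underlying vector space of the affine Lie algebra. -/
def ofPair : (LieAlgebra.loopAlgebra ℂ ℤ 𝔤 × ℂ) ≃ₗ[ℂ] AffineLieAlgebra 𝔤 where
  toFun p := LieAlgebra.ofProd _ (p.1, (TrivialLieModule.equiv ℂ _ ℂ).symm p.2)
  invFun X := (((LieAlgebra.ofProd _).symm X).1,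
    TrivialLieModule.equiv ℂ _ ℂ ((LieAlgebra.ofProd _).symm X).2)
  map_add' _ _ := rfl
  map_smul' _ _ := rfl
  left_inv _ := rfl
  right_inv _ := rfl

variable {𝔤}

/-- The element `x tⁿ` of the affine Lie algebra. -/
def current (x : 𝔤) (n : ℤ) : AffineLieAlgebra 𝔤 :=
  ofPair 𝔤 (AddMonoidAlgebra.single n (1 : ℂ) ⊗ₜ[ℂ] x, 0)

variable (𝔤) in
/-- The central element `K` of the affine Lie algebra. -/
def centralElement : AffineLieAlgebra 𝔤 := ofPair 𝔤 (0, 1)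

lemma lie_ofPair (p q : LieAlgebra.loopAlgebra ℂ ℤ 𝔤 × ℂ) : ⁅ofPair 𝔤 p, ofPair 𝔤 q⁆ =
    ofPair 𝔤 (⁅p.1, q.1⁆,
      LieAlgebra.LoopAlgebra.residuePairing ℂ ℤ 𝔤 (-normalizedForm 𝔤) p.1 q.1) := by
  refine Eq.trans (LieAlgebra.bracket_ofTwoCocycle (x := ofPair 𝔤 p) (y := ofPair 𝔤 q)) ?_
  refine Equiv.congr_arg (Prod.ext rfl ?_)
  change _ + ⁅p.1, (TrivialLieModule.equiv ℂ (LieAlgebra.loopAlgebra ℂ ℤ 𝔤) ℂ).symm q.2⁆ -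
    ⁅q.1, (TrivialLieModule.equiv ℂ (LieAlgebra.loopAlgebra ℂ ℤ 𝔤) ℂ).symm p.2⁆ = _
  rw [trivial_lie_zero, trivial_lie_zero, add_zero, sub_zero]
  rfl

lemma lie_current (x y : 𝔤) (m n : ℤ) :
    ⁅current x m, current y n⁆ = current ⁅x, y⁆ (m + n) +
      (if m + n = 0 then (m : ℂ) * normalizedForm 𝔤 x y else 0) • centralElement 𝔤 := by
  rw [current, current, current, centralElement, lie_ofPair, ← map_smul, ← map_add]
  congr 1
  refine Prod.ext ?_ ?_
  · rw [Prod.fst_add, Prod.smul_fst, smul_zero, add_zero]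
    simp only [LieAlgebra.ExtendScalars.bracket_tmul,
      AddMonoidAlgebra.single_mul_single, mul_one]
  · rw [Prod.snd_add, zero_add, Prod.smul_snd, smul_eq_mul, mul_one]
    change LieAlgebra.LoopAlgebra.residuePairing ℂ ℤ 𝔤 (-normalizedForm 𝔤)
        (AddMonoidAlgebra.single m (1 : ℂ) ⊗ₜ[ℂ] x) (AddMonoidAlgebra.single n (1 : ℂ) ⊗ₜ[ℂ] y) = _
    rw [LieAlgebra.LoopAlgebra.residuePairing_apply_apply,
      LieAlgebra.LoopAlgebra.toFinsupp_single_tmul, LieAlgebra.LoopAlgebra.toFinsupp_single_tmul,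
      Finsupp.sum_single_index (by simp)]
    split_ifs with h
    · obtain rfl : m = -n := by omega
      simp
    · rw [Finsupp.single_eq_of_ne (by omega)]
      simp

lemma lie_centralElement (X : AffineLieAlgebra 𝔤) : ⁅X, centralElement 𝔤⁆ = 0 := by
  obtain ⟨p, rfl⟩ := (ofPair 𝔤).surjective X
  rw [centralElement, lie_ofPair]
  refine Eq.trans ?_ (map_zero (ofPair 𝔤))
  congr 1

lemma span_eq_top : Submodule.span ℂ
    ({X | ∃ (x : 𝔤) (n : ℤ), X = current x n} ∪ {centralElement 𝔤}) = ⊤ := by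
  rw [eq_top_iff]
  rintro X -
  obtain ⟨⟨f, c⟩, rfl⟩ := (ofPair 𝔤).surjective X
  have hc : ofPair 𝔤 (f, c) = ofPair 𝔤 (f, 0) + c • centralElement 𝔤 := by
    rw [centralElement, ← map_smul, ← map_add]
    simp
  rw [hc]
  refine Submodule.add_mem _ ?_ (Submodule.smul_mem _ _ (Submodule.subset_span (Or.inr rfl)))
  clear hc
  induction f using TensorProduct.induction_on with
  | zero => exact (map_zero (ofPair 𝔤)).symm ▸ Submodule.zero_mem _
  | add f g hf hg =>
    have := Submodule.add_mem _ hf hg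
    rwa [← map_add, Prod.mk_add_mk, add_zero] at this
  | tmul p x =>
    induction p using AddMonoidAlgebra.induction_linear with
    | zero =>
      rw [TensorProduct.zero_tmul]
      exact (map_zero (ofPair 𝔤)).symm ▸ Submodule.zero_mem _
    | add p q hp hq =>
      have := Submodule.add_mem _ hp hq
      rwa [← map_add, Prod.mk_add_mk, add_zero, ← TensorProduct.add_tmul] at this
    | single n r =>
      have := Submodule.smul_mem _ r (Submodule.subset_span (R := ℂ)
        (s := {X | ∃ (x : 𝔤) (n : ℤ), X = current x n} ∪ {centralElement 𝔤})
        (Or.inl ⟨x, n, rfl⟩))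
      rwa [current, ← map_smul, Prod.smul_mk, smul_zero, TensorProduct.smul_tmul',
        AddMonoidAlgebra.smul_single, smul_eq_mul, mul_one] at this

/-- The derivation `-d/dt` of the affine Lie algebra. -/
def derivation : AffineLieAlgebra 𝔤 →ₗ[ℂ] AffineLieAlgebra 𝔤 :=
  (ofPair 𝔤).toLinearMap ∘ₗ LinearMap.inl ℂ _ _ ∘ₗ
    (LinearMap.rTensor 𝔤 ((AddMonoidAlgebra.basis ℤ ℂ).constr ℂ
      fun n => AddMonoidAlgebra.single (n - 1) (-(n : ℂ)))) ∘ₗ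
    LinearMap.fst ℂ _ _ ∘ₗ (ofPair 𝔤).symm.toLinearMap

lemma derivation_current (x : 𝔤) (n : ℤ) :
    derivation (current x n) = -(n : ℂ) • current x (n - 1) := by
  have h : (AddMonoidAlgebra.single n (1 : ℂ)) = AddMonoidAlgebra.basis ℤ ℂ n := by simp
  simp only [derivation, current, LinearMap.comp_apply, LinearEquiv.coe_coe,
    LinearEquiv.symm_apply_apply, LinearMap.fst_apply, LinearMap.rTensor_tmul]
  rw [h, Module.Basis.constr_basis, ← map_smul, Prod.smul_mk, TensorProduct.smul_tmul',
    AddMonoidAlgebra.smul_single, smul_eq_mul, mul_one, smul_zero]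
  rfl

lemma derivation_centralElement : derivation (centralElement 𝔤) = 0 := by
  simp [derivation, centralElement]

lemma derivation_lie (X Y : AffineLieAlgebra 𝔤) :
    derivation ⁅X, Y⁆ = ⁅X, derivation Y⁆ + ⁅derivation X, Y⁆ := by
  have hX : X ∈ Submodule.span ℂ
    ({X | ∃ (x : 𝔤) (n : ℤ), X = current x n} ∪ {centralElement 𝔤}) := by
    rw [span_eq_top]; trivial
  have hY : Y ∈ Submodule.span ℂ
    ({X | ∃ (x : 𝔤) (n : ℤ), X = current x n} ∪ {centralElement 𝔤}) := by
    rw [span_eq_top]; trivial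
  induction hX using Submodule.span_induction with
  | zero => simp
  | add X X' _ _ h1 h2 => simp only [map_add, add_lie, h1, h2]; abel
  | smul r X _ h => simp only [map_smul, smul_lie, h, smul_add]
  | mem X hX =>
    induction hY using Submodule.span_induction with
    | zero => simp
    | add Y Y' _ _ h1 h2 => simp only [map_add, lie_add, h1, h2]; abel
    | smul r Y _ h => simp only [map_smul, lie_smul, h, smul_add]
    | mem Y hY =>
      rcases hY with ⟨y, n, rfl⟩ | hY
      · rcases hX with ⟨x, m, rfl⟩ | hX
        · simp only [lie_current, map_add, map_smul, derivation_current, derivation_centralElement,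
            lie_smul, smul_lie, smul_zero, add_zero, smul_add, smul_smul]
          rw [show m + (n - 1) = m + n - 1 by ring, show m - 1 + n = m + n - 1 by ring]
          push_cast
          rw [add_add_add_comm, ← add_smul, ← add_smul]
          rw [show (-(n : ℂ)) + -(m : ℂ) = -((m : ℂ) + n) by ring, left_eq_add]
          convert zero_smul ℂ _ using 2
          split_ifs with h
          · have : (m : ℂ) + n = 1 := by exact_mod_cast (by omega : m + n = 1)
            linear_combination (-(m : ℂ) * normalizedForm 𝔤 x y) * this
          · simp
        · obtain rfl : X = centralElement 𝔤 := hX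
          rw [← lie_skew, lie_centralElement, derivation_centralElement, derivation_current,
            lie_smul, ← lie_skew, lie_centralElement]
          simp
      · obtain rfl : Y = centralElement 𝔤 := hY
        rw [lie_centralElement, derivation_centralElement, lie_centralElement]
        simp

end AffineVertexAlgebra

namespace AffineVertexAlgebra

open scoped TensorProduct
open FieldCalculus

variable (𝔤 : Type*) [LieRing 𝔤] [LieAlgebra ℂ 𝔤] [FiniteDimensional ℂ 𝔤] [LieAlgebra.IsSimple ℂ 𝔤]
  (k : ℂ)

/-- The universal enveloping algebra of the affine Lie algebra. -/
abbrev AffineEnvelope : Type _ := UniversalEnvelopingAlgebra ℂ (AffineLieAlgebra 𝔤)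

/-- The left ideal of `U(ĝ)` generated by `𝔤[t]` and `K - k`. -/
def vacuumIdeal : Submodule (AffineEnvelope 𝔤) (AffineEnvelope 𝔤) :=
  Submodule.span _ ({u | ∃ (x : 𝔤) (n : ℕ), u = UniversalEnvelopingAlgebra.ι ℂ (current x n)} ∪
    {UniversalEnvelopingAlgebra.ι ℂ (centralElement 𝔤) - algebraMap ℂ _ k})

/-- The space of the universal affine vertex algebra `V^k(𝔤)`: the vacuum module
`U(ĝ) ⊗_{U(𝔤[t] ⊕ ℂK)} ℂ_k` of level `k`, that is, the quotient of `U(ĝ)` by the left ideal generated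
by `𝔤[t]` and `K - k`. -/
def Universal : Type _ := AffineEnvelope 𝔤 ⧸ vacuumIdeal 𝔤 k

namespace Universal

instance : AddCommGroup (Universal 𝔤 k) :=
  inferInstanceAs (AddCommGroup (AffineEnvelope 𝔤 ⧸ vacuumIdeal 𝔤 k))

instance : Module (AffineEnvelope 𝔤) (Universal 𝔤 k) :=
  inferInstanceAs (Module (AffineEnvelope 𝔤) (AffineEnvelope 𝔤 ⧸ vacuumIdeal 𝔤 k))

instance : Module ℂ (Universal 𝔤 k) :=
  inferInstanceAs (Module ℂ (AffineEnvelope 𝔤 ⧸ vacuumIdeal 𝔤 k))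

instance : IsScalarTower ℂ (AffineEnvelope 𝔤) (Universal 𝔤 k) :=
  inferInstanceAs (IsScalarTower ℂ (AffineEnvelope 𝔤) (AffineEnvelope 𝔤 ⧸ vacuumIdeal 𝔤 k))

/-- The projection `U(ĝ) → V^k(𝔤)`. -/
def proj : AffineEnvelope 𝔤 →ₗ[AffineEnvelope 𝔤] Universal 𝔤 k := (vacuumIdeal 𝔤 k).mkQ

/-- The vacuum vector, the class of `1`. -/
def vac : Universal 𝔤 k := proj 𝔤 k 1

attribute [local instance] LieRing.ofAssociativeRing

variable {𝔤 k}

lemma proj_surjective : Function.Surjective (proj 𝔤 k) := (vacuumIdeal 𝔤 k).mkQ_surjective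

lemma proj_eq_zero {u : AffineEnvelope 𝔤} (hu : u ∈ vacuumIdeal 𝔤 k) : proj 𝔤 k u = 0 :=
  (Submodule.Quotient.mk_eq_zero _).mpr hu

lemma smul_vac (u : AffineEnvelope 𝔤) : u • vac 𝔤 k = proj 𝔤 k u := by
  rw [vac, ← map_smul, smul_eq_mul, mul_one]

/-- A subalgebra of `U(ĝ)` that contains `ĝ` is everything. -/
lemma mem_of_contains_ι (A : Subalgebra ℂ (AffineEnvelope 𝔤))
    (h : ∀ X, UniversalEnvelopingAlgebra.ι ℂ X ∈ A) (u : AffineEnvelope 𝔤) : u ∈ A := by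
  let f : AffineLieAlgebra 𝔤 →ₗ⁅ℂ⁆ A :=
    { toFun := fun X => ⟨UniversalEnvelopingAlgebra.ι ℂ X, h X⟩
      map_add' := fun X Y => Subtype.ext (map_add _ X Y)
      map_smul' := fun r X => Subtype.ext (map_smul _ r X)
      map_lie' := fun {X Y} => Subtype.ext (LieHom.map_lie _ X Y) }
  have : A.val.comp (UniversalEnvelopingAlgebra.lift ℂ f) = AlgHom.id ℂ _ := by
    apply UniversalEnvelopingAlgebra.hom_ext
    ext X
    simp [f]
  have h2 := congrArg (fun g => g u) this
  simp only [AlgHom.comp_apply, AlgHom.id_apply] at h2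
  rw [← h2]
  exact (UniversalEnvelopingAlgebra.lift ℂ f u).2

/-- The action of the affine Lie algebra on the vacuum module. -/
def act (X : AffineLieAlgebra 𝔤) : Module.End ℂ (Universal 𝔤 k) :=
  Algebra.lsmul ℂ ℂ (Universal 𝔤 k) (UniversalEnvelopingAlgebra.ι ℂ X)

lemma act_apply (X : AffineLieAlgebra 𝔤) (v : Universal 𝔤 k) :
    act X v = UniversalEnvelopingAlgebra.ι ℂ X • v := rfl

lemma act_add (X Y : AffineLieAlgebra 𝔤) (v : Universal 𝔤 k) :
    act (X + Y) v = act X v + act Y v := by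
  simp only [act_apply, map_add, add_smul]

lemma act_smul (r : ℂ) (X : AffineLieAlgebra 𝔤) (v : Universal 𝔤 k) :
    act (r • X) v = r • act X v := by
  simp only [act_apply, map_smul, smul_assoc]

lemma act_lie (X Y : AffineLieAlgebra 𝔤) (v : Universal 𝔤 k) :
    act ⁅X, Y⁆ v = act X (act Y v) - act Y (act X v) := by
  simp only [act_apply, LieHom.map_lie, LieRing.of_associative_ring_bracket, sub_smul, mul_smul]

lemma act_current_vac (x : 𝔤) (n : ℤ) (hn : 0 ≤ n) : act (current x n) (vac 𝔤 k) = 0 := by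
  obtain ⟨n, rfl⟩ := Int.eq_ofNat_of_zero_le hn
  have h : UniversalEnvelopingAlgebra.ι ℂ (current x n) ∈ vacuumIdeal 𝔤 k :=
    Submodule.subset_span (Or.inl ⟨x, n, rfl⟩)
  rw [act_apply, smul_vac, proj_eq_zero h]

/-- A subspace that contains the vacuum and is stable under `ĝ` is everything. -/
lemma eq_top_of_stable (W : Submodule ℂ (Universal 𝔤 k)) (h0 : vac 𝔤 k ∈ W)
    (h : ∀ X, ∀ w ∈ W, act X w ∈ W) : W = ⊤ := by
  let A : Subalgebra ℂ (AffineEnvelope 𝔤) :=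
    { carrier := {u | ∀ w ∈ W, u • w ∈ W}
      mul_mem' := fun {a b} ha hb w hw => by rw [mul_smul]; exact ha _ (hb _ hw)
      add_mem' := fun {a b} ha hb w hw => by rw [add_smul]; exact W.add_mem (ha _ hw) (hb _ hw)
      algebraMap_mem' := fun r w hw => by rw [algebraMap_smul]; exact W.smul_mem r hw }
  rw [eq_top_iff]
  rintro v -
  obtain ⟨u, rfl⟩ := proj_surjective v
  rw [← smul_vac]
  exact mem_of_contains_ι A h u _ h0

lemma act_centralElement (v : Universal 𝔤 k) : act (centralElement 𝔤) v = k • v := by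
  let W : Submodule ℂ (Universal 𝔤 k) :=
    LinearMap.eqLocus (act (centralElement 𝔤)) (k • LinearMap.id)
  have hW : W = ⊤ := by
    refine eq_top_of_stable W ?_ ?_
    · have h : UniversalEnvelopingAlgebra.ι ℂ (centralElement 𝔤) - algebraMap ℂ _ k ∈
        vacuumIdeal 𝔤 k := Submodule.subset_span (Or.inr rfl)
      have h2 := proj_eq_zero h
      rw [map_sub, sub_eq_zero, ← smul_vac, ← smul_vac, algebraMap_smul] at h2
      exact h2
    · intro X w hw
      change act (centralElement 𝔤) (act X w) = k • act X w
      have hw : act (centralElement 𝔤) w = k • w := hw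
      have h := act_lie X (centralElement 𝔤) w
      rw [lie_centralElement, hw, map_smul, act_apply, map_zero, zero_smul, eq_comm,
        sub_eq_zero] at h
      exact h.symm
  have : v ∈ W := by rw [hW]; trivial
  exact this

/-- Commutation relations of the modes of the currents. -/
lemma act_current_comm (x y : 𝔤) (m n : ℤ) (v : Universal 𝔤 k) :
    act (current x m) (act (current y n) v) - act (current y n) (act (current x m) v) =
      act (current ⁅x, y⁆ (m + n)) v +
        (if m + n = 0 then (m : ℂ) * normalizedForm 𝔤 x y * k else 0) • v := by
  rw [← act_lie, lie_current, act_add, act_smul, act_centralElement, smul_smul, ite_mul, zero_mul]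

lemma exists_act_current_eq_zero (x : 𝔤) (v : Universal 𝔤 k) :
    ∃ N : ℤ, ∀ n, N ≤ n → act (current x n) v = 0 := by
  let W : Submodule ℂ (Universal 𝔤 k) :=
    { carrier := {v | ∀ x : 𝔤, ∃ N : ℤ, ∀ n, N ≤ n → act (current x n) v = 0}
      add_mem' := fun {v w} hv hw x => by
        obtain ⟨N, hN⟩ := hv x
        obtain ⟨N', hN'⟩ := hw x
        exact ⟨max N N', fun n hn => by
          rw [map_add, hN n (by omega), hN' n (by omega), add_zero]⟩
      zero_mem' := fun x => ⟨0, fun n _ => map_zero _⟩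
      smul_mem' := fun r v hv x => by
        obtain ⟨N, hN⟩ := hv x
        exact ⟨N, fun n hn => by rw [map_smul, hN n hn, smul_zero]⟩ }
  have hW : W = ⊤ := by
    refine eq_top_of_stable W (fun x => ⟨0, fun n hn => act_current_vac x n hn⟩) ?_
    intro X w hw
    have hX : X ∈ Submodule.span ℂ
        ({X | ∃ (x : 𝔤) (n : ℤ), X = current x n} ∪ {centralElement 𝔤}) := by
      rw [span_eq_top]; trivial
    induction hX using Submodule.span_induction with
    | zero => rw [act_apply, map_zero, zero_smul]; exact W.zero_mem
    | add X X' _ _ h1 h2 => rw [act_add]; exact W.add_mem h1 h2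
    | smul r X _ h => rw [act_smul]; exact W.smul_mem r h
    | mem X hX =>
      rcases hX with ⟨y, m, rfl⟩ | hX
      · intro x
        obtain ⟨N, hN⟩ := hw x
        obtain ⟨N', hN'⟩ := hw ⁅x, y⁆
        refine ⟨max (max N (N' - m)) (1 - m), fun n hn => ?_⟩
        have h := act_current_comm x y n m w
        rw [hN n (by omega), hN' (n + m) (by omega), if_neg (by omega), map_zero, sub_zero,
          zero_smul, add_zero] at h
        exact h
      · obtain rfl : X = centralElement 𝔤 := hX
        rw [act_centralElement]
        exact W.smul_mem k hw
  have : v ∈ W := by rw [hW]; trivial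
  exact this x

/-- The current `x(z) = ∑ (x tⁿ) z^(-n-1)`. -/
def currentField (x : 𝔤) : VertexOperator ℂ (Universal 𝔤 k) :=
  ofModes (fun n => act (current x n)) (exists_act_current_eq_zero x)

lemma currentField_mode (x : 𝔤) (n : ℤ) :
    mode (currentField x : VertexOperator ℂ (Universal 𝔤 k)) n = act (current x n) := by
  rw [currentField, ofModes_mode]

lemma currentField_isLocal (x y : 𝔤) :
    IsLocal (currentField x : VertexOperator ℂ (Universal 𝔤 k)) (currentField y) := by
  refine ⟨2, fun l m v => ?_⟩
  have h0 : ∀ l m, opProd (currentField x : VertexOperator ℂ (Universal 𝔤 k)) (currentField y) 0 l m v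
      = act (current ⁅x, y⁆ (l + m)) v +
        (if l + m = 0 then (l : ℂ) * normalizedForm 𝔤 x y * k else 0) • v := by
    intro l m
    rw [opProd_zero]
    simp only [currentField_mode]
    rw [act_current_comm]
  have h1 : ∀ l m, opProd (currentField x : VertexOperator ℂ (Universal 𝔤 k)) (currentField y) 1 l m v
      = (if l + m + 1 = 0 then normalizedForm 𝔤 x y * k else 0) • v := by
    intro l m
    rw [show (1 : ℤ) = 0 + 1 from rfl, opProd_pascal, h0, h0, show l + 1 + m = l + m + 1 by ring,
      show l + (m + 1) = l + m + 1 by ring, add_sub_add_left_eq_sub, ← sub_smul]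
    congr 1
    simp only [zero_add]
    split_ifs
    · push_cast; ring
    · ring
  rw [show ((2 : ℕ) : ℤ) = 1 + 1 from rfl, opProd_pascal, h1, h1,
    show l + 1 + m = l + (m + 1) by ring, sub_self]

section Translation

/-- Auxiliary action of `ĝ` on `V × V` used to construct the translation operator. -/
def pairAct : AffineLieAlgebra 𝔤 →ₗ⁅ℂ⁆ Module.End ℂ (Universal 𝔤 k × Universal 𝔤 k) where
  toFun X :=
    { toFun := fun v => (act X v.1, act X v.2 + act (derivation X) v.1)
      map_add' := fun v w => by ext <;> simp; abel
      map_smul' := fun r v => by ext <;> simp }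
  map_add' X Y := by
    refine LinearMap.ext fun v => Prod.ext ?_ ?_
    · simp [act_add]
    · simp [act_add]; abel
  map_smul' r X := by
    refine LinearMap.ext fun v => Prod.ext ?_ ?_
    · simp [act_smul]
    · simp [act_smul]
  map_lie' {X Y} := by
    refine LinearMap.ext fun v => Prod.ext ?_ ?_
    · simp [act_lie, LieRing.of_associative_ring_bracket]
    · simp [act_lie, act_add, derivation_lie, LieRing.of_associative_ring_bracket]; abel

/-- `u ↦ u · (|0⟩, 0)`. -/
def pairMap : AffineEnvelope 𝔤 →ₗ[ℂ] Universal 𝔤 k × Universal 𝔤 k :=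
  (LinearMap.applyₗ (vac 𝔤 k, (0 : Universal 𝔤 k))) ∘ₗ
    (UniversalEnvelopingAlgebra.lift ℂ (pairAct (𝔤 := 𝔤) (k := k))).toLinearMap

lemma pairMap_mul (u w : AffineEnvelope 𝔤) :
    pairMap (k := k) (u * w) = UniversalEnvelopingAlgebra.lift ℂ pairAct u (pairMap w) := by
  simp [pairMap]

lemma pairMap_vacuumIdeal {u : AffineEnvelope 𝔤} (hu : u ∈ vacuumIdeal 𝔤 k) :
    pairMap (k := k) u = 0 := by
  induction hu using Submodule.span_induction with
  | zero => exact map_zero _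
  | add x y _ _ hx hy => rw [map_add, hx, hy, add_zero]
  | smul a x _ hx => rw [smul_eq_mul, pairMap_mul, hx, map_zero]
  | mem u hu =>
    rcases hu with ⟨x, n, rfl⟩ | hu
    · change UniversalEnvelopingAlgebra.lift ℂ pairAct (UniversalEnvelopingAlgebra.ι ℂ _) _ = _
      rw [UniversalEnvelopingAlgebra.lift_ι_apply]
      refine Prod.ext ?_ ?_
      · exact act_current_vac x n (by omega)
      · change act (current x n) 0 + act (derivation (current x n)) (vac 𝔤 k) = 0
        rw [map_zero, zero_add, derivation_current, act_smul]
        rcases n with _ | n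
        · simp
        · rw [act_current_vac x _ (by push_cast; omega), smul_zero]
    · obtain rfl := hu
      rw [map_sub, sub_eq_zero]
      change UniversalEnvelopingAlgebra.lift ℂ pairAct (UniversalEnvelopingAlgebra.ι ℂ _) _ =
        UniversalEnvelopingAlgebra.lift ℂ pairAct _ _
      rw [UniversalEnvelopingAlgebra.lift_ι_apply, AlgHom.commutes]
      refine Prod.ext ?_ ?_
      · exact act_centralElement _
      · change act (centralElement 𝔤) 0 + act (derivation (centralElement 𝔤)) (vac 𝔤 k) =
          k • (0 : Universal 𝔤 k)
        rw [derivation_centralElement, act_apply, act_apply]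
        simp

variable (𝔤 k) in
/-- The translation operator. -/
def translation : Module.End ℂ (Universal 𝔤 k) :=
  ((vacuumIdeal 𝔤 k).restrictScalars ℂ).liftQ (LinearMap.snd ℂ _ _ ∘ₗ pairMap) fun u hu => by
    rw [LinearMap.mem_ker, LinearMap.comp_apply, pairMap_vacuumIdeal hu, map_zero]

lemma translation_vac : translation 𝔤 k (vac 𝔤 k) = 0 := by
  change (pairMap (k := k) (1 : AffineEnvelope 𝔤)).2 = 0
  simp [pairMap]

lemma translation_act (X : AffineLieAlgebra 𝔤) (v : Universal 𝔤 k) :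
    translation 𝔤 k (act X v) = act X (translation 𝔤 k v) + act (derivation X) v := by
  have hfst : ∀ u : AffineEnvelope 𝔤, (pairMap (k := k) u).1 = proj 𝔤 k u := by
    let A : Subalgebra ℂ (AffineEnvelope 𝔤) :=
      { carrier := {u | ∀ v : Universal 𝔤 k × Universal 𝔤 k,
          (UniversalEnvelopingAlgebra.lift ℂ pairAct u v).1 = u • v.1}
        mul_mem' := fun {a b} ha hb v => by
          rw [map_mul, Module.End.mul_apply, ha, hb, mul_smul]
        add_mem' := fun {a b} ha hb v => by
          rw [map_add, LinearMap.add_apply, Prod.fst_add, ha, hb, add_smul]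
        algebraMap_mem' := fun r v => by
          rw [AlgHom.commutes, algebraMap_smul]; rfl }
    intro u
    rw [← smul_vac]
    refine mem_of_contains_ι A (fun X v => ?_) u _
    rw [UniversalEnvelopingAlgebra.lift_ι_apply]
    rfl
  obtain ⟨u, rfl⟩ := proj_surjective v
  change (pairMap (k := k) (UniversalEnvelopingAlgebra.ι ℂ X * u)).2 =
    act X (pairMap (k := k) u).2 + _
  rw [pairMap_mul, UniversalEnvelopingAlgebra.lift_ι_apply]
  change _ + act (derivation X) (pairMap (k := k) u).1 = _
  rw [hfst]

end Translation

lemma isCovariant_of_mem_range : ∀ A ∈ Set.range currentField, IsCovariant (translation 𝔤 k) A := by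
  rintro _ ⟨x, rfl⟩ n v
  rw [currentField_mode, currentField_mode, translation_act, derivation_current, act_smul,
    neg_smul, ← sub_eq_add_neg, Int.cast_smul_eq_zsmul]

lemma isCreative_of_mem_range : ∀ A ∈ Set.range currentField, IsCreative (vac 𝔤 k) A := by
  rintro _ ⟨x, rfl⟩ n hn
  rw [currentField_mode]
  exact act_current_vac x n hn

lemma isLocal_of_mem_range : ∀ A ∈ Set.range (currentField (𝔤 := 𝔤) (k := k)),
    ∀ B ∈ Set.range currentField, IsLocal A B := by
  rintro _ ⟨x, rfl⟩ _ ⟨y, rfl⟩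
  exact currentField_isLocal x y

lemma eq_top_of_currentField_stable (W : Submodule ℂ (Universal 𝔤 k)) (h0 : vac 𝔤 k ∈ W)
    (h : ∀ A ∈ Set.range currentField, ∀ n, ∀ w ∈ W, mode A n w ∈ W) : W = ⊤ := by
  refine eq_top_of_stable W h0 fun X w hw => ?_
  have hX : X ∈ Submodule.span ℂ
      ({X | ∃ (x : 𝔤) (n : ℤ), X = current x n} ∪ {centralElement 𝔤}) := by
    rw [span_eq_top]; trivial
  induction hX using Submodule.span_induction with
  | zero => rw [act_apply, map_zero, zero_smul]; exact W.zero_mem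
  | add X X' _ _ h1 h2 => rw [act_add]; exact W.add_mem h1 h2
  | smul r X _ h => rw [act_smul]; exact W.smul_mem r h
  | mem X hX =>
    rcases hX with ⟨y, m, rfl⟩ | hX
    · have := h (currentField y) ⟨y, rfl⟩ m w hw
      rwa [currentField_mode] at this
    · obtain rfl : X = centralElement 𝔤 := hX
      rw [act_centralElement]
      exact W.smul_mem k hw

/-- The vertex algebra structure of `V^k(𝔤)`: the vacuum vector is the class of `1`, and the field
attached to `(x t⁻¹)|0⟩` is the current `x(z)`. -/
instance : VertexAlgebra (Universal 𝔤 k) :=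
  reconstruct translation_vac isCovariant_of_mem_range isCreative_of_mem_range isLocal_of_mem_range
    eq_top_of_currentField_stable

lemma vacuum_eq : VertexAlgebra.vacuum = vac 𝔤 k := rfl

lemma Y_current (x : 𝔤) :
    VertexAlgebra.Y (act (current x (-1)) (vac 𝔤 k)) = currentField x := by
  rw [← currentField_mode]
  exact reconstruct_Y translation_vac isCovariant_of_mem_range isCreative_of_mem_range
    isLocal_of_mem_range eq_top_of_currentField_stable ⟨x, rfl⟩

end Universal

end AffineVertexAlgebra

namespace AffineVertexAlgebra

variable (𝔤 : Type*) [LieRing 𝔤] [LieAlgebra ℂ 𝔤] [FiniteDimensional ℂ 𝔤] [LieAlgebra.IsSimple ℂ 𝔤]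
  (k : ℂ)

/-- The subspace of conformal weight `d` of `V^k(𝔤)`: the span of the vectors
`(x₁ tⁿ¹) ⋯ (xᵣ tⁿʳ)|0⟩` with `n₁ + ⋯ + nᵣ = -d`. -/
def weightSpace (d : ℤ) : Submodule ℂ (Universal 𝔤 k) :=
  Submodule.span ℂ {v | ∃ l : List (𝔤 × ℤ), (l.map Prod.snd).sum = -d ∧
    v = l.foldr (fun p w => Universal.act (current p.1 p.2) w) (Universal.vac 𝔤 k)}

/-- A subspace of `V^k(𝔤)` is graded if it is the sum of its intersections with the weight spaces. -/
def IsGraded (I : Submodule ℂ (Universal 𝔤 k)) : Prop := I = ⨆ d, I ⊓ weightSpace 𝔤 k d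

/-- The maximal graded ideal of `V^k(𝔤)`, that is, the sum of all proper graded ideals. -/
def maximalIdeal : Submodule ℂ (Universal 𝔤 k) :=
  sSup {I | VertexAlgebra.IsIdeal I ∧ IsGraded 𝔤 k I ∧ I ≠ ⊤}

lemma maximalIdeal_isIdeal : VertexAlgebra.IsIdeal (maximalIdeal 𝔤 k) :=
  VertexAlgebra.isIdeal_sSup fun _ hI => hI.1

/-- The simple affine vertex algebra `V_k(𝔤)`, the unique simple graded quotient of `V^k(𝔤)`. -/
def Simple : Type _ := Universal 𝔤 k ⧸ maximalIdeal 𝔤 k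

instance : AddCommGroup (Simple 𝔤 k) :=
  inferInstanceAs (AddCommGroup (Universal 𝔤 k ⧸ maximalIdeal 𝔤 k))

instance : Module ℂ (Simple 𝔤 k) :=
  inferInstanceAs (Module ℂ (Universal 𝔤 k ⧸ maximalIdeal 𝔤 k))

instance : VertexAlgebra (Simple 𝔤 k) := VertexAlgebra.quotient (maximalIdeal_isIdeal 𝔤 k)

variable {𝔤 k} in
/-- The image in `V_k(𝔤)` of the vector `(x t⁻¹)|0⟩`. -/
def currentVector (x : 𝔤) : Simple 𝔤 k :=
  (maximalIdeal 𝔤 k).mkQ (Universal.act (current x (-1)) (Universal.vac 𝔤 k))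

/-- The associated variety of `V_k(𝔤)` as a subset of `𝔤`. A point `χ` of `Specm R_{V_k(𝔤)}` gives
the linear form `y ↦ χ(class of (y t⁻¹)|0⟩)` on `𝔤`, and `𝔤` is identified with its dual by means of
the invariant form. -/
def associatedVariety : Set 𝔤 :=
  {x | ∃ χ : VertexAlgebra.AssociatedVariety (Simple 𝔤 k),
    ∀ y : 𝔤, normalizedForm 𝔤 x y = χ (VertexAlgebra.ZhuC2.mk _ (currentVector y))}

/-- The nilpotent cone of `𝔤`. -/
def nilpotentCone : Set 𝔤 := {x | IsNilpotent (LieAlgebra.ad ℂ 𝔤 x)}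

end AffineVertexAlgebra

end

/-! Let R be the C₂-algebra of V_k(𝔤). In R the modes x tⁿ with n ≤ -2 vanish and x t⁻¹ acts by
multiplication, so R is generated by the image of 𝔤, with bracket {x, y} = [x, y]
(`adjoin_range_zhuCurrent`, `poisson_zhuCurrent`). Finite strong generation is therefore automatic,
and X_V embeds in 𝔤 (`point_injective`). The Hamiltonian flow of the generator attached to y moves
points by the inverse of exp(ad y) (`exists_hamiltonianPath`). Hence X_V is stable under the group G
generated by such exponentials, and each G-orbit in X_V lies in one leaf.

Suppose X_V consists of nilpotent elements. It is enough that 𝔤 has finitely many nilpotent G-orbits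
(`exists_finite_nilpotent_classification`). To a nilpotent e one attaches a semisimple s with [s, e]
= 2e, with bounded integral eigenvalues, and with ad e : 𝔤₀ → 𝔤₂ onto (`exists_grading_element`). No
full sl₂-triple is needed: s is the semisimple part of some h = [e, f] with [h, e] = 2e. After
conjugation s lies in a fixed Cartan subalgebra, where integrality leaves finitely many choices. For
a given s the elements e with the surjectivity property form one orbit: orbits are open by the
inverse function theorem, and a complex line through two such elements leaves the set at finitely
many points only (`eventually_line_exists_exp`, `rel_of_line_connected`). The same combination of
openness and connectedness proves that Cartan subalgebras are conjugate and that semisimple elements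
can be moved into a given one.

Suppose conversely that there are finitely many leaves. The function x ↦ tr (ad x)^m on X_V comes
from a Poisson-central element of R (`trace_zhuMatrix_pow_central`), so it is constant on leaves and
takes finitely many values. Because V_k(𝔤) is a graded quotient, the rescaling of t descends to R,
and X_V is stable under nonzero scalars (`exists_point_eq_smul`). Scaling x by r multiplies the
function by r^m, so for m > 0 it vanishes, and an operator whose positive powers are all traceless
is nilpotent. -/

namespace QuasiLisse

open Module

/-! ### Nilpotency criteria from traces and commutators -/

section LinearAlgebra

variable {V : Type*} [AddCommGroup V] [Module ℂ V]

section FiniteDimensional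

variable [FiniteDimensional ℂ V]

/-- A complex endomorphism all of whose eigenvalues vanish is nilpotent. -/
lemma isNilpotent_of_forall_eigenvalue {f : End ℂ V}
    (h : ∀ (μ : ℂ) (v : V), v ≠ 0 → f v = μ • v → μ = 0) : IsNilpotent f := by
  rw [LinearMap.isNilpotent_iff_charpoly]
  have hs := (IsAlgClosed.splits f.charpoly).eq_prod_roots_of_monic f.charpoly_monic
  have hr : f.charpoly.roots = Multiset.replicate (finrank ℂ V) 0 := by
    rw [Multiset.eq_replicate]
    refine ⟨?_, fun μ hμ => ?_⟩
    · rw [← f.charpoly_natDegree]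
      exact ((IsAlgClosed.splits f.charpoly).natDegree_eq_card_roots).symm
    · have h1 : f.HasEigenvalue μ := by
        rw [End.hasEigenvalue_iff_isRoot_charpoly]
        exact (Polynomial.mem_roots'.mp hμ).2
      obtain ⟨v, hv⟩ := h1.exists_hasEigenvector
      exact h μ v hv.2 hv.apply_eq_smul
  rw [hs, hr]
  simp

/-- An endomorphism in characteristic zero is nilpotent if the traces of its powers vanish. -/
lemma isNilpotent_of_forall_trace_pow {f : End ℂ V}
    (h : ∀ m : ℕ, 0 < m → LinearMap.trace ℂ V (f ^ m) = 0) : IsNilpotent f := by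
  have hpoly : ∀ p : Polynomial ℂ,
      LinearMap.trace ℂ V (Polynomial.aeval f (Polynomial.X * p)) = 0 := by
    intro p
    induction p using Polynomial.induction_on' with
    | add p q hp hq => rw [mul_add, map_add, map_add, hp, hq, add_zero]
    | monomial n a =>
      rw [Polynomial.X_mul_monomial, Polynomial.aeval_monomial, ← Algebra.smul_def, map_smul,
        h _ n.succ_pos, smul_zero]
  -- The characteristic polynomial is X^a q with X not dividing q. The Bézout term divisible by
  -- X^(a+1) evaluates at f to an idempotent P by Cayley–Hamilton. It has no constant term, so P is
  -- traceless and hence zero. The exponent a + 1 keeps a factor X even when a = 0.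
  obtain ⟨q, hq, hq0⟩ := Polynomial.exists_eq_pow_rootMultiplicity_mul_and_not_dvd f.charpoly
    f.charpoly_monic.ne_zero 0
  set a := f.charpoly.rootMultiplicity 0
  rw [map_zero, sub_zero] at hq hq0
  have hco : IsCoprime ((Polynomial.X : Polynomial ℂ) ^ (a + 1)) q :=
    ((Polynomial.irreducible_X.coprime_iff_not_dvd).mpr hq0).pow_left
  obtain ⟨u, v, huv⟩ := hco
  set P := Polynomial.aeval f (u * Polynomial.X ^ (a + 1)) with hP
  set Q := Polynomial.aeval f (v * q) with hQ
  have hPQ : P + Q = 1 := by rw [hP, hQ, ← map_add, huv, map_one]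
  have hPQ0 : P * Q = 0 := by
    rw [hP, hQ, ← map_mul, show u * Polynomial.X ^ (a + 1) * (v * q) =
      u * v * Polynomial.X * (Polynomial.X ^ a * q) by ring, ← hq, map_mul,
      LinearMap.aeval_self_charpoly, mul_zero]
  have hid : IsIdempotentElem P := by
    have : Q = 1 - P := by rw [← hPQ]; abel
    rw [this, mul_sub, mul_one, sub_eq_zero] at hPQ0
    exact hPQ0.symm
  have hP0 : P = 0 := by
    refine LinearMap.IsIdempotentElem.eq_zero_of_trace_eq_zero hid ?_
    rw [hP, show u * Polynomial.X ^ (a + 1) = Polynomial.X * (u * Polynomial.X ^ a) by ring]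
    exact hpoly _
  refine ⟨a, ?_⟩
  have h1 : (Polynomial.aeval f) (Polynomial.X ^ a * (v * q)) = f ^ a := by
    rw [map_mul, ← hQ, ← zero_add Q, ← hP0, hPQ, mul_one]; simp
  rw [← h1, show Polynomial.X ^ a * (v * q) = v * (Polynomial.X ^ a * q) by ring, ← hq, map_mul,
    LinearMap.aeval_self_charpoly, mul_zero]

/-- Jacobson's lemma. -/
lemma isNilpotent_commutator {E U : End ℂ V} (h : Commute E (E * U - U * E)) :
    IsNilpotent (E * U - U * E) := by
  refine isNilpotent_of_forall_trace_pow fun m hm => ?_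
  obtain ⟨m, rfl⟩ := Nat.exists_eq_succ_of_ne_zero hm.ne'
  set C := E * U - U * E with hC
  -- As E commutes with C, every positive power of C is again a commutator with E, hence traceless.
  have h1 : C ^ (m + 1) = E * (U * C ^ m) - U * C ^ m * E := by
    rw [mul_assoc U, ← (h.pow_right m).eq, pow_succ', ← mul_assoc, ← mul_assoc, ← sub_mul]
  rw [Nat.succ_eq_add_one, h1, map_sub, LinearMap.trace_mul_comm, sub_self]

/-- If `E` is nilpotent and commutes with `[E, U]`, then `UE` is nilpotent. -/
lemma isNilpotent_mul_of_commute_commutator {E U : End ℂ V} (hE : IsNilpotent E)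
    (h : Commute E (E * U - U * E)) : IsNilpotent (U * E) := by
  obtain ⟨r, hr⟩ := isNilpotent_commutator h
  set C := E * U - U * E with hC
  have hpow : ∀ p : ℕ, E ^ (p + 1) * U = U * E ^ (p + 1) + ((p : ℂ) + 1) • (C * E ^ p) := by
    intro p
    induction p with
    | zero => simp [hC]
    | succ p ih =>
      have h2 : E * (C * E ^ p) = C * E ^ (p + 1) := by
        rw [← mul_assoc, h.eq, mul_assoc, ← pow_succ']
      have h3 : E * U = U * E + C := by rw [hC]; abel
      rw [pow_succ' E (p + 1), mul_assoc, ih, mul_add, mul_smul_comm, h2, ← mul_assoc, h3,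
        add_mul, mul_assoc]
      push_cast
      module
  -- Let v be an eigenvector of UE for μ ≠ 0 and E^p v = 0 with p minimal. For p ≥ 2, applying the
  -- power formula to E v shows that w = E^(p-1) v is an eigenvector of C for μ/(p-1), which
  -- contradicts the nilpotency of C.
  refine isNilpotent_of_forall_eigenvalue fun μ v hv hμ => ?_
  by_contra hμ0
  have hex : ∃ p, (E ^ p) v = 0 := by
    obtain ⟨n, hn⟩ := hE
    exact ⟨n, by rw [hn, LinearMap.zero_apply]⟩
  classical
  set p := Nat.find hex with hp
  have hp0 : (E ^ p) v = 0 := Nat.find_spec hex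
  have hpmin : ∀ q < p, (E ^ q) v ≠ 0 := fun q hq => Nat.find_min hex hq
  rcases hcase : p with _ | _ | p'
  · rw [hcase] at hp0; exact hv (by simpa using hp0)
  · rw [hcase, zero_add, pow_one] at hp0
    rw [Module.End.mul_apply, hp0, map_zero, eq_comm, smul_eq_zero] at hμ
    exact hμ.elim hμ0 hv
  · have h1 := congrArg (fun T => T (E v)) (hpow p')
    set w := (E ^ (p' + 1)) v with hw
    have hw0 : w ≠ 0 := hpmin _ (by omega)
    have e1 : (E ^ (p' + 1) * U) (E v) = μ • w := by
      rw [Module.End.mul_apply, ← Module.End.mul_apply U E, hμ, map_smul]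
    have e2 : (U * E ^ (p' + 1)) (E v) = 0 := by
      rw [Module.End.mul_apply, ← Module.End.mul_apply (E ^ (p' + 1)) E, ← pow_succ]
      rw [hcase] at hp0
      rw [hp0, map_zero]
    have e3 : (C * E ^ p') (E v) = C w := by
      rw [Module.End.mul_apply, ← Module.End.mul_apply (E ^ p') E, ← pow_succ]
    simp only [LinearMap.add_apply, LinearMap.smul_apply, e1, e2, e3, zero_add] at h1
    have hne : (p' : ℂ) + 1 ≠ 0 := by exact_mod_cast p'.succ_ne_zero
    have h4 : C w = (((p' : ℂ) + 1)⁻¹ * μ) • w := by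
      rw [mul_smul, h1, smul_smul, inv_mul_cancel₀ hne, one_smul]
    have h5 : ∀ j : ℕ, (C ^ j) w = (((p' : ℂ) + 1)⁻¹ * μ) ^ j • w := by
      intro j
      induction j with
      | zero => simp
      | succ j ih => rw [pow_succ', Module.End.mul_apply, ih, map_smul, h4, smul_smul, pow_succ]
    have h6 := h5 r
    rw [hr, LinearMap.zero_apply, eq_comm, smul_eq_zero] at h6
    exact h6.elim (pow_ne_zero _ (mul_ne_zero (inv_ne_zero hne) hμ0)) hw0

end FiniteDimensional

/-! ### Eigenvalues of H from [H, E] = 2E and [E, F] = H -/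

section Sl2

variable {H E F : End ℂ V}

/-- The relation [H, F] = -2F plays no role here; this is why an incomplete sl₂-triple suffices
later. -/
lemma pow_mul_sub_mul_pow (hHE : H * E - E * H = (2 : ℂ) • E) (hEF : E * F - F * E = H) (m : ℕ) :
    E ^ (m + 1) * F - F * E ^ (m + 1) = ((m : ℂ) + 1) • (H * E ^ m - (m : ℂ) • E ^ m) := by
  have hEH : E * H = H * E - (2 : ℂ) • E := by rw [← hHE]; abel
  have hEF' : E * F = F * E + H := by rw [← hEF]; abel
  induction m with
  | zero => simp [hEF]
  | succ m ih =>
    have h1 : E ^ (m + 1) * F = F * E ^ (m + 1) +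
        ((m : ℂ) + 1) • (H * E ^ m - (m : ℂ) • E ^ m) := by rw [← ih]; abel
    have h2 : E * (F * E ^ (m + 1)) = F * E ^ (m + 2) + H * E ^ (m + 1) := by
      rw [← mul_assoc, hEF', add_mul, mul_assoc, ← pow_succ']
    have h3 : E * (H * E ^ m) = H * E ^ (m + 1) - (2 : ℂ) • E ^ (m + 1) := by
      rw [← mul_assoc, hEH, sub_mul, mul_assoc, smul_mul_assoc, ← pow_succ']
    rw [pow_succ' E (m + 1), mul_assoc, h1, mul_add, mul_smul_comm, mul_sub, mul_smul_comm, h2,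
      h3, ← pow_succ', ← pow_succ']
    push_cast
    module

/-- Write z = E^i w with i as large as possible. The formula for [E^(i+1), F] applied to w gives
E^(i+1) F w = (i+1)(μ - i) z, so μ ≠ i would put z in the range of E^(i+1). -/
lemma eigenvalue_on_ker (hHE : H * E - E * H = (2 : ℂ) • E) (hEF : E * F - F * E = H) {n : ℕ}
    (hE : E ^ n = 0) {z : V} (hz : z ≠ 0) (hEz : E z = 0) {μ : ℂ} (hμ : H z = μ • z) :
    ∃ i < n, μ = (i : ℂ) := by
  classical
  have hex : ∃ i, ∀ w, (E ^ (i + 1)) w ≠ z := by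
    refine ⟨n, fun w hw => hz ?_⟩
    rw [← hw, pow_succ, hE, zero_mul, LinearMap.zero_apply]
  set i := Nat.find hex with hi
  have hspec : ∀ w, (E ^ (i + 1)) w ≠ z := Nat.find_spec hex
  have hw : ∃ w, (E ^ i) w = z := by
    rcases h0 : i with _ | j
    · exact ⟨z, by simp⟩
    · have := Nat.find_min hex (m := j) (by omega)
      push Not at this
      exact this
  obtain ⟨w, hw⟩ := hw
  have hin : i < n := by
    by_contra h
    refine hz ?_
    rw [← hw, show i = n + (i - n) by omega, pow_add, hE, zero_mul, LinearMap.zero_apply]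
  refine ⟨i, hin, ?_⟩
  by_contra hne
  have h1 := congrArg (fun T => T w) (pow_mul_sub_mul_pow hHE hEF i)
  simp only [LinearMap.sub_apply, LinearMap.smul_apply, Module.End.mul_apply, hw] at h1
  rw [pow_succ' E i, Module.End.mul_apply (E) (E ^ i) w, hw, hEz, map_zero, sub_zero, hμ,
    ← sub_smul, smul_smul, ← pow_succ'] at h1
  have hne2 : ((i : ℂ) + 1) * (μ - i) ≠ 0 :=
    mul_ne_zero (by exact_mod_cast i.succ_ne_zero) (sub_ne_zero.mpr hne)
  refine hspec ((((i : ℂ) + 1) * (μ - i))⁻¹ • F w) ?_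
  rw [map_smul, h1, smul_smul, inv_mul_cancel₀ hne2, one_smul]

/-- Apply E to v until the last nonzero vector E^k v. It lies in ker E with eigenvalue μ + 2k, a
natural number below n by the preceding lemma. Since k < n, a crude bound for |μ| is 2n. -/
lemma eigenvalue_integral (hHE : H * E - E * H = (2 : ℂ) • E) (hEF : E * F - F * E = H) {n : ℕ}
    (hE : E ^ n = 0) {v : V} (hv : v ≠ 0) {μ : ℂ} (hμ : H v = μ • v) :
    ∃ i : ℤ, i ∈ Finset.Icc (-(2 * n : ℤ)) (2 * n) ∧ μ = (i : ℂ) := by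
  classical
  have hex : ∃ k, (E ^ k) v = 0 := ⟨n, by rw [hE, LinearMap.zero_apply]⟩
  obtain ⟨k, hk⟩ : ∃ k, Nat.find hex = k + 1 := by
    rcases h0 : Nat.find hex with _ | k
    · have := Nat.find_spec hex
      rw [h0] at this
      exact absurd (by simpa using this) hv
    · exact ⟨k, rfl⟩
  have hkn : k + 1 ≤ n := hk ▸ Nat.find_min' hex (by rw [hE, LinearMap.zero_apply])
  have h0 : E ((E ^ k) v) = 0 := by
    have := Nat.find_spec hex
    rwa [hk, pow_succ', Module.End.mul_apply] at this
  have h1 : (E ^ k) v ≠ 0 := Nat.find_min hex (by omega)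
  have h2 : ∀ j : ℕ, H ((E ^ j) v) = (μ + 2 * j) • (E ^ j) v := by
    intro j
    induction j with
    | zero => simp [hμ]
    | succ j ih =>
      have h3 : H * E = E * H + (2 : ℂ) • E := by rw [← hHE]; abel
      have h4 := congrArg (fun T => T ((E ^ j) v)) h3
      simp only [Module.End.mul_apply, LinearMap.add_apply, LinearMap.smul_apply, ih, map_smul]
        at h4
      rw [pow_succ', Module.End.mul_apply, h4]
      push_cast
      module
  obtain ⟨i, hi, hi2⟩ := eigenvalue_on_ker hHE hEF hE h1 h0 (h2 k)
  refine ⟨i - 2 * k, ?_, ?_⟩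
  · rw [Finset.mem_Icc]; omega
  · push_cast
    rw [← hi2]; ring

end Sl2

/-- A vector orthogonal to the kernel of the adjoint operator lies in the range. -/
lemma mem_range_of_orthogonal [FiniteDimensional ℂ V] {B : LinearMap.BilinForm ℂ V}
    (hB : B.Nondegenerate) {A A' : End ℂ V} (hA : ∀ x y, B x (A y) = B (A' x) y) {v : V}
    (hv : ∀ u, A' u = 0 → B u v = 0) : v ∈ LinearMap.range A := by
  by_contra h
  obtain ⟨φ, hφ, hφ0⟩ := Submodule.exists_le_ker_of_notMem h
  obtain ⟨u, rfl⟩ := (B.toDual hB).surjective φ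
  refine hφ (hv u (hB.1 _ fun y => ?_))
  rw [← hA]
  exact hφ0 ⟨y, rfl⟩

end LinearAlgebra

end QuasiLisse

namespace QuasiLisse

open Module Filter Topology

/-! ### Exponentials of endomorphisms without a chosen norm -/

section Exponential

variable {V W : Type*} [AddCommGroup V] [Module ℂ V] [AddCommGroup W] [Module ℂ W]

/-- `S = exp T`, tested against linear functionals. -/
def IsExp (T S : End ℂ V) : Prop :=
  ∀ (φ : V →ₗ[ℂ] ℂ) (v : V),
    HasSum (fun n : ℕ => (n.factorial : ℂ)⁻¹ * φ ((T ^ n) v)) (φ (S v))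

lemma IsExp.zero : IsExp (0 : End ℂ V) 1 := fun φ v => by
  convert hasSum_single (f := fun n : ℕ => (n.factorial : ℂ)⁻¹ * φ (((0 : End ℂ V) ^ n) v)) 0
    fun n hn => ?_
  · simp
  · simp [zero_pow hn]

/-- A map intertwining T and T' intertwines their powers, hence the series. Uniqueness, restriction
to subspaces and compatibility with bilinear products all come from suitable choices of A. -/
lemma IsExp.intertwine {T S : End ℂ V} {T' S' : End ℂ W} (h : IsExp T S) (h' : IsExp T' S')
    {A : V →ₗ[ℂ] W} (hA : ∀ v, A (T v) = T' (A v)) (v : V) : A (S v) = S' (A v) := by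
  have hn : ∀ (n : ℕ) (v : V), A ((T ^ n) v) = (T' ^ n) (A v) := by
    intro n
    induction n with
    | zero => simp
    | succ n ih =>
      intro v
      rw [pow_succ, Module.End.mul_apply, ih, hA, pow_succ, Module.End.mul_apply]
  rw [← sub_eq_zero, ← Module.forall_dual_apply_eq_zero_iff ℂ]
  intro φ
  have h1 := h (φ ∘ₗ A) v
  simp only [LinearMap.comp_apply, hn] at h1
  rw [map_sub, h1.unique (h' φ (A v)), sub_self]

lemma IsExp.unique {T S S' : End ℂ V} (h : IsExp T S) (h' : IsExp T S') : S = S' :=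
  LinearMap.ext fun v => h.intertwine h' (A := LinearMap.id) (fun _ => rfl) v

lemma isExp_exp {E : Type*} [NormedAddCommGroup E] [NormedSpace ℂ E] [FiniteDimensional ℂ E]
    [CompleteSpace E] (T : E →L[ℂ] E) :
    IsExp (T : End ℂ E) (NormedSpace.exp T : E →L[ℂ] E) := by
  intro φ v
  have h := NormedSpace.exp_series_hasSum_exp' (𝕂 := ℂ) T
  have h2 := h.mapL ((LinearMap.toContinuousLinearMap φ).comp (ContinuousLinearMap.apply ℂ E v))
  have hpow : ∀ n, (T : End ℂ E) ^ n = ((T ^ n : E →L[ℂ] E) : End ℂ E) := by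
    intro n
    induction n with
    | zero => rfl
    | succ n ih => rw [pow_succ, ih, pow_succ]; rfl
  simp only [hpow]
  have h3 : ∀ n : ℕ, (n.factorial : ℂ)⁻¹ * φ (((T ^ n : E →L[ℂ] E) : End ℂ E) v) =
      (LinearMap.toContinuousLinearMap φ ∘SL ContinuousLinearMap.apply ℂ E v)
        ((n.factorial : ℂ)⁻¹ • T ^ n) := fun n => by
    rw [map_smul, smul_eq_mul]; rfl
  simp only [h3]
  exact h2

lemma isExp_conj (e : V ≃ₗ[ℂ] W) {T S : End ℂ W} (h : IsExp T S) :
    IsExp (e.symm.conj T) (e.symm.conj S) := by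
  intro φ v
  have h1 := h (φ ∘ₗ e.symm.toLinearMap) (e v)
  have : ∀ n, (e.symm.conj T) ^ n = e.symm.conj (T ^ n) := by
    intro n
    induction n with
    | zero => ext; simp [LinearEquiv.conj_apply]
    | succ n ih => rw [pow_succ, ih, pow_succ]; ext; simp [LinearEquiv.conj_apply]
  simp only [this]
  simpa [LinearEquiv.conj_apply] using h1

variable [FiniteDimensional ℂ V]

lemma exists_isExp (T : End ℂ V) : ∃ S, IsExp T S := by
  let e := (finBasis ℂ V).equivFun
  have := isExp_conj e (isExp_exp (LinearMap.toContinuousLinearMap (e.conj T)))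
  rw [show e.symm.conj (LinearMap.toContinuousLinearMap (e.conj T) : End ℂ (Fin _ → ℂ)) = T by
    ext; simp [LinearEquiv.conj_apply]] at this
  exact ⟨_, this⟩

lemma IsExp.add {T T' S S' : End ℂ V} (h : IsExp T S) (h' : IsExp T' S') (hc : Commute T T') :
    IsExp (T + T') (S * S') := by
  let e := (finBasis ℂ V).equivFun
  let c : End ℂ V → ((Fin (finrank ℂ V) → ℂ) →L[ℂ] (Fin (finrank ℂ V) → ℂ)) := fun T =>
    LinearMap.toContinuousLinearMap (e.conj T)
  have key : ∀ T, IsExp T (e.symm.conj (NormedSpace.exp (c T) : _ →L[ℂ] _)) := by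
    intro T
    have := isExp_conj e (isExp_exp (c T))
    rwa [show e.symm.conj (c T : End ℂ (Fin _ → ℂ)) = T by
      ext; simp [c, LinearEquiv.conj_apply]] at this
  rw [h.unique (key T), h'.unique (key T')]
  have hcc : Commute (c T) (c T') := by
    ext v : 1
    have := congrArg (fun T => e (T (e.symm v))) hc.eq
    simpa [c, LinearEquiv.conj_apply] using this
  let _ : NormedAlgebra ℚ ((Fin (finrank ℂ V) → ℂ) →L[ℂ] (Fin (finrank ℂ V) → ℂ)) :=
    NormedAlgebra.restrictScalars ℚ ℂ _
  have h2 := key (T + T')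
  rw [show c (T + T') = c T + c T' by simp [c], NormedSpace.exp_add_of_commute hcc] at h2
  convert h2 using 1
  ext v
  simp [LinearEquiv.conj_apply]

lemma IsExp.neg_mul_cancel {T S S' : End ℂ V} (h : IsExp T S) (h' : IsExp (-T) S') :
    S' * S = 1 := by
  have := h'.add h (Commute.neg_left (Commute.refl T))
  rw [neg_add_cancel] at this
  exact this.unique IsExp.zero

/-- The exponential of an endomorphism as a linear equivalence. -/
lemma exists_equiv_isExp (T : End ℂ V) : ∃ S : V ≃ₗ[ℂ] V, IsExp T S := by
  obtain ⟨S, hS⟩ := exists_isExp T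
  obtain ⟨S', hS'⟩ := exists_isExp (-T)
  refine ⟨LinearEquiv.ofLinearMap S S' ?_ ?_, hS⟩
  · exact hS'.neg_mul_cancel (by rwa [neg_neg])
  · exact hS.neg_mul_cancel hS'

/-- The exponential of a derivation is an automorphism. -/
lemma IsExp.map_bilin {T S : End ℂ V} (h : IsExp T S) (β : V →ₗ[ℂ] V →ₗ[ℂ] V)
    (hT : ∀ a b, T (β a b) = β (T a) b + β a (T b)) (a b : V) : S (β a b) = β (S a) (S b) := by
  -- The derivation rule says that β, as a map V ⊗ V → V, intertwines T ⊗ 1 + 1 ⊗ T with T. The two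
  -- summands commute, so the exponential of their sum is the product of their exponentials, and its
  -- value at a ⊗ b is S a ⊗ S b.
  open TensorProduct in
  let A : V ⊗[ℂ] V →ₗ[ℂ] V := TensorProduct.lift β
  obtain ⟨L, hL⟩ := exists_isExp (LinearMap.rTensor V T)
  obtain ⟨R, hR⟩ := exists_isExp (LinearMap.lTensor V T)
  have hLR := hL.add hR (by
    change _ * _ = _ * _
    ext; simp)
  have h1 := hLR.intertwine h (A := A) (fun v => by
    induction v using TensorProduct.induction_on with
    | zero => simp
    | add x y hx hy => simp only [map_add, hx, hy]
    | tmul x y => simp [A, hT]) (a ⊗ₜ b)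
  have h2 : L (a ⊗ₜ S b) = S a ⊗ₜ S b :=
    (h.intertwine hL (A := (TensorProduct.mk ℂ V V).flip (S b)) (fun v => by simp) a).symm
  have h3 : R (a ⊗ₜ b) = a ⊗ₜ S b :=
    (h.intertwine hR (A := TensorProduct.mk ℂ V V a) (fun v => by simp) b).symm
  rw [Module.End.mul_apply, h3, h2] at h1
  simpa [A] using h1.symm

end Exponential

/-! ### Open orbits and connectedness along complex lines -/

section Openness

/-- If `(y, p) ↦ ρ(y) x + ι(p)` is onto, then `exp(ρ(y)) (x + ι(p))` covers a neighbourhood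
of `x`. -/
lemma eventually_exists_exp {Y P F : Type*} [NormedAddCommGroup Y] [NormedSpace ℂ Y]
    [CompleteSpace Y] [NormedAddCommGroup P] [NormedSpace ℂ P] [CompleteSpace P]
    [NormedAddCommGroup F] [NormedSpace ℂ F] [CompleteSpace F]
    (ρ : Y →L[ℂ] F →L[ℂ] F) (ι : P →L[ℂ] F) (x : F)
    (hsurj : ∀ v, ∃ y p, v = ρ y x + ι p) :
    ∀ᶠ v in 𝓝 x, ∃ y p, v = NormedSpace.exp (ρ y) (x + ι p) := by
  let f : Y × P → F := fun q => NormedSpace.exp (ρ q.1) (x + ι q.2)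
  have h1 : HasStrictFDerivAt (fun q : Y × P => NormedSpace.exp (ρ q.1))
      (ρ.comp (ContinuousLinearMap.fst ℂ Y P)) 0 := by
    have h := (hasStrictFDerivAt_exp_zero (𝕂 := ℂ) (𝔸 := F →L[ℂ] F))
    have h2 := (ρ.comp (ContinuousLinearMap.fst ℂ Y P)).hasStrictFDerivAt (x := 0)
    have h3 : HasStrictFDerivAt (NormedSpace.exp : (F →L[ℂ] F) → _) (1 : (F →L[ℂ] F) →L[ℂ] _)
        ((ρ.comp (ContinuousLinearMap.fst ℂ Y P)) 0) := by rw [map_zero]; exact h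
    exact h3.comp 0 h2
  have h2 : HasStrictFDerivAt (fun q : Y × P => x + ι q.2)
      (ι.comp (ContinuousLinearMap.snd ℂ Y P)) 0 :=
    ((ι.comp (ContinuousLinearMap.snd ℂ Y P)).hasStrictFDerivAt).const_add x
  have h3 := h1.clm_apply h2
  -- The strict derivative at 0 is (y, p) ↦ ρ(y) x + ι(p). Being onto, it makes the map open at 0.
  have h4 := h3.map_nhds_eq_of_surj (by
    rw [LinearMap.range_eq_top]
    intro v
    obtain ⟨y, p, rfl⟩ := hsurj v
    refine ⟨(y, p), ?_⟩
    simp [NormedSpace.exp_zero]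
    abel)
  have h5 : NormedSpace.exp (ρ (0 : Y × P).1) (x + ι (0 : Y × P).2) = x := by
    simp [NormedSpace.exp_zero]
  rw [h5] at h4
  rw [← h4]
  exact Filter.eventually_map.mpr (Filter.Eventually.of_forall fun q => ⟨q.1, q.2, rfl⟩)

/-- The preceding lemma along a line, without topologies on the spaces. -/
lemma eventually_line_exists_exp {Y P F : Type*} [AddCommGroup Y] [Module ℂ Y]
    [FiniteDimensional ℂ Y] [AddCommGroup P] [Module ℂ P] [FiniteDimensional ℂ P]
    [AddCommGroup F] [Module ℂ F] [FiniteDimensional ℂ F]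
    (ρ : Y →ₗ[ℂ] End ℂ F) (ι : P →ₗ[ℂ] F) (x : F) (hsurj : ∀ v, ∃ y p, v = ρ y x + ι p) (v : F) :
    ∀ᶠ t in 𝓝 (0 : ℂ), ∃ y p S, IsExp (ρ y) S ∧ x + t • v = S (x + ι p) := by
  let eY := (finBasis ℂ Y).equivFun
  let eP := (finBasis ℂ P).equivFun
  let e := (finBasis ℂ F).equivFun
  let c : End ℂ F →ₗ[ℂ] ((Fin (finrank ℂ F) → ℂ) →L[ℂ] (Fin (finrank ℂ F) → ℂ)) :=
    LinearMap.toContinuousLinearMap.toLinearMap ∘ₗ e.conj.toLinearMap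
  have key : ∀ T, IsExp T (e.symm.conj (NormedSpace.exp (c T) : _ →L[ℂ] _)) := by
    intro T
    have := isExp_conj e (isExp_exp (c T))
    rwa [show e.symm.conj (c T : End ℂ (Fin _ → ℂ)) = T by
      ext; simp [c, LinearEquiv.conj_apply]] at this
  have h := eventually_exists_exp
    (LinearMap.toContinuousLinearMap (c ∘ₗ ρ ∘ₗ eY.symm.toLinearMap))
    (LinearMap.toContinuousLinearMap (e.toLinearMap ∘ₗ ι ∘ₗ eP.symm.toLinearMap)) (e x) (by
      intro w
      obtain ⟨y, p, h⟩ := hsurj (e.symm w)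
      refine ⟨eY y, eP p, ?_⟩
      rw [LinearEquiv.symm_apply_eq] at h
      simp [c, h, LinearEquiv.conj_apply])
  have hcont : Tendsto (fun t : ℂ => e x + t • e v) (𝓝 0) (𝓝 (e x)) := by
    have : Continuous fun t : ℂ => e x + t • e v := by fun_prop
    simpa using this.tendsto 0
  filter_upwards [hcont.eventually h] with t ht
  obtain ⟨y, p, ht⟩ := ht
  refine ⟨eY.symm y, eP.symm p, _, key _, ?_⟩
  apply e.injective
  rw [map_add, map_smul, ht]
  simp [LinearEquiv.conj_apply]

/-- Connectedness along lines: a locally constant equivalence relation is constant. -/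
lemma rel_of_line_connected {E : Type*} [AddCommGroup E] [Module ℂ E] {U : Set E}
    {r : E → E → Prop} (hr : Equivalence r)
    (hU : ∀ a ∈ U, ∀ b ∈ U, {t : ℂ | a + t • (b - a) ∉ U}.Finite)
    (hloc : ∀ x ∈ U, ∀ v, ∀ᶠ t in 𝓝 (0 : ℂ), x + t • v ∈ U → r x (x + t • v))
    {a b : E} (ha : a ∈ U) (hb : b ∈ U) : r a b := by
  set B := {t : ℂ | a + t • (b - a) ∉ U}
  -- ℂ has real dimension two, so it stays connected after removing countably many points.
  have hconn : IsPreconnected Bᶜ :=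
    ((hU a ha b hb).countable.isConnected_compl_of_one_lt_rank (by simp)).isPreconnected
  let g : ℂ → E := fun t => a + t • (b - a)
  have hlocal : ∀ t ∈ Bᶜ, ∀ᶠ s in 𝓝 t, s ∈ Bᶜ → r (g t) (g s) := by
    intro t ht
    have ht' : g t ∈ U := not_not.mp ht
    have h := hloc (g t) ht' (b - a)
    have hc : Tendsto (fun s : ℂ => s - t) (𝓝 t) (𝓝 0) := by
      have : Continuous fun s : ℂ => s - t := by fun_prop
      simpa using this.tendsto t
    filter_upwards [hc.eventually h] with s hs hsB
    have e : g t + (s - t) • (b - a) = g s := by simp only [g]; module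
    rw [e] at hs
    exact hs (not_not.mp hsB)
  have h0 : (0 : ℂ) ∈ Bᶜ := by simpa [B] using ha
  have h1 : (1 : ℂ) ∈ Bᶜ := by simpa [B] using hb
  have := hconn.induction₂' (fun s t => r (g s) (g t)) (fun t ht => ?_)
    (fun x y z _ _ _ => hr.trans) h0 h1
  · simpa [g] using this
  · filter_upwards [mem_nhdsWithin_of_mem_nhds (hlocal t ht), self_mem_nhdsWithin] with s hs hsB
    exact ⟨hs hsB, hr.symm (hs hsB)⟩

end Openness

end QuasiLisse

namespace QuasiLisse

open Module Filter Topology LieAlgebra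

attribute [local instance 100] LieRing.ofAssociativeRing

/-! ### The group generated by the exponentials exp(ad y) -/

section InnerGroup

variable (𝔤 : Type*) [LieRing 𝔤] [LieAlgebra ℂ 𝔤]

/-- The group generated by the exponentials of inner derivations. -/
def innerGroup : Subgroup (𝔤 ≃ₗ[ℂ] 𝔤) :=
  Subgroup.closure {σ | ∃ y, IsExp (ad ℂ 𝔤 y) σ}

variable {𝔤}

lemma mem_innerGroup_of_isExp {y : 𝔤} {σ : 𝔤 ≃ₗ[ℂ] 𝔤} (h : IsExp (ad ℂ 𝔤 y) σ) :
    σ ∈ innerGroup 𝔤 :=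
  Subgroup.subset_closure ⟨y, h⟩

variable [FiniteDimensional ℂ 𝔤]

/-- The generators are exponentials of derivations, hence Lie algebra automorphisms. -/
lemma innerGroup_lie {σ : 𝔤 ≃ₗ[ℂ] 𝔤} (h : σ ∈ innerGroup 𝔤) (a b : 𝔤) : σ ⁅a, b⁆ = ⁅σ a, σ b⁆ := by
  induction h using Subgroup.closure_induction generalizing a b with
  | mem σ hσ =>
    obtain ⟨y, hy⟩ := hσ
    exact hy.map_bilin (ad ℂ 𝔤 : 𝔤 →ₗ[ℂ] End ℂ 𝔤) (fun a b => by simp) a b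
  | one => rfl
  | mul σ τ _ _ hσ hτ => simp [hσ, hτ]
  | inv σ _ hσ =>
    apply σ.injective
    rw [hσ]
    change σ (σ.symm _) = ⁅σ (σ.symm _), σ (σ.symm _)⁆
    simp

lemma innerGroup_ad_pow {σ : 𝔤 ≃ₗ[ℂ] 𝔤} (h : σ ∈ innerGroup 𝔤) (x y : 𝔤) (n : ℕ) :
    σ ((ad ℂ 𝔤 x ^ n) y) = (ad ℂ 𝔤 (σ x) ^ n) (σ y) := by
  induction n generalizing y with
  | zero => rfl
  | succ n ih => rw [pow_succ, Module.End.mul_apply, ih, pow_succ, Module.End.mul_apply, ad_apply,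
      ad_apply, innerGroup_lie h]

lemma map_mem_engel_iff {σ : 𝔤 ≃ₗ[ℂ] 𝔤} (h : σ ∈ innerGroup 𝔤) (x y : 𝔤) :
    σ y ∈ LieSubalgebra.engel ℂ (σ x) ↔ y ∈ LieSubalgebra.engel ℂ x := by
  simp only [LieSubalgebra.mem_engel_iff, ← innerGroup_ad_pow h,
    LinearEquiv.map_eq_zero_iff]

lemma isRegular_map_iff {σ : 𝔤 ≃ₗ[ℂ] 𝔤} (h : σ ∈ innerGroup 𝔤) (x : 𝔤) :
    IsRegular ℂ (σ x) ↔ IsRegular ℂ x := by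
  rw [isRegular_iff_finrank_engel_eq_rank, isRegular_iff_finrank_engel_eq_rank]
  have : (LieSubalgebra.engel ℂ (σ x)).toSubmodule =
      (LieSubalgebra.engel ℂ x).toSubmodule.map σ.toLinearMap := by
    ext z
    obtain ⟨y, rfl⟩ := σ.surjective z
    rw [LieSubalgebra.mem_toSubmodule, map_mem_engel_iff h]
    simp
  have h2 : finrank ℂ (LieSubalgebra.engel ℂ (σ x)) = finrank ℂ (LieSubalgebra.engel ℂ x) := by
    change finrank ℂ (LieSubalgebra.engel ℂ (σ x)).toSubmodule = _
    rw [this]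
    exact LinearEquiv.finrank_map_eq σ _
  rw [h2]

end InnerGroup

/-- Fitting decomposition: the space is the sum of the generalized kernel of T and the stable range,
and the latter lies in the range of T. For T = ad x this supplies the surjectivity needed in the
openness argument. -/
lemma exists_eq_add_apply {V : Type*} [AddCommGroup V] [Module ℂ V] [FiniteDimensional ℂ V]
    (T : End ℂ V) (v : V) : ∃ p ∈ T.maxGenEigenspace 0, ∃ u, v = p + T u := by
  have hv : v ∈ (⨆ n, LinearMap.ker (T ^ n)) ⊔ ⨅ n, LinearMap.range (T ^ n) := by
    rw [T.isCompl_iSup_ker_pow_iInf_range_pow.sup_eq_top]; trivial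
  obtain ⟨p, hp, q, hq, rfl⟩ := Submodule.mem_sup.mp hv
  obtain ⟨u, rfl⟩ := (Submodule.mem_iInf _).mp hq 1
  refine ⟨p, ?_, u, by rw [pow_one]⟩
  rw [Submodule.mem_iSup_of_directed _ (monotone_nat_of_le_succ fun n z hz => by
    rw [LinearMap.mem_ker] at hz ⊢
    rw [pow_succ', Module.End.mul_apply, hz, map_zero]).directed_le] at hp
  rw [Module.End.mem_maxGenEigenspace]
  simpa using hp

/-! ### Regular elements and conjugacy of Cartan subalgebras -/

section Regular

variable {𝔤 : Type*} [LieRing 𝔤] [LieAlgebra ℂ 𝔤] [FiniteDimensional ℂ 𝔤]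

/-- Regularity means that engel x has the least possible dimension. It is thus minimal among the
engel z with z ∈ engel x, and therefore contained in all of them. By Engel's theorem it is
nilpotent; Engel subalgebras are self-normalizing in any case. -/
lemma isCartanSubalgebra_engel_of_isRegular {x : 𝔤} (hx : IsRegular ℂ x) :
    (LieSubalgebra.engel ℂ x).IsCartanSubalgebra := by
  refine ⟨?_, LieSubalgebra.normalizer_engel _ _⟩
  apply LieSubalgebra.isNilpotent_of_forall_le_engel
  intro y hy
  have hinf : (finrank ℂ 𝔤 : Cardinal) ≤ Cardinal.mk ℂ :=
    Cardinal.natCast_le_aleph0.trans (Cardinal.infinite_iff.mp inferInstance)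
  set Ex : {LieSubalgebra.engel ℂ z | z ∈ LieSubalgebra.engel ℂ x} :=
    ⟨LieSubalgebra.engel ℂ x, x, LieSubalgebra.self_mem_engel _ _, rfl⟩
  suffices IsBot Ex from @this ⟨LieSubalgebra.engel ℂ y, y, hy, rfl⟩
  apply engel_isBot_of_isMin hinf (LieSubalgebra.engel ℂ x) Ex le_rfl
  rintro ⟨_, y, hy, rfl⟩ hyx
  suffices finrank ℂ (LieSubalgebra.engel ℂ x) ≤ finrank ℂ (LieSubalgebra.engel ℂ y) by
    suffices LieSubalgebra.engel ℂ y = LieSubalgebra.engel ℂ x from this.ge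
    apply LieSubalgebra.toSubmodule_injective
    exact Submodule.eq_of_le_of_finrank_le hyx this
  rw [(isRegular_iff_finrank_engel_eq_rank ℂ x).mp hx]
  apply rank_le_finrank_engel

/-- Regularity is the nonvanishing of a coefficient of the generic characteristic polynomial.
Restricted to the line this is a one-variable polynomial, nonzero because it does not vanish at t₁.
-/
lemma finite_not_isRegular_line {a v : 𝔤} {t₁ : ℂ} (h : IsRegular ℂ (a + t₁ • v)) :
    {t : ℂ | ¬ IsRegular ℂ (a + t • v)}.Finite := by
  classical
  let b := finBasis ℂ 𝔤
  let q : MvPolynomial _ ℂ := (LinearMap.polyCharpoly (LieModule.toEnd ℂ 𝔤 𝔤).toLinearMap b).coeff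
    (LieModule.rank ℂ 𝔤 𝔤)
  have hq : ∀ x : 𝔤, IsRegular ℂ x ↔ MvPolynomial.eval (b.repr x) q ≠ 0 := fun x =>
    LieModule.isRegular_iff_coeff_polyCharpoly_rank_ne_zero ℂ 𝔤 b x
  let p : Polynomial ℂ := MvPolynomial.aeval
    (fun i => Polynomial.C (b.repr a i) + Polynomial.X * Polynomial.C (b.repr v i)) q
  have hp : ∀ t, p.eval t = MvPolynomial.eval (b.repr (a + t • v)) q := by
    intro t
    have h1 := MvPolynomial.comp_aeval_apply (R := ℂ) 
      (f := fun i => Polynomial.C (b.repr a i) + Polynomial.X * Polynomial.C (b.repr v i))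
      (Polynomial.aeval t : Polynomial ℂ →ₐ[ℂ] ℂ) q
    rw [← Polynomial.coe_aeval_eq_eval]
    refine h1.trans ?_
    rw [← MvPolynomial.coe_aeval_eq_eval]
    have : ∀ i, Polynomial.aeval t (Polynomial.C (b.repr a i) + Polynomial.X *
        Polynomial.C (b.repr v i)) = b.repr (a + t • v) i := fun i => by
      simp; ring
    simp only [this]
    rfl
  have hp0 : p ≠ 0 := by
    rintro h0
    rw [hq, ← hp, h0] at h
    simp at h
  refine (p.roots.toFinset.finite_toSet).subset fun t ht => ?_
  simp only [Set.mem_ofPred_eq, hq, not_not, ← hp] at ht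
  simp [hp0, ht]

variable [IsKilling ℂ 𝔤]

/-- Cartan subalgebras are abelian for a nondegenerate Killing form, so engel x centralizes z and
lies in engel z. Both have dimension equal to the rank. -/
lemma engel_eq_of_mem {x z : 𝔤} (hx : IsRegular ℂ x) (hz : IsRegular ℂ z)
    (hzx : z ∈ LieSubalgebra.engel ℂ x) : LieSubalgebra.engel ℂ z = LieSubalgebra.engel ℂ x := by
  have := isCartanSubalgebra_engel_of_isRegular hx
  symm
  apply LieSubalgebra.toSubmodule_injective
  refine Submodule.eq_of_le_of_finrank_le (fun y hy => ?_) ?_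
  · rw [LieSubalgebra.mem_toSubmodule, LieSubalgebra.mem_engel_iff]
    refine ⟨1, ?_⟩
    have h := trivial_lie_zero (LieSubalgebra.engel ℂ x) (LieSubalgebra.engel ℂ x) ⟨z, hzx⟩ ⟨y, hy⟩
    simpa using congrArg Subtype.val h
  · exact (((isRegular_iff_finrank_engel_eq_rank ℂ z).mp hz).trans
      ((isRegular_iff_finrank_engel_eq_rank ℂ x).mp hx).symm).le

/-- Conjugacy of the Cartan subalgebras `engel x`. -/
lemma exists_map_engel_eq {a b : 𝔤} (ha : IsRegular ℂ a) (hb : IsRegular ℂ b) :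
    ∃ σ ∈ innerGroup 𝔤, ∀ y, y ∈ LieSubalgebra.engel ℂ a ↔ σ y ∈ LieSubalgebra.engel ℂ b := by
  refine rel_of_line_connected (U := {x : 𝔤 | IsRegular ℂ x})
    (r := fun a b => ∃ σ ∈ innerGroup 𝔤, ∀ y, y ∈ LieSubalgebra.engel ℂ a ↔
      σ y ∈ LieSubalgebra.engel ℂ b) ⟨?_, ?_, ?_⟩ ?_ ?_ ha hb
  · exact fun x => ⟨1, one_mem _, fun y => Iff.rfl⟩
  · rintro x y ⟨σ, hσ, h⟩
    refine ⟨σ⁻¹, inv_mem hσ, fun z => ?_⟩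
    rw [h]
    change _ ↔ σ (σ.symm z) ∈ _
    rw [LinearEquiv.apply_symm_apply]
  · rintro x y z ⟨σ, hσ, h⟩ ⟨τ, hτ, h'⟩
    exact ⟨τ * σ, mul_mem hτ hσ, fun w => by rw [h, h']; rfl⟩
  · intro a ha b _
    exact finite_not_isRegular_line (t₁ := 0) (by simpa using ha)
  · intro x hx v
    -- Points of the line near x have the form σ(x + p) with p ∈ engel x. If such a point is
    -- regular, so is x + p, hence engel (x + p) = engel x, and σ carries engel x onto the Engel
    -- subalgebra of the point.
    have h := eventually_line_exists_exp (Y := 𝔤) (P := LieSubalgebra.engel ℂ x) (F := 𝔤)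
      (ad ℂ 𝔤 : 𝔤 →ₗ[ℂ] End ℂ 𝔤) (LieSubalgebra.engel ℂ x).toSubmodule.subtype x ?_ v
    · filter_upwards [h] with t ht hreg
      obtain ⟨y, p, S, hS, ht⟩ := ht
      obtain ⟨σ, hσ⟩ := exists_equiv_isExp (ad ℂ 𝔤 y)
      have hσG := mem_innerGroup_of_isExp hσ
      obtain rfl : S = σ := hS.unique hσ
      have ht' : x + t • v = σ (x + p) := ht
      refine ⟨σ, hσG, fun z => ?_⟩
      rw [ht'] at hreg ⊢
      rw [map_mem_engel_iff hσG, engel_eq_of_mem hx ((isRegular_map_iff hσG _).mp hreg)]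
      exact (LieSubalgebra.engel ℂ x).add_mem (LieSubalgebra.self_mem_engel _ _) p.2
    · intro v
      obtain ⟨p, hp, u, rfl⟩ := exists_eq_add_apply (ad ℂ 𝔤 x) v
      refine ⟨-u, ⟨p, hp⟩, ?_⟩
      change _ = ⁅-u, x⁆ + p
      rw [neg_lie, lie_skew, ad_apply, add_comm]

/-- A semisimple element is conjugate to an element of a given Cartan subalgebra. -/
lemma exists_map_mem_engel_of_isSemisimple {x₀ s : 𝔤} (hx₀ : IsRegular ℂ x₀)
    (hs : (ad ℂ 𝔤 s).IsSemisimple) :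
    ∃ σ ∈ innerGroup 𝔤, σ s ∈ LieSubalgebra.engel ℂ x₀ := by
  -- Points of the line from s to x₀ near s have the form σ(s + p) with [s, p] = 0, and nearly all
  -- are regular. As s commutes with s + p, it lies in engel (s + p), which is conjugate to engel
  -- x₀.
  have h := eventually_line_exists_exp (Y := 𝔤) (P := LinearMap.ker (ad ℂ 𝔤 s)) (F := 𝔤)
      (ad ℂ 𝔤 : 𝔤 →ₗ[ℂ] End ℂ 𝔤) (LinearMap.ker (ad ℂ 𝔤 s)).subtype s ?_ (x₀ - s)
  · have h2 : ∀ᶠ t in 𝓝[≠] (0 : ℂ), IsRegular ℂ (s + t • (x₀ - s)) := by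
      have hfin := finite_not_isRegular_line (a := s) (v := x₀ - s) (t₁ := 1) (by simpa using hx₀)
      have := (hfin.subset (Set.sdiff_subset (t := {0}))).isClosed.isOpen_compl.mem_nhds (x := (0 : ℂ)) (by simp)
      filter_upwards [mem_nhdsWithin_of_mem_nhds this, self_mem_nhdsWithin] with t ht ht0
      by_contra hn
      exact ht ⟨hn, ht0⟩
    obtain ⟨t, ⟨y, p, S, hS, ht⟩, hreg⟩ := ((h.filter_mono nhdsWithin_le_nhds).and h2).exists
    obtain ⟨σ, hσ⟩ := exists_equiv_isExp (ad ℂ 𝔤 y)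
    have hσG := mem_innerGroup_of_isExp hσ
    obtain rfl : S = σ := hS.unique hσ
    have ht' : s + t • (x₀ - s) = σ (s + p) := ht
    rw [ht', isRegular_map_iff hσG] at hreg
    obtain ⟨τ, hτ, hτ'⟩ := exists_map_engel_eq hreg hx₀
    refine ⟨τ, hτ, (hτ' s).mp ?_⟩
    rw [LieSubalgebra.mem_engel_iff]
    refine ⟨1, ?_⟩
    have hp : ⁅s, (p : 𝔤)⁆ = 0 := p.2
    rw [pow_one, ad_apply, add_lie, lie_self, zero_add, ← lie_skew, hp, neg_zero]
  · intro v
    obtain ⟨p, hp, u, rfl⟩ := exists_eq_add_apply (ad ℂ 𝔤 s) v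
    -- Semisimplicity reduces the Fitting null component of ad s to its kernel, so p really commutes
    -- with s.
    rw [hs.isFinitelySemisimple.maxGenEigenspace_eq_eigenspace, Module.End.eigenspace_zero] at hp
    refine ⟨-u, ⟨p, hp⟩, ?_⟩
    change _ = ⁅-u, s⁆ + p
    rw [neg_lie, lie_skew, ad_apply, add_comm]

end Regular

end QuasiLisse

namespace QuasiLisse

open Module Filter Topology LieAlgebra

attribute [local instance 100] LieRing.ofAssociativeRing

/-! ### Eigenvectors and the Jordan decomposition -/

section JordanDecomposition

variable {V : Type*} [AddCommGroup V] [Module ℂ V]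

/-- An eigenvector of `S` yields, by powers of `H - μ`, an eigenvector of `H` when `H - S` is
nilpotent and commutes with `S`. -/
lemma exists_pow_eigenvector {H S N : End ℂ V} (hH : H = N + S) (hN : IsNilpotent N)
    (hc : Commute N S) {v : V} (hv : v ≠ 0) {μ : ℂ} (hμ : S v = μ • v) :
    ∃ j : ℕ, ((H - μ • (1 : End ℂ V)) ^ j) v ≠ 0 ∧
      H (((H - μ • (1 : End ℂ V)) ^ j) v) = μ • ((H - μ • (1 : End ℂ V)) ^ j) v := by
  classical
  have hpow : ∀ j : ℕ, ((H - μ • (1 : End ℂ V)) ^ j) v = (N ^ j) v := by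
    intro j
    induction j with
    | zero => rfl
    | succ j ih =>
      have h1 : S ((N ^ j) v) = μ • (N ^ j) v := by
        have := congrArg (fun T => T v) (hc.pow_left j).eq
        simp only [Module.End.mul_apply, hμ, map_smul] at this
        exact this.symm
      rw [pow_succ', Module.End.mul_apply, ih, hH]
      simp only [LinearMap.sub_apply, LinearMap.add_apply, h1, LinearMap.smul_apply,
        Module.End.one_apply, add_sub_cancel_right]
      rw [pow_succ', Module.End.mul_apply]
  have hex : ∃ j, ((H - μ • (1 : End ℂ V)) ^ j) v = 0 := by
    obtain ⟨n, hn⟩ := hN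
    exact ⟨n, by rw [hpow, hn, LinearMap.zero_apply]⟩
  obtain ⟨j, hj⟩ : ∃ j, Nat.find hex = j + 1 := by
    rcases h0 : Nat.find hex with _ | k
    · have := Nat.find_spec hex
      rw [h0] at this
      exact absurd (by simpa using this) hv
    · exact ⟨k, rfl⟩
  refine ⟨j, Nat.find_min hex (by omega), ?_⟩
  have := Nat.find_spec hex
  rw [hj, pow_succ', Module.End.mul_apply] at this
  rw [← sub_eq_zero]
  simpa using this

end JordanDecomposition

/-! ### Grading elements of nilpotent elements -/

section Nilpotent

variable {𝔤 : Type*} [LieRing 𝔤] [LieAlgebra ℂ 𝔤] [FiniteDimensional ℂ 𝔤] [IsKilling ℂ 𝔤]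

/-- The semisimple part of `ad h` is inner. -/
lemma exists_semisimple_part (h : 𝔤) : ∃ s : 𝔤, ∃ N : End ℂ 𝔤, (ad ℂ 𝔤 s).IsSemisimple ∧
    IsNilpotent N ∧ Commute N (ad ℂ 𝔤 s) ∧ ad ℂ 𝔤 h = N + ad ℂ 𝔤 s := by
  obtain ⟨N, hN₀, S, hS₀, hN, hS, hSN⟩ := (ad ℂ 𝔤 h).exists_isNilpotent_isSemisimple
  have hcNS : Commute N S := Algebra.commute_of_mem_adjoin_singleton_of_commute hS₀
    (Algebra.commute_of_mem_adjoin_self hN₀).symm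
  replace hS₀ : Commute (ad ℂ 𝔤 h) S := Algebra.commute_of_mem_adjoin_self hS₀
  have hN' : IsNilpotent (ad ℂ 𝔤 h - S) := by rwa [hSN, add_sub_cancel_right]
  have aux {μ : ℂ} {y : 𝔤} (hy : y ∈ (ad ℂ 𝔤 h).maxGenEigenspace μ) : S y = μ • y :=
    Module.End.apply_eq_of_mem_of_comm_of_isFinitelySemisimple_of_isNil hy hS₀
      hS.isFinitelySemisimple hN'
  -- S acts by the scalar μ on each generalized eigenspace of ad h, and brackets add these
  -- eigenvalues. So S is a derivation, and derivations are inner when the Killing form is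
  -- nondegenerate.
  have h_der (y z : 𝔤) : S ⁅y, z⁆ = ⁅S y, z⁆ + ⁅y, S z⁆ := by
    have hy : y ∈ ⨆ μ, (ad ℂ 𝔤 h).maxGenEigenspace μ := by
      rw [Module.End.iSup_maxGenEigenspace_eq_top]; trivial
    have hz : z ∈ ⨆ μ, (ad ℂ 𝔤 h).maxGenEigenspace μ := by
      rw [Module.End.iSup_maxGenEigenspace_eq_top]; trivial
    induction hy using Submodule.iSup_induction' with
    | mem α y hy =>
      induction hz using Submodule.iSup_induction' with
      | mem β z hz =>
        have hyz : ⁅y, z⁆ ∈ (ad ℂ 𝔤 h).maxGenEigenspace (α + β) :=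
          LieModule.lie_mem_maxGenEigenspace_toEnd hy hz
        rw [aux hy, aux hz, aux hyz, smul_lie, lie_smul, ← add_smul]
      | zero => simp
      | add _ _ _ _ h h' => simp only [lie_add, map_add, h, h']; abel
    | zero => simp
    | add _ _ _ _ h h' => simp only [add_lie, map_add, h, h']; abel
  replace h_der : ∀ y z : 𝔤, S ⁅y, z⁆ = ⁅y, S z⁆ - ⁅z, S y⁆ := fun y z => by
    rw [h_der, ← lie_skew (S y) z]; abel
  let S' : LieDerivation ℂ 𝔤 𝔤 := ⟨S, h_der⟩
  obtain ⟨s, hs⟩ := LieDerivation.IsKilling.exists_eq_ad S'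
  have hs' : ad ℂ 𝔤 s = S := by rw [← LieDerivation.coe_ad_apply_eq_ad_apply, hs]
  exact ⟨s, N, by rwa [hs'], hN, by rwa [hs'], by rwa [hs']⟩

/-- A nilpotent element `e` is contained in `[e, [e, 𝔤]]`. -/
lemma exists_lie_lie_eq {e : 𝔤} (he : IsNilpotent (ad ℂ 𝔤 e)) : ∃ f, ⁅e, ⁅e, f⁆⁆ = e := by
  -- (ad e)² is self-adjoint for the Killing form, so it suffices that e is orthogonal to its
  -- kernel. If [e, [e, u]] = 0, then ad e commutes with [ad e, ad u], so ad u ∘ ad e is nilpotent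
  -- and its trace, the Killing pairing of u and e, vanishes.
  have h := mem_range_of_orthogonal (IsKilling.killingForm_nondegenerate ℂ 𝔤)
    (A := ad ℂ 𝔤 e * ad ℂ 𝔤 e) (A' := ad ℂ 𝔤 e * ad ℂ 𝔤 e) (v := e) (fun x y => by
      simp only [Module.End.mul_apply, ad_apply]
      rw [← LieModule.traceForm_apply_lie_apply, ← lie_skew x e, map_neg, LinearMap.neg_apply,
        ← LieModule.traceForm_apply_lie_apply, ← lie_skew ⁅e, x⁆ e, map_neg, LinearMap.neg_apply]
      simp) (fun u hu => by
      rw [LieModule.traceForm_apply_apply]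
      have hc : ad ℂ 𝔤 e * ad ℂ 𝔤 u - ad ℂ 𝔤 u * ad ℂ 𝔤 e = ad ℂ 𝔤 ⁅e, u⁆ := by
        rw [LieHom.map_lie]; rfl
      have h1 : Commute (ad ℂ 𝔤 e) (ad ℂ 𝔤 e * ad ℂ 𝔤 u - ad ℂ 𝔤 u * ad ℂ 𝔤 e) := by
        rw [hc, commute_iff_lie_eq, ← LieHom.map_lie]
        have : ⁅e, ⁅e, u⁆⁆ = 0 := hu
        rw [this, map_zero]
      exact (LinearMap.isNilpotent_trace_of_isNilpotent
        (isNilpotent_mul_of_commute_commutator he h1)).eq_zero)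
  exact h

/-- A nilpotent element is homogeneous of degree `2`, with `ad e : 𝔤₀ → 𝔤₂` onto, for the grading
given by a semisimple element with bounded integral eigenvalues. -/
theorem exists_grading_element {e : 𝔤} (he : IsNilpotent (ad ℂ 𝔤 e)) :
    ∃ s : 𝔤, (ad ℂ 𝔤 s).IsSemisimple ∧ ⁅s, e⁆ = (2 : ℂ) • e ∧
      (∀ (v : 𝔤) (μ : ℂ), v ≠ 0 → ⁅s, v⁆ = μ • v →
        ∃ i : ℤ, i ∈ Finset.Icc (-(2 * finrank ℂ 𝔤 : ℤ)) (2 * finrank ℂ 𝔤) ∧ μ = (i : ℂ)) ∧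
      ∀ v : 𝔤, ⁅s, v⁆ = (2 : ℂ) • v → ∃ w : 𝔤, ⁅s, w⁆ = 0 ∧ ⁅e, w⁆ = v := by
  obtain ⟨f₀, hf₀⟩ := exists_lie_lie_eq he
  -- The factor -2 makes [h, e] = -[e, [e, f]] equal to 2e.
  set f := (-2 : ℂ) • f₀ with hf
  set h := ⁅e, f⁆ with hh
  have hhe : ⁅h, e⁆ = (2 : ℂ) • e := by
    rw [← lie_skew, hh, hf, lie_smul, lie_smul, hf₀]; module
  have hHE : ad ℂ 𝔤 h * ad ℂ 𝔤 e - ad ℂ 𝔤 e * ad ℂ 𝔤 h = (2 : ℂ) • ad ℂ 𝔤 e := by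
    rw [← map_smul, ← hhe, LieHom.map_lie (ad ℂ 𝔤) h e]; rfl
  have hEF : ad ℂ 𝔤 e * ad ℂ 𝔤 f - ad ℂ 𝔤 f * ad ℂ 𝔤 e = ad ℂ 𝔤 h := by
    rw [hh, LieHom.map_lie]; rfl
  have hE : (ad ℂ 𝔤 e) ^ finrank ℂ 𝔤 = 0 := by
    have h1 := (ad ℂ 𝔤 e).aeval_self_charpoly
    rw [IsNilpotent.charpoly_eq_X_pow_finrank he] at h1
    simpa using h1
  obtain ⟨s, N, hs, hN, hc, hsum⟩ := exists_semisimple_part h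
  have hse : ⁅s, e⁆ = (2 : ℂ) • e := by
    refine Module.End.apply_eq_of_mem_of_comm_of_isFinitelySemisimple_of_isNil
      (f := ad ℂ 𝔤 h) (g := ad ℂ 𝔤 s) (k := ⊤) (μ := 2) (m := e) ?_ ?_
      hs.isFinitelySemisimple ?_
    · exact Module.End.eigenspace_le_maxGenEigenspace (Module.End.mem_eigenspace_iff.mpr hhe)
    · rw [hsum]; exact hc.add_left (Commute.refl _)
    · rwa [hsum, add_sub_cancel_right]
  refine ⟨s, hs, hse, fun v μ hv hμ => ?_, fun v hv => ?_⟩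
  · obtain ⟨j, hj, hj'⟩ := exists_pow_eigenvector hsum hN hc hv hμ
    exact eigenvalue_integral hHE hEF hE hj hj'
  -- On ker (ad e) the eigenvalues of ad h are natural numbers, so -2 is not an eigenvalue of ad s
  -- there. The passage from s to h stays inside ker (ad e) because it uses powers of ad h + 2, and
  -- [h, e] is a multiple of e.
  · have hker : ∀ z : 𝔤, ⁅e, z⁆ = 0 → ⁅s, z⁆ = (-2 : ℂ) • z → z = 0 := by
      intro z hz hsz
      by_contra hz0
      obtain ⟨j, hj, hj'⟩ := exists_pow_eigenvector hsum hN hc hz0 hsz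
      have hst : ∀ j : ℕ, ad ℂ 𝔤 e (((ad ℂ 𝔤 h - (-2 : ℂ) • (1 : End ℂ 𝔤)) ^ j) z) = 0 := by
        intro j
        induction j with
        | zero => exact hz
        | succ j ih =>
          have h1 : ad ℂ 𝔤 e * ad ℂ 𝔤 h = ad ℂ 𝔤 h * ad ℂ 𝔤 e - (2 : ℂ) • ad ℂ 𝔤 e := by
            rw [← hHE]; abel
          set w := ((ad ℂ 𝔤 h - (-2 : ℂ) • (1 : End ℂ 𝔤)) ^ j) z
          have h2 := congrArg (fun T => T w) h1
          simp only [Module.End.mul_apply, LinearMap.sub_apply, LinearMap.smul_apply, ih, map_zero,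
            smul_zero, sub_zero] at h2
          rw [pow_succ', Module.End.mul_apply, LinearMap.sub_apply, map_sub, h2,
            LinearMap.smul_apply, Module.End.one_apply, map_smul, ih]
          simp
      obtain ⟨i, -, hi⟩ := eigenvalue_on_ker hHE hEF hE hj (hst j) hj'
      have : (i : ℂ) + 2 = 0 := by rw [← hi]; ring
      exact absurd this (by exact_mod_cast (by omega : i + 2 ≠ 0))
    have hstable : ∀ z ∈ LinearMap.ker (ad ℂ 𝔤 e),
        (ad ℂ 𝔤 s + (2 : ℂ) • 1) z ∈ LinearMap.ker (ad ℂ 𝔤 e) := by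
      intro z hz
      have hz' : ⁅e, z⁆ = 0 := hz
      simp only [LinearMap.mem_ker, LinearMap.add_apply, LinearMap.smul_apply,
        Module.End.one_apply, ad_apply, lie_add, lie_smul, hz', smul_zero, add_zero]
      rw [leibniz_lie, hz', lie_zero, add_zero, ← lie_skew e s, hse, neg_lie, smul_lie, hz',
        smul_zero, neg_zero]
    have hsurj : Function.Surjective ((ad ℂ 𝔤 s + (2 : ℂ) • 1).restrict hstable) := by
      rw [← LinearMap.injective_iff_surjective, ← LinearMap.ker_eq_bot, LinearMap.ker_eq_bot']
      rintro ⟨z, hz⟩ hz0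
      have h1 : ⁅s, z⁆ + (2 : ℂ) • z = 0 := congrArg Subtype.val hz0
      refine Subtype.ext (hker z hz ?_)
      rw [neg_smul]
      exact eq_neg_of_add_eq_zero_left h1
    -- The range of ad e is the orthogonal complement of ker (ad e). Each z in that kernel is [s,
    -- z'] + 2z', and invariance moves ad s onto v with a sign, where its eigenvalue 2 cancels the
    -- second term.
    have hrange : v ∈ LinearMap.range (ad ℂ 𝔤 e) := by
      refine mem_range_of_orthogonal (IsKilling.killingForm_nondegenerate ℂ 𝔤) (A' := -ad ℂ 𝔤 e)
        (fun x y => ?_) fun z hz => ?_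
      · simp only [LinearMap.neg_apply, ad_apply, lie_skew]
        exact (LieModule.traceForm_apply_lie_apply ℂ 𝔤 𝔤 x e y).symm
      · obtain ⟨⟨z', hz'⟩, h1⟩ := hsurj ⟨z, neg_eq_zero.mp hz⟩
        have h2 : ⁅s, z'⁆ + (2 : ℂ) • z' = z := congrArg Subtype.val h1
        rw [← h2, map_add, LinearMap.add_apply, ← lie_skew, map_neg, LinearMap.neg_apply,
          LieModule.traceForm_apply_lie_apply, hv]
        simp
    obtain ⟨w, hw⟩ := hrange
    -- Replace w by its degree zero component p. The error [e, p] - v is -(ad s - 2)[e, u] and has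
    -- degree two itself, so [e, u] is a generalized eigenvector for 2. Semisimplicity makes it a
    -- true eigenvector and the error vanishes.
    obtain ⟨p, hp, u, rfl⟩ := exists_eq_add_apply (ad ℂ 𝔤 s) w
    rw [hs.isFinitelySemisimple.maxGenEigenspace_eq_eigenspace, Module.End.eigenspace_zero] at hp
    have hp' : ⁅s, p⁆ = 0 := hp
    refine ⟨p, hp, ?_⟩
    rw [← sub_eq_zero]
    have h1 : ⁅e, p⁆ + ⁅e, ⁅s, u⁆⁆ = v := by rw [← hw, map_add]; rfl
    have hes : ⁅e, s⁆ = -((2 : ℂ) • e) := by rw [← lie_skew, hse]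
    have h2 : ⁅e, p⁆ - v = -((ad ℂ 𝔤 s - algebraMap ℂ (End ℂ 𝔤) 2) ⁅e, u⁆) := by
      rw [← h1, leibniz_lie e s u, hes, neg_lie, smul_lie, LinearMap.sub_apply, ad_apply,
        Module.algebraMap_end_apply]
      abel
    have h3 : (ad ℂ 𝔤 s) (⁅e, p⁆ - v) = (2 : ℂ) • (⁅e, p⁆ - v) := by
      rw [ad_apply, lie_sub, hv, leibniz_lie, hse, hp', lie_zero, add_zero, smul_lie, smul_sub]
    have h4 : ⁅e, u⁆ ∈ (ad ℂ 𝔤 s).maxGenEigenspace 2 := by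
      rw [Module.End.mem_maxGenEigenspace]
      refine ⟨2, ?_⟩
      have h5 : (ad ℂ 𝔤 s - (2 : ℂ) • (1 : End ℂ 𝔤)) ⁅e, u⁆ = -(⁅e, p⁆ - v) := by
        rw [h2, neg_neg]; rfl
      rw [pow_succ, pow_one, Module.End.mul_apply, h5, map_neg, LinearMap.sub_apply, h3]
      simp
    rw [hs.isFinitelySemisimple.maxGenEigenspace_eq_eigenspace] at h4
    have h5 := Module.End.mem_eigenspace_iff.mp h4
    rw [h2, LinearMap.sub_apply, h5]
    simp

end Nilpotent

end QuasiLisse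

namespace QuasiLisse

open Module Filter Topology LieAlgebra

attribute [local instance 100] LieRing.ofAssociativeRing

/-! ### Finiteness of the number of nilpotent orbits -/

section NilpotentOrbits

variable {𝔤 : Type*} [LieRing 𝔤] [LieAlgebra ℂ 𝔤]

/-- The elements `e` of degree two, for the grading given by `s`, such that `ad e : 𝔤₀ → 𝔤₂` is
onto. -/
def openDegreeTwo (s : 𝔤) : Set 𝔤 :=
  {e | ⁅s, e⁆ = (2 : ℂ) • e ∧ ∀ v : 𝔤, ⁅s, v⁆ = (2 : ℂ) • v → ∃ w : 𝔤, ⁅s, w⁆ = 0 ∧ ⁅e, w⁆ = v}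

/-- The degree two part. -/
def degreeTwo (s : 𝔤) : Submodule ℂ 𝔤 := LinearMap.ker (ad ℂ 𝔤 s - (2 : ℂ) • 1)

lemma mem_degreeTwo {s v : 𝔤} : v ∈ degreeTwo s ↔ ⁅s, v⁆ = (2 : ℂ) • v := by
  simp [degreeTwo, sub_eq_zero]

lemma lie_mem_degreeTwo {s v w : 𝔤} (hw : ⁅s, w⁆ = 0) (hv : v ∈ degreeTwo s) :
    ⁅w, v⁆ ∈ degreeTwo s := by
  rw [mem_degreeTwo] at *
  rw [leibniz_lie, hw, zero_lie, zero_add, hv, lie_smul]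

/-- The action of the degree zero part on the degree two part. -/
def degreeTwoAction (s : 𝔤) : LinearMap.ker (ad ℂ 𝔤 s) →ₗ[ℂ] End ℂ (degreeTwo s) where
  toFun w := (ad ℂ 𝔤 (w : 𝔤)).restrict fun _ hv => lie_mem_degreeTwo w.2 hv
  map_add' w w' := LinearMap.ext fun v => Subtype.ext (add_lie (w : 𝔤) w' (v : 𝔤))
  map_smul' r w := LinearMap.ext fun v => Subtype.ext (smul_lie r (w : 𝔤) (v : 𝔤))

variable [FiniteDimensional ℂ 𝔤]

/-- Let A₀ and A₁ be ad a and ad (b - a) from degree zero to degree two, and B a right inverse of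
A₀. Then (A₀ + t A₁) B = 1 + t A₁ B, which is bijective unless -1/t is an eigenvalue of A₁ B. With
0⁻¹ = 0 the map t ↦ -t⁻¹ is injective on all of ℂ; including t = 0 in the exceptional set is
harmless. -/
lemma finite_notMem_openDegreeTwo_line {s a b : 𝔤} (ha : a ∈ openDegreeTwo s)
    (hb : b ∈ openDegreeTwo s) : {t : ℂ | a + t • (b - a) ∉ openDegreeTwo s}.Finite := by
  let A : 𝔤 → LinearMap.ker (ad ℂ 𝔤 s) →ₗ[ℂ] 𝔤 := fun e => ad ℂ 𝔤 e ∘ₗ Submodule.subtype _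
  have hA : ∀ e (he : e ∈ degreeTwo s) w, A e w ∈ degreeTwo s := fun e he w => by
    change ⁅e, (w : 𝔤)⁆ ∈ _
    rw [← lie_skew]
    exact (degreeTwo s).neg_mem (lie_mem_degreeTwo w.2 he)
  have ha2 : a ∈ degreeTwo s := mem_degreeTwo.mpr ha.1
  have hb2 : b - a ∈ degreeTwo s := (degreeTwo s).sub_mem (mem_degreeTwo.mpr hb.1) ha2
  let A₀ : LinearMap.ker (ad ℂ 𝔤 s) →ₗ[ℂ] degreeTwo s := (A a).codRestrict _ (hA a ha2)
  let A₁ : LinearMap.ker (ad ℂ 𝔤 s) →ₗ[ℂ] degreeTwo s := (A (b - a)).codRestrict _ (hA _ hb2)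
  have hsurj : Function.Surjective A₀ := fun v => by
    obtain ⟨w, hw, hw'⟩ := ha.2 v (mem_degreeTwo.mp v.2)
    exact ⟨⟨w, hw⟩, Subtype.ext hw'⟩
  obtain ⟨B, hB⟩ := A₀.exists_rightInverse_of_surjective (LinearMap.range_eq_top.mpr hsurj)
  have hB' : ∀ v : degreeTwo s, A₀ (B v) = v := fun v => LinearMap.congr_fun hB v
  have hfin : ((fun t : ℂ => -t⁻¹) ⁻¹' {μ | Module.End.HasEigenvalue (A₁ ∘ₗ B) μ}).Finite :=
    (Module.End.finite_hasEigenvalue (A₁ ∘ₗ B)).preimage fun x _ y _ h => by simpa using h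
  refine hfin.subset fun t ht => ?_
  by_contra hne
  refine ht ⟨?_, fun v hv => ?_⟩
  · exact mem_degreeTwo.mp ((degreeTwo s).add_mem ha2 ((degreeTwo s).smul_mem t hb2))
  · have hinj : Function.Injective (LinearMap.id + t • (A₁ ∘ₗ B) : Module.End ℂ (degreeTwo s)) := by
      rw [← LinearMap.ker_eq_bot, LinearMap.ker_eq_bot']
      intro v hv
      by_contra hv0
      simp only [LinearMap.add_apply, LinearMap.id_apply, LinearMap.smul_apply] at hv
      have ht0 : t ≠ 0 := by
        rintro rfl
        rw [zero_smul, add_zero] at hv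
        exact hv0 hv
      refine hne (Module.End.hasEigenvalue_of_hasEigenvector (x := v)
        ⟨Module.End.mem_eigenspace_iff.mpr ?_, hv0⟩)
      rw [neg_smul, ← smul_neg, neg_eq_of_add_eq_zero_right hv, smul_smul,
        inv_mul_cancel₀ ht0, one_smul]
    obtain ⟨u, hu⟩ := LinearMap.injective_iff_surjective.mp hinj ⟨v, mem_degreeTwo.mpr hv⟩
    refine ⟨B u, (B u).2, ?_⟩
    have h1 := congrArg Subtype.val hu
    simp only [LinearMap.add_apply, LinearMap.id_apply, LinearMap.smul_apply] at h1
    rw [add_lie, smul_lie, ← h1]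
    exact congrArg (fun w : degreeTwo s => (w : 𝔤) + t • ⁅b - a, (B u : 𝔤)⁆) (hB' u)

/-- The elements of `openDegreeTwo s` form a single orbit. -/
lemma exists_map_eq_of_mem_openDegreeTwo {s a b : 𝔤} (ha : a ∈ openDegreeTwo s)
    (hb : b ∈ openDegreeTwo s) : ∃ σ ∈ innerGroup 𝔤, σ a = b := by
  refine rel_of_line_connected (U := openDegreeTwo s)
    (r := fun a b => ∃ σ ∈ innerGroup 𝔤, σ a = b) ⟨?_, ?_, ?_⟩ ?_ ?_ ha hb
  · exact fun x => ⟨1, one_mem _, rfl⟩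
  · rintro x y ⟨σ, hσ, rfl⟩
    exact ⟨σ⁻¹, inv_mem hσ, σ.symm_apply_apply x⟩
  · rintro x y z ⟨σ, hσ, rfl⟩ ⟨τ, hτ, rfl⟩
    exact ⟨τ * σ, mul_mem hτ hσ, rfl⟩
  · exact fun a ha b hb => finite_notMem_openDegreeTwo_line ha hb
  · intro x hx v
    have hx2 : x ∈ degreeTwo s := mem_degreeTwo.mpr hx.1
    by_cases hv : v ∈ degreeTwo s
    -- Bracketing x with degree zero already gives all of degree two, so exponentials of degree zero
    -- elements alone cover a neighbourhood of x there; the extra parameter space is trivial.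
    · have h := eventually_line_exists_exp (degreeTwoAction s)
        (0 : PUnit →ₗ[ℂ] degreeTwo s) ⟨x, hx2⟩ (fun u => by
          obtain ⟨w, hw, hw'⟩ := hx.2 u (mem_degreeTwo.mp u.2)
          refine ⟨⟨-w, by rw [LinearMap.mem_ker, ad_apply, lie_neg, hw, neg_zero]⟩, 0,
            Subtype.ext ?_⟩
          change (u : 𝔤) = ⁅-w, x⁆ + 0
          rw [add_zero, neg_lie, lie_skew, hw']) ⟨v, hv⟩
      filter_upwards [h] with t ht _
      obtain ⟨y, p, S, hS, ht⟩ := ht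
      obtain ⟨σ, hσ⟩ := exists_equiv_isExp (ad ℂ 𝔤 (y : 𝔤))
      refine ⟨σ, mem_innerGroup_of_isExp hσ, ?_⟩
      have h1 := hS.intertwine hσ (A := (degreeTwo s).subtype) (fun _ => rfl) ⟨x, hx2⟩
      have h2 := congrArg Subtype.val ht
      rw [LinearMap.zero_apply, add_zero] at h2
      exact h1.symm.trans h2.symm
    -- A line through x in a direction outside the degree two part meets it at t = 0 only.
    · refine Filter.Eventually.of_forall fun t ht => ?_
      have h1 := (degreeTwo s).sub_mem (mem_degreeTwo.mpr ht.1) hx2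
      rw [add_sub_cancel_left] at h1
      rcases eq_or_ne t 0 with rfl | ht0
      · exact ⟨1, one_mem _, by simp⟩
      · exact absurd (((degreeTwo s).smul_mem_iff ht0).mp h1) hv

variable [IsKilling ℂ 𝔤]

/-- The weights of H separate its elements because their kernels meet trivially. Each weight takes
at s an eigenvalue of ad s, hence one of finitely many integers, and there are finitely many
weights. -/
lemma finite_integral_elements (H : LieSubalgebra ℂ 𝔤) [H.IsCartanSubalgebra] (n : ℤ) :
    {s : 𝔤 | s ∈ H ∧ ∀ (v : 𝔤) (μ : ℂ), v ≠ 0 → ⁅s, v⁆ = μ • v →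
      ∃ i : ℤ, i ∈ Finset.Icc (-n) n ∧ μ = (i : ℂ)}.Finite := by
  set A := {s : H | ∀ (v : 𝔤) (μ : ℂ), v ≠ 0 → ⁅(s : 𝔤), v⁆ = μ • v →
      ∃ i : ℤ, i ∈ Finset.Icc (-n) n ∧ μ = (i : ℂ)} with hA
  have hAfin : A.Finite := by
    have hinj : Set.InjOn (fun (s : H) (α : LieModule.Weight ℂ H 𝔤) => α s) A := by
      intro s _ s' _ h
      have : s - s' ∈ (iInf fun α : LieModule.Weight ℂ H 𝔤 => (LieModule.Weight.ker (χ := α)) : Submodule ℂ H) := by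
        rw [Submodule.mem_iInf]
        intro α
        change LieModule.Weight.toLinear ℂ H 𝔤 α (s - s') = 0
        rw [map_sub, sub_eq_zero]
        exact congrFun h α
      rw [IsKilling.iInf_ker_weight_eq_bot, Submodule.mem_bot, sub_eq_zero] at this
      exact this
    refine Set.Finite.of_finite_image ?_ hinj
    refine (Set.Finite.pi' (t := fun _ : LieModule.Weight ℂ H 𝔤 =>
      ((fun i : ℤ => (i : ℂ)) '' (Finset.Icc (-n) n : Set ℤ)))
      fun _ => (Finset.finite_toSet _).image _).subset ?_
    rintro _ ⟨s, hs, rfl⟩ α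
    obtain ⟨v, hv, hv0⟩ := α.exists_ne_zero
    obtain ⟨i, hi, hi2⟩ := hs v (α s) hv0 (IsKilling.lie_eq_smul_of_mem_rootSpace hv s)
    exact ⟨i, hi, hi2.symm⟩
  refine (hAfin.image Subtype.val).subset ?_
  rintro s ⟨hs, h⟩
  exact ⟨⟨s, hs⟩, h, rfl⟩

/-- There are finitely many nilpotent orbits. -/
theorem exists_finite_nilpotent_classification (𝔤 : Type*) [LieRing 𝔤] [LieAlgebra ℂ 𝔤]
    [FiniteDimensional ℂ 𝔤] [IsKilling ℂ 𝔤] :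
    ∃ (F : Set 𝔤) (c : 𝔤 → 𝔤), F.Finite ∧ (∀ e, IsNilpotent (ad ℂ 𝔤 e) → c e ∈ F) ∧
      ∀ e e', IsNilpotent (ad ℂ 𝔤 e) → IsNilpotent (ad ℂ 𝔤 e') → c e = c e' →
        ∃ σ ∈ innerGroup 𝔤, σ e = e' := by
  obtain ⟨x₀, hx₀⟩ := exists_isRegular ℂ 𝔤
  have := isCartanSubalgebra_engel_of_isRegular hx₀
  set F := {s : 𝔤 | s ∈ LieSubalgebra.engel ℂ x₀ ∧ ∀ (v : 𝔤) (μ : ℂ), v ≠ 0 → ⁅s, v⁆ = μ • v →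
      ∃ i : ℤ, i ∈ Finset.Icc (-(2 * finrank ℂ 𝔤 : ℤ)) (2 * finrank ℂ 𝔤) ∧ μ = (i : ℂ)} with hF
  -- Conjugating the grading element of e into the fixed Cartan subalgebra keeps its eigenvalues and
  -- carries e to an element of the corresponding open orbit.
  have key : ∀ e : 𝔤, ∃ s : 𝔤, IsNilpotent (ad ℂ 𝔤 e) →
      s ∈ F ∧ ∃ σ ∈ innerGroup 𝔤, σ e ∈ openDegreeTwo s := by
    intro e
    by_cases he : IsNilpotent (ad ℂ 𝔤 e)
    · obtain ⟨s, hs, hse, hint, hopen⟩ := exists_grading_element he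
      obtain ⟨σ, hσ, hσs⟩ := exists_map_mem_engel_of_isSemisimple hx₀ hs
      refine ⟨σ s, fun _ => ⟨⟨hσs, fun v μ hv hμ => ?_⟩, σ, hσ, ?_, fun v hv => ?_⟩⟩
      · refine hint (σ.symm v) μ (by simpa using hv) (σ.injective ?_)
        rw [innerGroup_lie hσ, map_smul, LinearEquiv.apply_symm_apply, hμ]
      · rw [← innerGroup_lie hσ, hse, map_smul]
      · obtain ⟨w, hw, hw'⟩ := hopen (σ.symm v) (σ.injective (by
          rw [innerGroup_lie hσ, map_smul, LinearEquiv.apply_symm_apply, hv]))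
        refine ⟨σ w, by rw [← innerGroup_lie hσ, hw, map_zero], ?_⟩
        rw [← innerGroup_lie hσ, hw', LinearEquiv.apply_symm_apply]
    · exact ⟨0, fun h => absurd h he⟩
  -- The map c is a mere choice, not an orbit invariant; only the fact that equal values force
  -- conjugacy is needed.
  choose c hc using key
  refine ⟨F, c, finite_integral_elements _ _, fun e he => (hc e he).1, fun e e' he he' h => ?_⟩
  obtain ⟨-, σ, hσ, hσe⟩ := hc e he
  obtain ⟨-, σ', hσ', hσe'⟩ := hc e' he'
  rw [h] at hσe
  obtain ⟨τ, hτ, h1⟩ := exists_map_eq_of_mem_openDegreeTwo hσe hσe'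
  refine ⟨σ'⁻¹ * τ * σ, mul_mem (mul_mem (inv_mem hσ') hτ) hσ, ?_⟩
  change σ'.symm (τ (σ e)) = e'
  rw [h1, LinearEquiv.symm_apply_apply]

end NilpotentOrbits

end QuasiLisse

namespace QuasiLisse

open Module Filter Topology LieAlgebra VertexAlgebra

attribute [local instance 100] LieRing.ofAssociativeRing

/-! ### Leibniz rules and scalings of the C₂-algebra -/

section Poisson

variable {V : Type*} [AddCommGroup V] [Module ℂ V] [VertexAlgebra V]

/-- The commutator formula with l = 0 retains only its j = 0 term, so a₍₀₎ is a derivation of the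
product a₍₋₁₎b already on V. -/
lemma poisson_mul (f g h : ZhuC2 V) :
    ZhuC2.poisson f (g * h) = ZhuC2.poisson f g * h + g * ZhuC2.poisson f h := by
  obtain ⟨a, rfl⟩ := ZhuC2.mk_surjective f
  obtain ⟨b, rfl⟩ := ZhuC2.mk_surjective g
  obtain ⟨c, rfl⟩ := ZhuC2.mk_surjective h
  simp only [ZhuC2.mk_mul_mk, ZhuC2.poisson_mk, nthProd_apply, ← map_add]
  have h := commutator a b c 0 (-1)
  rw [finsum_eq_single _ 0, sub_eq_iff_eq_add] at h
  · rw [h]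
    simp
  · rintro (_ | j) hj
    · exact absurd rfl hj
    · simp [Ring.choose_zero_succ]

/-- In contrast to the other variable, this holds only modulo C₂: in the iterate formula for
(a₍₋₁₎b)₍₀₎ all terms with j ≥ 1 contain an outer mode of index at most -2. -/
lemma mul_poisson (f g h : ZhuC2 V) :
    ZhuC2.poisson (f * g) h = f * ZhuC2.poisson g h + g * ZhuC2.poisson f h := by
  obtain ⟨a, rfl⟩ := ZhuC2.mk_surjective f
  obtain ⟨b, rfl⟩ := ZhuC2.mk_surjective g
  obtain ⟨c, rfl⟩ := ZhuC2.mk_surjective h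
  simp only [ZhuC2.mk_mul_mk, ZhuC2.poisson_mk, nthProd_apply, ← map_add]
  rw [ZhuC2.mk_eq_mk]
  have hfin := borcherds_right_finite a b c 0 0 (-1)
  simp only [zero_add] at hfin
  have h := finsum_sub_zero_mem (M := C2 V) hfin fun j =>
    (C2 V).toAddSubgroup.zsmul_mem ((C2 V).sub_mem (mode_mem_C2 (by push_cast; omega) _ _)
      ((C2 V).toAddSubgroup.zsmul_mem (mode_mem_C2 (by push_cast; omega) _ _) _)) _
  have hit := iterate a b c 0 (-1)
  simp only [zero_add] at hit
  rw [← hit] at h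
  simpa only [pow_zero, Ring.choose_zero_right, mul_one, one_smul, Int.negOnePow_neg,
    Int.negOnePow_one, Nat.cast_zero, sub_zero, add_zero, Units.val_neg, Units.val_one, neg_smul,
    sub_neg_eq_add] using h

lemma poisson_one (f : ZhuC2 V) : ZhuC2.poisson f 1 = 0 := by
  have h := poisson_mul f 1 1
  rwa [mul_one, mul_one, one_mul, left_eq_add] at h

lemma one_poisson (f : ZhuC2 V) : ZhuC2.poisson 1 f = 0 := by
  have h := mul_poisson 1 1 f
  rwa [mul_one, one_mul, left_eq_add] at h

/-- An element that Poisson commutes with generators is central. -/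
lemma poisson_eq_zero_of_adjoin {s : Set (ZhuC2 V)} (hs : Algebra.adjoin ℂ s = ⊤) {z : ZhuC2 V}
    (hz : ∀ f ∈ s, ZhuC2.poisson f z = 0) (f : ZhuC2 V) : ZhuC2.poisson f z = 0 := by
  have hf : f ∈ Algebra.adjoin ℂ s := hs ▸ Algebra.mem_top
  induction hf using Algebra.adjoin_induction with
  | mem f hf => exact hz f hf
  | algebraMap r =>
    rw [Algebra.algebraMap_eq_smul_one, map_smul, LinearMap.smul_apply, one_poisson, smul_zero]
  | add f g _ _ hf hg => rw [map_add, LinearMap.add_apply, hf, hg, add_zero]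
  | mul f g _ _ hf hg => rw [mul_poisson, hf, hg, mul_zero, mul_zero, add_zero]

/-- `T` acts like the `ℂˣ`-action `r ^ L₀`. -/
structure IsScaling (r : ℂ) (T : End ℂ V) : Prop where
  vacuum : T vacuum = vacuum
  nthProd : ∀ (a : V) (n : ℤ) (b : V), T (nthProd n a b) = r ^ (-n - 1) • nthProd n (T a) (T b)

/-- The vectors `a` for which `T` satisfies the scaling rule for all products `a₍ₙ₎b`. -/
def scalingSubmodule (r : ℂ) (T : End ℂ V) : Submodule ℂ V where
  carrier := {a | ∀ (n : ℤ) (b : V), T (nthProd n a b) = r ^ (-n - 1) • nthProd n (T a) (T b)}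
  add_mem' {a a'} ha ha' n b := by
    simp only [map_add, LinearMap.add_apply, ha n b, ha' n b, smul_add]
  zero_mem' n b := by simp
  smul_mem' s a ha n b := by
    simp only [map_smul, LinearMap.smul_apply, ha n b, smul_comm s]

/-- In every term of the iterate formula for (a₍ₘ₎b)₍ₙ₎c the two modes add up to m + n, so T
contributes the same power r^(-m-n-2) throughout. The scaling rule therefore has to be checked on
generators only. -/
lemma nthProd_mem_scalingSubmodule {r : ℂ} (hr : r ≠ 0) {T : End ℂ V} {a b : V}
    (ha : a ∈ scalingSubmodule r T) (hb : b ∈ scalingSubmodule r T) (m : ℤ) :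
    nthProd m a b ∈ scalingSubmodule r T := by
  intro n c
  rw [ha m b, map_smul, LinearMap.smul_apply]
  simp only [nthProd_apply]
  rw [iterate, iterate]
  have hfin := borcherds_right_finite a b c 0 n m
  have hfin' := borcherds_right_finite (T a) (T b) (T c) 0 n m
  simp only [zero_add] at hfin hfin'
  have h1 := T.toAddMonoidHom.map_finsum hfin
  simp only [LinearMap.toAddMonoidHom_coe] at h1
  rw [h1, ← mul_smul, ← zpow_add₀ hr, smul_finsum' _ hfin']
  refine finsum_congr fun j => ?_
  rw [map_zsmul, smul_comm, map_sub, map_zsmul]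
  congr 1
  simp only [← nthProd_apply]
  rw [ha _ _, hb _ _, hb _ _, ha _ _, map_smul, map_smul, ← mul_smul, ← mul_smul, ← zpow_add₀ hr,
    ← zpow_add₀ hr, smul_sub, smul_comm (m.negOnePow : ℤ),
    show -(m - (j : ℤ)) - 1 + (-(n + j) - 1) = -n - 1 + (-m - 1) by ring,
    show -(n + m - (j : ℤ)) - 1 + (-j - 1) = -n - 1 + (-m - 1) by ring]

/-- The automorphism of `R_V` induced by a scaling. -/
def IsScaling.zhu {r : ℂ} {T : End ℂ V} (h : IsScaling r T) : ZhuC2 V →ₐ[ℂ] ZhuC2 V :=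
  AlgHom.ofLinearMap
    ((C2 V).mapQ (C2 V) T (by
      refine Submodule.span_le.mpr ?_
      rintro _ ⟨a, b, rfl⟩
      rw [SetLike.mem_coe, Submodule.mem_comap, h.nthProd]
      exact (C2 V).smul_mem _ (Submodule.subset_span ⟨_, _, rfl⟩)))
    (congrArg (ZhuC2.mk V) h.vacuum)
    (fun x y => by
      obtain ⟨a, rfl⟩ := ZhuC2.mk_surjective x
      obtain ⟨b, rfl⟩ := ZhuC2.mk_surjective y
      change ZhuC2.mk V (T (VertexAlgebra.nthProd (-1) a b)) =
        ZhuC2.mk V (VertexAlgebra.nthProd (-1) (T a) (T b))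
      rw [h.nthProd]
      simp)

end Poisson

end QuasiLisse

namespace QuasiLisse

open Module Filter Topology LieAlgebra VertexAlgebra FieldCalculus
open AffineVertexAlgebra AffineVertexAlgebra.Universal
open scoped TensorProduct

attribute [local instance 100] LieRing.ofAssociativeRing

/-! ### Generators and brackets in the C₂-algebra of V_k(𝔤) -/

section Affine

variable {𝔤 : Type*} [LieRing 𝔤] [LieAlgebra ℂ 𝔤] [FiniteDimensional ℂ 𝔤] [LieAlgebra.IsSimple ℂ 𝔤]
  {k : ℂ}

lemma affine_induction {p : AffineLieAlgebra 𝔤 → Prop} (X : AffineLieAlgebra 𝔤)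
    (current : ∀ (x : 𝔤) (n : ℤ), p (current x n)) (central : p (centralElement 𝔤))
    (zero : p 0) (add : ∀ X Y, p X → p Y → p (X + Y)) (smul : ∀ (r : ℂ) X, p X → p (r • X)) :
    p X := by
  have hX : X ∈ Submodule.span ℂ
      ({X | ∃ (x : 𝔤) (n : ℤ), X = AffineVertexAlgebra.current x n} ∪ {centralElement 𝔤}) := by
    rw [span_eq_top]; trivial
  induction hX using Submodule.span_induction with
  | mem X hX =>
    rcases hX with ⟨x, n, rfl⟩ | rfl
    · exact current x n
    · exact central
  | zero => exact zero
  | add X Y _ _ hX hY => exact add X Y hX hY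
  | smul r X _ hX => exact smul r X hX

/-- `V^k(𝔤)` is spanned by products of negative modes applied to the vacuum. -/
lemma eq_top_of_negative_stable (W : Submodule ℂ (Universal 𝔤 k)) (h0 : vac 𝔤 k ∈ W)
    (h : ∀ (x : 𝔤) (n : ℤ), n ≤ -1 → ∀ w ∈ W, act (current x n) w ∈ W) : W = ⊤ := by
  let S : Set (Submodule ℂ (Universal 𝔤 k)) :=
    {W | vac 𝔤 k ∈ W ∧ ∀ (x : 𝔤) (n : ℤ), n ≤ -1 → ∀ w ∈ W, act (current x n) w ∈ W}
  have hS : sInf S ∈ S :=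
    ⟨Submodule.mem_sInf.mpr fun M hM => hM.1, fun x n hn w hw => Submodule.mem_sInf.mpr
      fun M hM => hM.2 x n hn w (Submodule.mem_sInf.mp hw M hM)⟩
  -- This avoids the PBW theorem. M collects the vectors of the least negative-stable subspace that
  -- all modes keep inside it. The commutation relations show that M is itself negative-stable, so
  -- by minimality the least subspace is stable under the whole affine algebra.
  let M : Submodule ℂ (Universal 𝔤 k) :=
    sInf S ⊓ ⨅ (x : 𝔤) (n : ℤ), (sInf S).comap (act (current x n))
  have hM : ∀ w, w ∈ M ↔ w ∈ sInf S ∧ ∀ (x : 𝔤) (n : ℤ), act (current x n) w ∈ sInf S := by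
    intro w
    simp [M, Submodule.mem_iInf]
  have hMS : M ∈ S := by
    refine ⟨(hM _).mpr ⟨hS.1, fun x n => ?_⟩, fun x n hn w hw => ?_⟩
    · rcases le_or_gt 0 n with hn | hn
      · rw [act_current_vac x n hn]
        exact Submodule.zero_mem _
      · exact hS.2 x n (by omega) _ hS.1
    · rw [hM] at hw ⊢
      refine ⟨hw.2 x n, fun y m => ?_⟩
      rw [sub_eq_iff_eq_add.mp (act_current_comm y x m n w)]
      exact add_mem (add_mem (hw.2 _ _) (Submodule.smul_mem _ _ hw.1))
        (hS.2 x n hn _ (hw.2 y m))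
  have htop : sInf S = ⊤ := by
    refine eq_top_of_stable _ hS.1 fun X w hw => ?_
    refine affine_induction (p := fun X => act X w ∈ sInf S) X ?_ ?_ ?_ ?_ ?_
    · exact fun x n => ((hM w).mp (sInf_le hMS hw)).2 x n
    · rw [act_centralElement]
      exact Submodule.smul_mem _ _ hw
    · rw [act_apply, map_zero, zero_smul]
      exact Submodule.zero_mem _
    · intro X Y hX hY
      rw [act_add]
      exact add_mem hX hY
    · intro r X hX
      rw [act_smul]
      exact Submodule.smul_mem _ _ hX
  exact top_le_iff.mp (htop ▸ sInf_le (show W ∈ S from ⟨h0, h⟩))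

/-- The projection of `V^k(𝔤)` onto its simple quotient. -/
noncomputable def toSimple : Universal 𝔤 k →ₗ[ℂ] Simple 𝔤 k := (maximalIdeal 𝔤 k).mkQ

lemma toSimple_surjective : Function.Surjective (toSimple : Universal 𝔤 k → Simple 𝔤 k) :=
  Submodule.mkQ_surjective _

/-- The projection of `V^k(𝔤)` onto Zhu's algebra of the simple quotient. -/
noncomputable def zhuProj : Universal 𝔤 k →ₗ[ℂ] ZhuC2 (Simple 𝔤 k) :=
  ZhuC2.mk (Simple 𝔤 k) ∘ₗ toSimple

variable (k) in
/-- The class of `(y t⁻¹)|0⟩` in Zhu's algebra. -/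
noncomputable def zhuCurrent : 𝔤 →ₗ[ℂ] ZhuC2 (Simple 𝔤 k) where
  toFun y := ZhuC2.mk _ (currentVector y)
  map_add' x y := by
    have h : current (x + y) (-1) = current x (-1) + current y (-1) := by
      simp only [current, TensorProduct.tmul_add, ← map_add, Prod.mk_add_mk, add_zero]
    simp only [currentVector, h, act_add]
    rfl
  map_smul' r x := by
    have h : current (r • x) (-1) = r • current x (-1) := by
      simp only [current, TensorProduct.tmul_smul, ← map_smul, Prod.smul_mk, smul_zero]
    simp only [currentVector, h, act_smul]
    rfl

lemma zhuProj_surjective : Function.Surjective (zhuProj : Universal 𝔤 k → _) :=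
  ZhuC2.mk_surjective.comp toSimple_surjective

lemma zhuProj_vac : zhuProj (vac 𝔤 k) = 1 := rfl

lemma nthProd_toSimple (a : Universal 𝔤 k) (n : ℤ) (b : Universal 𝔤 k) :
    nthProd n (toSimple a) (toSimple b) = toSimple (nthProd n a b) :=
  quotientY_mode (maximalIdeal_isIdeal 𝔤 k) a n b

lemma nthProd_currentVector (x : 𝔤) (n : ℤ) (v : Universal 𝔤 k) :
    nthProd n (currentVector x) (toSimple v) =
      toSimple (act (current x n) v) := by
  rw [← currentField_mode, ← Y_current]
  exact nthProd_toSimple _ n v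

lemma zhuProj_act_neg_one (x : 𝔤) (v : Universal 𝔤 k) :
    zhuProj (act (current x (-1)) v) = zhuCurrent k x * zhuProj v := by
  refine (congrArg (ZhuC2.mk _) (nthProd_currentVector x (-1) v)).symm.trans ?_
  rfl

lemma zhuProj_act_zero (x : 𝔤) (v : Universal 𝔤 k) :
    zhuProj (act (current x 0) v) = ZhuC2.poisson (zhuCurrent k x) (zhuProj v) := by
  refine (congrArg (ZhuC2.mk _) (nthProd_currentVector x 0 v)).symm.trans ?_
  rfl

lemma zhuProj_act_of_le (x : 𝔤) {n : ℤ} (hn : n ≤ -2) (v : Universal 𝔤 k) :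
    zhuProj (act (current x n) v) = 0 := by
  refine (congrArg (ZhuC2.mk _) (nthProd_currentVector x n v)).symm.trans ?_
  exact (Submodule.Quotient.mk_eq_zero _).mpr (mode_mem_C2 hn _ _)

/-- V is spanned by negative modes applied to the vacuum. In the C₂-algebra the mode -1 is
multiplication by a generator, and lower modes give zero. -/
lemma adjoin_range_zhuCurrent : Algebra.adjoin ℂ (Set.range (zhuCurrent (𝔤 := 𝔤) k)) = ⊤ := by
  set A := Algebra.adjoin ℂ (Set.range (zhuCurrent (𝔤 := 𝔤) k))
  have h : (Subalgebra.toSubmodule A).comap zhuProj = ⊤ := by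
    refine eq_top_of_negative_stable _ ?_ fun x n hn w hw => ?_
    · rw [Submodule.mem_comap, zhuProj_vac]
      exact one_mem A
    · rw [Submodule.mem_comap] at hw ⊢
      rcases eq_or_lt_of_le hn with rfl | hn
      · rw [zhuProj_act_neg_one]
        exact mul_mem (S := Subalgebra ℂ _) (s := A) (Algebra.subset_adjoin ⟨x, rfl⟩) hw
      · rw [zhuProj_act_of_le x (by omega)]
        exact zero_mem A
  refine eq_top_iff.mpr fun r _ => ?_
  obtain ⟨v, rfl⟩ := zhuProj_surjective r
  exact (h ▸ Submodule.mem_top : v ∈ (Subalgebra.toSubmodule A).comap zhuProj)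

lemma isFinitelyStronglyGenerated_simple : IsFinitelyStronglyGenerated (Simple 𝔤 k) := by
  let b := Module.finBasis ℂ 𝔤
  classical
  refine ⟨⟨Finset.univ.image fun i => zhuCurrent k (b i), ?_⟩⟩
  rw [eq_top_iff, ← adjoin_range_zhuCurrent]
  refine Algebra.adjoin_le ?_
  rintro _ ⟨y, rfl⟩
  rw [← b.sum_repr y, map_sum]
  refine sum_mem fun i _ => ?_
  rw [map_smul]
  exact Subalgebra.smul_mem _ (Algebra.subset_adjoin (by simp)) _

/-- The level does not enter, since the central term of [x t⁰, y t⁻¹] vanishes: the bracket is the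
Kirillov–Kostant bracket for every k. -/
lemma poisson_zhuCurrent (x y : 𝔤) :
    ZhuC2.poisson (zhuCurrent k x) (zhuCurrent k y) = zhuCurrent k ⁅x, y⁆ := by
  have h1 : ∀ y : 𝔤, zhuCurrent k y = zhuProj (act (current y (-1)) (vac 𝔤 k)) := fun _ => rfl
  rw [h1 y, ← zhuProj_act_zero, sub_eq_iff_eq_add.mp (act_current_comm x y 0 (-1) (vac 𝔤 k)),
    act_current_vac x 0 le_rfl]
  simp [h1]

end Affine

/-! ### The action of ℂˣ by rescaling the loop parameter -/

section Rescale

variable {𝔤 : Type*} [LieRing 𝔤] [LieAlgebra ℂ 𝔤] [FiniteDimensional ℂ 𝔤] [LieAlgebra.IsSimple ℂ 𝔤]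
  {k : ℂ}

/-- The rescaling `x tⁿ ↦ r⁻ⁿ x tⁿ` of the loop parameter. -/
noncomputable def rescale (r : ℂ) : AffineLieAlgebra 𝔤 →ₗ[ℂ] AffineLieAlgebra 𝔤 :=
  (ofPair 𝔤).toLinearMap ∘ₗ LinearMap.prodMap
    (LinearMap.rTensor 𝔤 ((AddMonoidAlgebra.basis ℤ ℂ).constr ℂ
      fun n => AddMonoidAlgebra.single n (r ^ (-n)))) LinearMap.id ∘ₗ
    (ofPair 𝔤).symm.toLinearMap

lemma rescale_current (r : ℂ) (x : 𝔤) (n : ℤ) :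
    rescale r (current x n) = r ^ (-n) • current x n := by
  have h : (AddMonoidAlgebra.single n (1 : ℂ)) = AddMonoidAlgebra.basis ℤ ℂ n := by simp
  simp only [rescale, current, LinearMap.comp_apply, LinearEquiv.coe_coe,
    LinearEquiv.symm_apply_apply, LinearMap.prodMap_apply, LinearMap.rTensor_tmul]
  rw [h, Module.Basis.constr_basis, ← map_smul, Prod.smul_mk, TensorProduct.smul_tmul', ← h,
    AddMonoidAlgebra.smul_single, smul_eq_mul, mul_one, smul_zero]
  rfl

lemma rescale_centralElement (r : ℂ) : rescale r (centralElement 𝔤) = centralElement 𝔤 := by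
  simp [rescale, centralElement]

/-- The cocycle contributes only when m + n = 0, where the scaling factor is 1; this is consistent
with K being fixed. -/
lemma rescale_lie {r : ℂ} (hr : r ≠ 0) (X Y : AffineLieAlgebra 𝔤) :
    rescale r ⁅X, Y⁆ = ⁅rescale r X, rescale r Y⁆ := by
  refine affine_induction (p := fun X => rescale r ⁅X, Y⁆ = ⁅rescale r X, rescale r Y⁆) X
    (fun x m => ?_) ?_ (by simp) (fun X X' h h' => by simp only [add_lie, map_add, h, h'])
    (fun s X h => by simp only [smul_lie, map_smul, h])
  · refine affine_induction (p := fun Y => rescale r ⁅current x m, Y⁆ =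
      ⁅rescale r (current x m), rescale r Y⁆) Y
      (fun y n => ?_) ?_ (by simp) (fun X X' h h' => by simp only [lie_add, map_add, h, h'])
      (fun s X h => by simp only [lie_smul, map_smul, h])
    · rw [rescale_current, rescale_current, smul_lie, lie_smul, lie_current, map_add, map_smul,
        rescale_current, rescale_centralElement, smul_smul, ← zpow_add₀ hr, smul_add,
        show -m + -n = -(m + n) by ring]
      split_ifs with h
      · rw [h]; simp
      · simp
    · rw [rescale_centralElement, lie_centralElement, lie_centralElement, map_zero]
  · rw [rescale_centralElement, ← lie_skew, lie_centralElement, ← lie_skew (centralElement 𝔤),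
      lie_centralElement, neg_zero, map_zero]

/-- The action of the affine Lie algebra on `V^k(𝔤)` twisted by the rescaling. -/
noncomputable def rescaledAction {r : ℂ} (hr : r ≠ 0) :
    AffineLieAlgebra 𝔤 →ₗ⁅ℂ⁆ Module.End ℂ (Universal 𝔤 k) where
  toFun X := act (rescale r X)
  map_add' X Y := by ext v; rw [map_add, act_add]; rfl
  map_smul' s X := by ext v; rw [map_smul, act_smul]; rfl
  map_lie' {X Y} := by ext v; rw [rescale_lie hr, act_lie]; rfl

/-- The linear automorphism of `V^k(𝔤)` induced by the rescaling. -/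
noncomputable def rescaleUniversal {r : ℂ} (hr : r ≠ 0) : End ℂ (Universal 𝔤 k) :=
  ((vacuumIdeal 𝔤 k).restrictScalars ℂ).liftQ
    (LinearMap.applyₗ (vac 𝔤 k) ∘ₗ
      (UniversalEnvelopingAlgebra.lift ℂ (rescaledAction (k := k) hr)).toLinearMap) (by
    intro u hu
    rw [Submodule.restrictScalars_mem] at hu
    change UniversalEnvelopingAlgebra.lift ℂ (rescaledAction (k := k) hr) u (vac 𝔤 k) = 0
    induction hu using Submodule.span_induction with
    | mem u hu =>
      rcases hu with ⟨x, n, rfl⟩ | rfl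
      · rw [UniversalEnvelopingAlgebra.lift_ι_apply]
        change act (rescale r (current x n)) _ = 0
        rw [rescale_current, act_smul, act_current_vac x n (by positivity), smul_zero]
      · rw [map_sub, UniversalEnvelopingAlgebra.lift_ι_apply, AlgHom.commutes]
        change act (rescale r (centralElement 𝔤)) _ - k • vac 𝔤 k = 0
        rw [rescale_centralElement, act_centralElement, sub_self]
    | zero => rw [map_zero, LinearMap.zero_apply]
    | add u v _ _ hu hv => rw [map_add, LinearMap.add_apply, hu, hv, add_zero]
    | smul a u _ hu => rw [smul_eq_mul, map_mul, Module.End.mul_apply, hu, map_zero])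

lemma rescaleUniversal_proj {r : ℂ} (hr : r ≠ 0) (u : AffineEnvelope 𝔤) :
    rescaleUniversal hr (proj 𝔤 k u) =
      UniversalEnvelopingAlgebra.lift ℂ (rescaledAction (k := k) hr) u (vac 𝔤 k) := rfl

lemma rescaleUniversal_vac {r : ℂ} (hr : r ≠ 0) : rescaleUniversal hr (vac 𝔤 k) = vac 𝔤 k := by
  rw [vac, rescaleUniversal_proj, map_one]
  rfl

lemma rescaleUniversal_act {r : ℂ} (hr : r ≠ 0) (X : AffineLieAlgebra 𝔤) (v : Universal 𝔤 k) :
    rescaleUniversal hr (act X v) = act (rescale r X) (rescaleUniversal hr v) := by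
  obtain ⟨u, rfl⟩ := proj_surjective v
  rw [act_apply, ← map_smul, rescaleUniversal_proj, rescaleUniversal_proj, smul_eq_mul, map_mul,
    UniversalEnvelopingAlgebra.lift_ι_apply]
  rfl

/-- The scaling submodule contains the vacuum and the vectors (x t⁻¹)|0⟩ and is closed under all
products. Since the field of (x t⁻¹)|0⟩ is the current x(z), it is stable under all current modes,
hence everything. -/
lemma rescaleUniversal_isScaling {r : ℂ} (hr : r ≠ 0) :
    IsScaling r (rescaleUniversal (𝔤 := 𝔤) (k := k) hr) where
  vacuum := rescaleUniversal_vac hr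
  nthProd a := by
    suffices h : scalingSubmodule r (rescaleUniversal (𝔤 := 𝔤) (k := k) hr) = ⊤ from
      (h ▸ Submodule.mem_top : a ∈ scalingSubmodule r (rescaleUniversal (𝔤 := 𝔤) (k := k) hr))
    refine eq_top_of_negative_stable _ (fun n b => ?_) fun x m _ w hw => ?_
    · rw [rescaleUniversal_vac, ← vacuum_eq]
      simp only [nthProd_apply, vacuum_mode]
      split_ifs with h
      · subst h; simp
      · simp
    · rw [← currentField_mode, ← Y_current]
      refine nthProd_mem_scalingSubmodule hr (fun n b => ?_) hw m
      rw [rescaleUniversal_act, rescale_current, act_smul, rescaleUniversal_vac, map_smul,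
        LinearMap.smul_apply]
      simp only [nthProd_apply, Y_current, currentField_mode]
      rw [rescaleUniversal_act, rescale_current, act_smul, smul_smul, ← zpow_add₀ hr]
      congr 2
      ring

lemma rescaleUniversal_of_mem_weightSpace {r : ℂ} (hr : r ≠ 0) {d : ℤ} {v : Universal 𝔤 k}
    (hv : v ∈ weightSpace 𝔤 k d) : rescaleUniversal hr v = r ^ d • v := by
  induction hv using Submodule.span_induction with
  | mem v hv =>
    obtain ⟨l, hl, rfl⟩ := hv
    obtain rfl : d = -(l.map Prod.snd).sum := by omega
    clear hl
    induction l with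
    | nil => simp [rescaleUniversal_vac]
    | cons p l ih =>
      rw [List.foldr_cons, rescaleUniversal_act, rescale_current, act_smul, ih, map_smul, smul_smul,
        ← zpow_add₀ hr, List.map_cons, List.sum_cons]
      congr 2
      ring
  | zero => rw [map_zero, smul_zero]
  | add v w _ _ hv hw => rw [map_add, hv, hw, smul_add]
  | smul s v _ hv => rw [map_smul, hv, smul_comm]

/-- Here gradedness of the ideals enters: rescaling acts on conformal weight d as the scalar r^d, so
it preserves any subspace that is the sum of its weight components. -/
lemma maximalIdeal_le_comap_rescaleUniversal {r : ℂ} (hr : r ≠ 0) :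
    maximalIdeal 𝔤 k ≤ (maximalIdeal 𝔤 k).comap (rescaleUniversal hr) := by
  refine sSup_le fun I hI => ?_
  refine le_trans ?_ (Submodule.comap_mono (le_sSup hI))
  refine (show I = ⨆ d, I ⊓ weightSpace 𝔤 k d from hI.2.1).le.trans ?_
  refine iSup_le fun d v hv => ?_
  rw [Submodule.mem_comap, rescaleUniversal_of_mem_weightSpace hr hv.2]
  exact I.smul_mem _ hv.1

/-- The linear automorphism of `V_k(𝔤)` induced by the rescaling. -/
noncomputable def rescaleSimple {r : ℂ} (hr : r ≠ 0) : End ℂ (Simple 𝔤 k) :=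
  (maximalIdeal 𝔤 k).mapQ _ (rescaleUniversal hr) (maximalIdeal_le_comap_rescaleUniversal hr)

lemma rescaleSimple_isScaling {r : ℂ} (hr : r ≠ 0) :
    IsScaling r (rescaleSimple (𝔤 := 𝔤) (k := k) hr) where
  vacuum := congrArg toSimple (rescaleUniversal_vac hr)
  nthProd a n b := by
    obtain ⟨a, rfl⟩ := toSimple_surjective a
    obtain ⟨b, rfl⟩ := toSimple_surjective b
    refine (congrArg (rescaleSimple hr) (nthProd_toSimple a n b)).trans ?_
    refine (congrArg toSimple
      ((rescaleUniversal_isScaling hr).nthProd a n b)).trans ?_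
    refine (map_smul _ _ _).trans (congrArg (r ^ (-n - 1) • ·) ?_)
    exact (nthProd_toSimple _ n _).symm

/-- Zhu's algebra of `V_k(𝔤)` carries the contracting `ℂˣ`-action. -/
lemma exists_algHom_zhuCurrent {r : ℂ} (hr : r ≠ 0) :
    ∃ θ : ZhuC2 (Simple 𝔤 k) →ₐ[ℂ] ZhuC2 (Simple 𝔤 k),
      ∀ y : 𝔤, θ (zhuCurrent k y) = r • zhuCurrent k y := by
  refine ⟨(rescaleSimple_isScaling hr).zhu, fun y => ?_⟩
  have h : rescaleUniversal hr (act (current y (-1)) (vac 𝔤 k)) =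
      r • act (current y (-1)) (vac 𝔤 k) := by
    rw [rescaleUniversal_act, rescale_current, act_smul, rescaleUniversal_vac]
    simp
  exact congrArg zhuProj h

end Rescale

end QuasiLisse

namespace QuasiLisse

open Module Filter Topology LieAlgebra VertexAlgebra AffineVertexAlgebra

attribute [local instance 100] LieRing.ofAssociativeRing

/-! ### Nondegeneracy and invariance of the normalized form -/

section NormalizedForm

variable {𝔤 : Type*} [LieRing 𝔤] [LieAlgebra ℂ 𝔤] [FiniteDimensional ℂ 𝔤]

section IsKilling

variable [IsKilling ℂ 𝔤] {H : LieSubalgebra ℂ 𝔤} [H.IsCartanSubalgebra]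

/-- The trace over the weight spaces gives the sum of dim 𝔤_χ · χ(α^∨)², and χ(α^∨) is an integer,
the difference of the lengths of the two halves of the α-chain through χ. -/
lemma exists_nat_killingForm_coroot (α : LieModule.Weight ℂ H 𝔤) :
    ∃ n : ℕ, killingForm ℂ 𝔤 (IsKilling.coroot α) (IsKilling.coroot α) = n := by
  have h : killingForm ℂ 𝔤 (IsKilling.coroot α) (IsKilling.coroot α) =
      LieModule.traceForm ℂ H 𝔤 (IsKilling.coroot α) (IsKilling.coroot α) := rfl
  refine ⟨∑ χ : LieModule.Weight ℂ H 𝔤, finrank ℂ (LieModule.genWeightSpace 𝔤 χ) *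
    (LieModule.chainBotCoeff α χ - LieModule.chainTopCoeff α χ : ℤ).natAbs ^ 2, ?_⟩
  rw [h, LieModule.traceForm_eq_sum_finrank_nsmul_mul, Nat.cast_sum]
  refine Finset.sum_congr rfl fun χ _ => ?_
  rw [IsKilling.apply_coroot_eq_cast, nsmul_eq_mul, Nat.cast_mul, ← Int.cast_mul,
    ← Int.cast_natCast (_ ^ 2), Int.natCast_pow, Int.natCast_natAbs, sq_abs, sq]

lemma killingForm_coroot_ne_zero {α : LieModule.Weight ℂ H 𝔤} (hα : α.IsNonZero) :
    killingForm ℂ 𝔤 (IsKilling.coroot α) (IsKilling.coroot α) ≠ 0 := by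
  change LieModule.traceForm ℂ H 𝔤 (IsKilling.coroot α) (IsKilling.coroot α) ≠ 0
  rw [IsKilling.traceForm_coroot, IsKilling.root_apply_coroot hα]
  simpa using IsKilling.root_apply_cartanEquivDual_symm_ne_zero hα

variable (H) in
-- Otherwise all weights vanish on H. As their kernels meet trivially, H = 0, whose normalizer is
-- all of 𝔤, and H would not be self-normalizing.
lemma exists_isNonZero_weight [Nontrivial 𝔤] : ∃ α : LieModule.Weight ℂ H 𝔤, α.IsNonZero := by
  by_contra! h
  have h1 := IsKilling.iInf_ker_weight_eq_bot (K := ℂ) (H := H) (L := 𝔤)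
  have h2 : ∀ x : H, x = 0 := fun x => by
    rw [← Submodule.mem_bot ℂ, ← h1, Submodule.mem_iInf]
    intro α
    have h3 : α.IsZero := h α
    exact congrFun h3 x
  have h3 : H = ⊥ := (LieSubalgebra.eq_bot_iff H).mpr fun x hx => congrArg Subtype.val (h2 ⟨x, hx⟩)
  have h4 : H.normalizer = H := LieSubalgebra.IsCartanSubalgebra.self_normalizing
  obtain ⟨x, hx⟩ := exists_ne (0 : 𝔤)
  have h5 : x ∈ H.normalizer := (LieSubalgebra.mem_normalizer_iff H x).mpr fun y hy => by
    rw [h3, LieSubalgebra.mem_bot] at hy ⊢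
    rw [hy, lie_zero]
  rw [h4, h3, LieSubalgebra.mem_bot] at h5
  exact hx h5

end IsKilling

lemma killingForm_map_innerGroup {σ : 𝔤 ≃ₗ[ℂ] 𝔤} (h : σ ∈ innerGroup 𝔤) (x y : 𝔤) :
    killingForm ℂ 𝔤 (σ x) (σ y) = killingForm ℂ 𝔤 x y :=
  killingForm_of_equiv_apply { σ with map_lie' := innerGroup_lie h _ _ } x y

variable [LieAlgebra.IsSimple ℂ 𝔤]

/-- An infimum over an empty set of naturals would be 0, so a Cartan subalgebra with a root has to
be exhibited. The infimum is then attained at a coroot, whose Killing norm is nonzero. This makes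
the normalized form a nonzero multiple of the Killing form. -/
lemma minCorootNorm_ne_zero : minCorootNorm 𝔤 ≠ 0 := by
  obtain ⟨x, hx⟩ := exists_isRegular ℂ 𝔤
  have hC := isCartanSubalgebra_engel_of_isRegular hx
  have : Nontrivial 𝔤 := by
    by_contra hn
    rw [not_nontrivial_iff_subsingleton] at hn
    exact IsSimple.non_abelian (R := ℂ) (L := 𝔤) ⟨fun _ _ => Subsingleton.elim _ _⟩
  obtain ⟨α, hα⟩ := exists_isNonZero_weight (LieSubalgebra.engel ℂ x)
  obtain ⟨n, hn⟩ := exists_nat_killingForm_coroot α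
  obtain ⟨H, hH, β, hβ, h⟩ : minCorootNorm 𝔤 ∈ _ := Nat.sInf_mem ⟨n, _, hC, α, hα, hn⟩
  intro h0
  rw [h0] at h
  exact killingForm_coroot_ne_zero hβ (by simpa using h)

lemma normalizedForm_apply (x y : 𝔤) :
    normalizedForm 𝔤 x y = 2 / (minCorootNorm 𝔤 : ℂ) * killingForm ℂ 𝔤 x y := rfl

lemma eq_zero_of_normalizedForm {x : 𝔤} (h : ∀ y, normalizedForm 𝔤 x y = 0) : x = 0 := by
  refine (IsKilling.killingForm_nondegenerate ℂ 𝔤).1 x fun y => ?_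
  have h1 := h y
  rw [normalizedForm_apply] at h1
  refine (mul_eq_zero.mp h1).resolve_left ?_
  exact div_ne_zero two_ne_zero (Nat.cast_ne_zero.mpr minCorootNorm_ne_zero)

lemma exists_normalizedForm_eq (φ : 𝔤 →ₗ[ℂ] ℂ) : ∃ x, ∀ y, normalizedForm 𝔤 x y = φ y := by
  have hinj : Function.Injective (normalizedForm 𝔤 : 𝔤 →ₗ[ℂ] Dual ℂ 𝔤) := by
    rw [← LinearMap.ker_eq_bot, LinearMap.ker_eq_bot']
    exact fun x hx => eq_zero_of_normalizedForm fun y => LinearMap.congr_fun hx y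
  obtain ⟨x, hx⟩ := (LinearMap.injective_iff_surjective_of_finrank_eq_finrank
    (Subspace.dual_finrank_eq (K := ℂ) (V := 𝔤)).symm).mp hinj φ
  exact ⟨x, fun y => LinearMap.congr_fun hx y⟩

lemma normalizedForm_comm (x y : 𝔤) : normalizedForm 𝔤 x y = normalizedForm 𝔤 y x := by
  rw [normalizedForm_apply, normalizedForm_apply, killingForm, LieModule.traceForm_comm]

lemma normalizedForm_lie_left (x y z : 𝔤) :
    normalizedForm 𝔤 ⁅x, y⁆ z = -normalizedForm 𝔤 y ⁅x, z⁆ := by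
  rw [normalizedForm_apply, normalizedForm_apply, killingForm,
    LieModule.traceForm_lieInvariant ℂ 𝔤 𝔤 x y z]
  ring

lemma normalizedForm_map_innerGroup {σ : 𝔤 ≃ₗ[ℂ] 𝔤} (h : σ ∈ innerGroup 𝔤) (x y : 𝔤) :
    normalizedForm 𝔤 (σ x) (σ y) = normalizedForm 𝔤 x y := by
  rw [normalizedForm_apply, normalizedForm_apply, killingForm_map_innerGroup h]

end NormalizedForm

end QuasiLisse

namespace QuasiLisse

open Module Filter Topology LieAlgebra VertexAlgebra AffineVertexAlgebra

attribute [local instance 100] LieRing.ofAssociativeRing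

/-! ### Exponential generating functions of geometrically bounded sequences -/

section ExpSeries

/-- Sequences with at most geometric growth. -/
def HasGeometricGrowth (a : ℕ → ℂ) : Prop :=
  ∃ C K : ℝ, 0 ≤ C ∧ 0 ≤ K ∧ ∀ n, ‖a n‖ ≤ C * K ^ n

/-- The exponential generating function of a sequence. -/
noncomputable def expSeries (a : ℕ → ℂ) (t : ℝ) : ℂ := ∑' n : ℕ, (n.factorial : ℂ)⁻¹ * t ^ n * a n

namespace HasGeometricGrowth

variable {a b : ℕ → ℂ}

lemma add (ha : HasGeometricGrowth a) (hb : HasGeometricGrowth b) :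
    HasGeometricGrowth fun n => a n + b n := by
  obtain ⟨C, K, hC, hK, h⟩ := ha
  obtain ⟨C', K', hC', hK', h'⟩ := hb
  refine ⟨C + C', max K K', by positivity, by positivity, fun n => ?_⟩
  refine (norm_add_le _ _).trans ?_
  rw [add_mul]
  refine add_le_add ((h n).trans ?_) ((h' n).trans ?_)
  · gcongr
    exact le_max_left _ _
  · gcongr
    exact le_max_right _ _

/-- Binomial convolution of the bounds C K^n and C' K'^n is C C' (K + K')^n by the binomial theorem.
This carries convergence of the flow from generators of an algebra to products. -/
lemma mul (ha : HasGeometricGrowth a) (hb : HasGeometricGrowth b) :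
    HasGeometricGrowth fun n =>
      ∑ ij ∈ Finset.HasAntidiagonal.antidiagonal n, (n.choose ij.1 : ℂ) * (a ij.1 * b ij.2) := by
  obtain ⟨C, K, hC, hK, h⟩ := ha
  obtain ⟨C', K', hC', hK', h'⟩ := hb
  refine ⟨C * C', K + K', by positivity, by positivity, fun n => ?_⟩
  refine (norm_sum_le _ _).trans ?_
  rw [(Commute.all K K').add_pow', Finset.mul_sum]
  refine Finset.sum_le_sum fun ij _ => ?_
  rw [norm_mul, norm_mul, Complex.norm_natCast, nsmul_eq_mul]
  calc (n.choose ij.1 : ℝ) * (‖a ij.1‖ * ‖b ij.2‖)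
      ≤ (n.choose ij.1 : ℝ) * ((C * K ^ ij.1) * (C' * K' ^ ij.2)) := by
        gcongr
        · exact h _
        · exact h' _
    _ = C * C' * ((n.choose ij.1 : ℝ) * (K ^ ij.1 * K' ^ ij.2)) := by ring

lemma shift (ha : HasGeometricGrowth a) : HasGeometricGrowth fun n => a (n + 1) := by
  obtain ⟨C, K, hC, hK, h⟩ := ha
  refine ⟨C * K, K, by positivity, hK, fun n => (h _).trans_eq ?_⟩
  ring

lemma summable (ha : HasGeometricGrowth a) (t : ℝ) :
    Summable fun n : ℕ => ‖(n.factorial : ℂ)⁻¹ * t ^ n * a n‖ := by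
  obtain ⟨C, K, hC, hK, h⟩ := ha
  refine Summable.of_nonneg_of_le (fun n => norm_nonneg _) (fun n => ?_)
    ((Real.summable_pow_div_factorial (|t| * K)).mul_left C)
  rw [norm_mul, norm_mul, norm_inv, Complex.norm_natCast, norm_pow, Complex.norm_real,
    Real.norm_eq_abs]
  calc (n.factorial : ℝ)⁻¹ * |t| ^ n * ‖a n‖ ≤ (n.factorial : ℝ)⁻¹ * |t| ^ n * (C * K ^ n) := by
        gcongr
        exact h n
    _ = C * ((|t| * K) ^ n / n.factorial) := by rw [mul_pow]; ring

lemma expSeries_add (ha : HasGeometricGrowth a) (hb : HasGeometricGrowth b) (t : ℝ) :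
    expSeries (fun n => a n + b n) t = expSeries a t + expSeries b t := by
  rw [expSeries, expSeries, expSeries,
    ← (ha.summable t).of_norm.tsum_add (hb.summable t).of_norm]
  exact tsum_congr fun n => by ring

lemma expSeries_mul (ha : HasGeometricGrowth a) (hb : HasGeometricGrowth b) (t : ℝ) :
    expSeries (fun n =>
      ∑ ij ∈ Finset.HasAntidiagonal.antidiagonal n, (n.choose ij.1 : ℂ) * (a ij.1 * b ij.2)) t =
      expSeries a t * expSeries b t := by
  rw [expSeries, expSeries, expSeries,
    tsum_mul_tsum_eq_tsum_sum_antidiagonal_of_summable_norm (ha.summable t) (hb.summable t)]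
  refine tsum_congr fun n => ?_
  rw [Finset.mul_sum]
  refine Finset.sum_congr rfl fun ij hij => ?_
  rw [Finset.HasAntidiagonal.mem_antidiagonal] at hij
  subst hij
  have h := Nat.add_choose_mul_factorial_mul_factorial ij.1 ij.2
  rw [← Nat.choose_symm_add] at h
  have h' : ((ij.1 + ij.2).choose ij.1 : ℂ) * ij.1.factorial * ij.2.factorial =
      (ij.1 + ij.2).factorial := by exact_mod_cast h
  have h1 : (ij.1.factorial : ℂ) ≠ 0 := Nat.cast_ne_zero.mpr (Nat.factorial_ne_zero _)
  have h2 : (ij.2.factorial : ℂ) ≠ 0 := Nat.cast_ne_zero.mpr (Nat.factorial_ne_zero _)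
  have h3 : ((ij.1 + ij.2).factorial : ℂ) ≠ 0 := Nat.cast_ne_zero.mpr (Nat.factorial_ne_zero _)
  rw [pow_add]
  field_simp
  rw [← h']
  ring

lemma hasDerivAt_expSeries (ha : HasGeometricGrowth a) (t : ℝ) :
    HasDerivAt (expSeries a) (expSeries (fun n => a (n + 1)) t) t := by
  -- Termwise differentiation on the ball of radius |t| + 1, where the derivative series is
  -- dominated by its values at the radius.
  set T := |t| + 1
  have key := hasDerivAt_tsum_of_isPreconnected (𝕜 := ℝ) (F := ℂ) (t := Metric.ball (0 : ℝ) T)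
    (g := fun (n : ℕ) (s : ℝ) => (n.factorial : ℂ)⁻¹ * s ^ n * a n)
    (g' := fun (n : ℕ) (s : ℝ) => (n.factorial : ℂ)⁻¹ * (n * s ^ (n - 1)) * a n)
    (u := fun n : ℕ => ‖(n.factorial : ℂ)⁻¹ * (n * (T : ℂ) ^ (n - 1)) * a n‖)
    (y := t) (y₀ := 0) ?_ Metric.isOpen_ball (convex_ball _ _).isPreconnected ?_ ?_ ?_ ?_ ?_
  · have key' : HasDerivAt (expSeries a)
        (∑' n : ℕ, (n.factorial : ℂ)⁻¹ * (n * (t : ℂ) ^ (n - 1)) * a n) t := key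
    convert key' using 1
    rw [expSeries, tsum_eq_zero_add' (f := fun n : ℕ =>
      (n.factorial : ℂ)⁻¹ * (n * (t : ℂ) ^ (n - 1)) * a n)]
    · simp only [Nat.cast_zero, zero_mul, mul_zero, zero_add, add_tsub_cancel_right]
      refine tsum_congr fun n => ?_
      rw [Nat.factorial_succ]
      have h3 : (n.factorial : ℂ) ≠ 0 := Nat.cast_ne_zero.mpr (Nat.factorial_ne_zero _)
      have h4 : ((n : ℂ) + 1) ≠ 0 := Nat.cast_add_one_ne_zero n
      push_cast
      field_simp
    · refine ((ha.shift.summable t).of_norm).congr fun n => ?_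
      rw [Nat.factorial_succ]
      have h3 : (n.factorial : ℂ) ≠ 0 := Nat.cast_ne_zero.mpr (Nat.factorial_ne_zero _)
      have h4 : ((n : ℂ) + 1) ≠ 0 := Nat.cast_add_one_ne_zero n
      push_cast
      field_simp
  · rw [← summable_nat_add_iff 1]
    refine (ha.shift.summable T).congr fun n => ?_
    rw [Nat.factorial_succ]
    have h3 : (n.factorial : ℂ) ≠ 0 := Nat.cast_ne_zero.mpr (Nat.factorial_ne_zero _)
    have h4 : ((n : ℂ) + 1) ≠ 0 := Nat.cast_add_one_ne_zero n
    push_cast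
    congr 1
    field_simp
  · intro n s _
    have h := ((hasDerivAt_pow n (s : ℂ)).comp_ofReal.const_mul ((n.factorial : ℂ)⁻¹)).mul_const
      (a n)
    exact h
  · intro n s hs
    rw [mem_ball_zero_iff, Real.norm_eq_abs] at hs
    have hs' : |s| ≤ |T| := hs.le.trans (le_abs_self T)
    simp only [norm_mul, norm_pow, Complex.norm_real, Real.norm_eq_abs]
    gcongr
  · exact Metric.mem_ball_self (by positivity)
  · exact (ha.summable 0).of_norm
  · rw [mem_ball_zero_iff, Real.norm_eq_abs]
    exact lt_add_one _

end HasGeometricGrowth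

lemma expSeries_zero (a : ℕ → ℂ) : expSeries a 0 = a 0 := by
  rw [expSeries, tsum_eq_single 0]
  · simp
  · intro n hn
    simp [zero_pow hn]

lemma hasGeometricGrowth_pow {V : Type*} [AddCommGroup V] [Module ℂ V] [FiniteDimensional ℂ V]
    (T : End ℂ V) (φ : V →ₗ[ℂ] ℂ) (v : V) : HasGeometricGrowth fun n => φ ((T ^ n) v) := by
  let e := (finBasis ℂ V).equivFun
  let T' := LinearMap.toContinuousLinearMap (e.conj T)
  let φ' := LinearMap.toContinuousLinearMap (φ ∘ₗ e.symm.toLinearMap)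
  refine ⟨‖φ'‖ * ‖e v‖, ‖T'‖, by positivity, by positivity, fun n => ?_⟩
  have h : ∀ n, e ((T ^ n) v) = (T' ^ n) (e v) := by
    intro n
    induction n with
    | zero => rfl
    | succ n ih =>
      rw [pow_succ', Module.End.mul_apply, pow_succ', mul_apply_eq_comp, ← ih]
      simp [T', LinearEquiv.conj_apply]
  have h1 : φ ((T ^ n) v) = φ' ((T' ^ n) (e v)) := by
    rw [← h]
    simp [φ']
  have h2 : ∀ n, ‖(T' ^ n) (e v)‖ ≤ ‖T'‖ ^ n * ‖e v‖ := by
    intro n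
    induction n with
    | zero => simp
    | succ n ih =>
      rw [pow_succ', mul_apply_eq_comp, pow_succ', mul_assoc]
      exact T'.le_opNorm_of_le ih
  simp only [h1]
  calc ‖φ' ((T' ^ n) (e v))‖ ≤ ‖φ'‖ * (‖T'‖ ^ n * ‖e v‖) :=
        φ'.le_opNorm_of_le (h2 n)
    _ = ‖φ'‖ * ‖e v‖ * ‖T'‖ ^ n := by ring

end ExpSeries

/-! ### Integrating a derivation to a curve of points -/

section Flow

variable {R : Type*} [CommRing R] [Algebra ℂ R]

lemma pow_apply_mul {D : End ℂ R} (hD : ∀ f g, D (f * g) = D f * g + f * D g) (n : ℕ) (f g : R) :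
    (D ^ n) (f * g) = ∑ ij ∈ Finset.HasAntidiagonal.antidiagonal n,
      n.choose ij.1 • ((D ^ ij.1) f * (D ^ ij.2) g) := by
  induction n with
  | zero => simp
  | succ n ih =>
    rw [Finset.sum_antidiagonal_choose_succ_nsmul (fun i j => (D ^ i) f * (D ^ j) g) n, pow_succ',
      Module.End.mul_apply, ih, map_sum, ← Finset.sum_add_distrib]
    refine Finset.sum_congr rfl fun ij hij => ?_
    rw [map_nsmul, hD, ← Module.End.mul_apply, ← Module.End.mul_apply, ← pow_succ', ← pow_succ',
      nsmul_add, add_comm]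
    rw [Finset.HasAntidiagonal.mem_antidiagonal] at hij
    rw [Nat.choose_symm_of_eq_add hij.symm]

variable {D : End ℂ R} {χ : R →ₐ[ℂ] ℂ}

lemma map_pow_apply_mul (hD : ∀ f g, D (f * g) = D f * g + f * D g) (n : ℕ) (f g : R) :
    χ ((D ^ n) (f * g)) = ∑ ij ∈ Finset.HasAntidiagonal.antidiagonal n,
      (n.choose ij.1 : ℂ) * (χ ((D ^ ij.1) f) * χ ((D ^ ij.2) g)) := by
  rw [pow_apply_mul hD, map_sum]
  refine Finset.sum_congr rfl fun ij _ => ?_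
  rw [map_nsmul, map_mul, nsmul_eq_mul]

lemma pow_apply_algebraMap (hD : ∀ f g, D (f * g) = D f * g + f * D g) (r : ℂ) {n : ℕ}
    (hn : n ≠ 0) : (D ^ n) (algebraMap ℂ R r) = 0 := by
  have h1 : D 1 = 0 := by
    have h := hD 1 1
    rwa [mul_one, mul_one, one_mul, left_eq_add] at h
  obtain ⟨n, rfl⟩ := Nat.exists_eq_succ_of_ne_zero hn
  rw [Nat.succ_eq_add_one, pow_succ, Module.End.mul_apply, Algebra.algebraMap_eq_smul_one, map_smul,
    h1, smul_zero, map_zero]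

/-- The algebra may be infinite-dimensional, so exp(tD) is not available as an operator. By the
Leibniz rule, growth along D of a product is the binomial convolution of the growths of its factors,
so bounds on generators suffice for the series to converge after evaluation at χ. -/
lemma hasGeometricGrowth_of_adjoin (hD : ∀ f g, D (f * g) = D f * g + f * D g) {s : Set R}
    (hs : Algebra.adjoin ℂ s = ⊤) (h : ∀ f ∈ s, HasGeometricGrowth fun n => χ ((D ^ n) f))
    (f : R) : HasGeometricGrowth fun n => χ ((D ^ n) f) := by
  have hf : f ∈ Algebra.adjoin ℂ s := hs ▸ Algebra.mem_top
  induction hf using Algebra.adjoin_induction with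
  | mem f hf => exact h f hf
  | algebraMap r =>
    refine ⟨‖r‖, 1, by positivity, by positivity, fun n => ?_⟩
    rcases eq_or_ne n 0 with rfl | hn
    · simp
    · simp only [pow_apply_algebraMap hD r hn, map_zero, norm_zero]
      positivity
  | add f g _ _ hf hg => simpa only [map_add] using hf.add hg
  | mul f g _ _ hf hg => simpa only [map_pow_apply_mul hD] using hf.mul hg

/-- The flow of a derivation on the points of the spectrum. -/
noncomputable def flow (hD : ∀ f g, D (f * g) = D f * g + f * D g)
    (h : ∀ f, HasGeometricGrowth fun n => χ ((D ^ n) f)) (t : ℝ) : R →ₐ[ℂ] ℂ :=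
  { toFun := fun f => expSeries (fun n => χ ((D ^ n) f)) t
    map_one' := by
      rw [expSeries, tsum_eq_single 0]
      · simp
      · intro n hn
        rw [← map_one (algebraMap ℂ R), pow_apply_algebraMap hD 1 hn, map_zero, mul_zero]
    map_mul' := fun f g => by
      simp only [map_pow_apply_mul hD]
      exact (h f).expSeries_mul (h g) t
    map_zero' := by simp [expSeries]
    map_add' := fun f g => by
      simp only [map_add]
      exact (h f).expSeries_add (h g) t
    commutes' := fun r => by
      change expSeries _ t = r
      rw [expSeries, tsum_eq_single 0]
      · simp
      · intro n hn
        rw [pow_apply_algebraMap hD r hn, map_zero, mul_zero] }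

lemma flow_apply (hD : ∀ f g, D (f * g) = D f * g + f * D g)
    (h : ∀ f, HasGeometricGrowth fun n => χ ((D ^ n) f)) (t : ℝ) (f : R) :
    flow hD h t f = expSeries (fun n => χ ((D ^ n) f)) t := rfl

lemma flow_zero (hD : ∀ f g, D (f * g) = D f * g + f * D g)
    (h : ∀ f, HasGeometricGrowth fun n => χ ((D ^ n) f)) : flow hD h 0 = χ :=
  AlgHom.ext fun f => by rw [flow_apply, expSeries_zero, pow_zero, Module.End.one_apply]

lemma hasDerivAt_flow (hD : ∀ f g, D (f * g) = D f * g + f * D g)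
    (h : ∀ f, HasGeometricGrowth fun n => χ ((D ^ n) f)) (t : ℝ) (f : R) :
    HasDerivAt (fun s => flow hD h s f) (flow hD h t (D f)) t := by
  have h1 := (h f).hasDerivAt_expSeries t
  simp only [pow_succ, Module.End.mul_apply] at h1
  exact h1

end Flow

end QuasiLisse

namespace QuasiLisse

open Module Filter Topology LieAlgebra VertexAlgebra AffineVertexAlgebra

attribute [local instance 100] LieRing.ofAssociativeRing

/-! ### Orbits inside leaves and the finiteness criterion -/

section Leaves

variable {𝔤 : Type*} [LieRing 𝔤] [LieAlgebra ℂ 𝔤] [FiniteDimensional ℂ 𝔤] [LieAlgebra.IsSimple ℂ 𝔤]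
  {k : ℂ}

/-- The element of `𝔤` attached to a point of the associated variety. -/
noncomputable def point (χ : AssociatedVariety (Simple 𝔤 k)) : 𝔤 :=
  (exists_normalizedForm_eq (χ.toLinearMap ∘ₗ zhuCurrent k)).choose

lemma normalizedForm_point (χ : AssociatedVariety (Simple 𝔤 k)) (y : 𝔤) :
    normalizedForm 𝔤 (point χ) y = χ (zhuCurrent k y) :=
  (exists_normalizedForm_eq (χ.toLinearMap ∘ₗ zhuCurrent k)).choose_spec y

lemma point_eq {χ : AssociatedVariety (Simple 𝔤 k)} {x : 𝔤}
    (h : ∀ y, normalizedForm 𝔤 x y = χ (zhuCurrent k y)) : point χ = x := by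
  rw [← sub_eq_zero]
  refine eq_zero_of_normalizedForm fun y => ?_
  rw [map_sub, LinearMap.sub_apply, normalizedForm_point, h, sub_self]

/-- A character is determined by its values on the image of 𝔤, which generates the C₂-algebra. -/
lemma point_injective : Function.Injective (point (𝔤 := 𝔤) (k := k)) := by
  intro χ χ' h
  refine AlgHom.ext_of_adjoin_eq_top adjoin_range_zhuCurrent ?_
  rintro _ ⟨y, rfl⟩
  rw [← normalizedForm_point, h, normalizedForm_point]

lemma pow_poisson_zhuCurrent (y z : 𝔤) (n : ℕ) :
    ((ZhuC2.poisson (zhuCurrent k y) : End ℂ (ZhuC2 (Simple 𝔤 k))) ^ n) (zhuCurrent k z) =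
      zhuCurrent k ((ad ℂ 𝔤 y ^ n) z) := by
  induction n with
  | zero => rfl
  | succ n ih =>
    rw [pow_succ', Module.End.mul_apply, ih, poisson_zhuCurrent, pow_succ', Module.End.mul_apply,
      ad_apply]

/-- The exponential of `ad y` is realized by the flow of the Hamiltonian of `y`. -/
lemma exists_hamiltonianPath (χ : AssociatedVariety (Simple 𝔤 k)) {y : 𝔤} {σ : 𝔤 ≃ₗ[ℂ] 𝔤}
    (hσ : IsExp (ad ℂ 𝔤 y) (σ : 𝔤 →ₗ[ℂ] 𝔤)) :
    ∃ χ' : AssociatedVariety (Simple 𝔤 k), HamiltonianPath χ χ' ∧ point χ' = σ.symm (point χ) := by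
  set D : End ℂ (ZhuC2 (Simple 𝔤 k)) := ZhuC2.poisson (zhuCurrent k y)
  have hD : ∀ f g, D (f * g) = D f * g + f * D g := poisson_mul _
  have hgrowth : ∀ f, HasGeometricGrowth fun n => χ ((D ^ n) f) := by
    refine hasGeometricGrowth_of_adjoin hD adjoin_range_zhuCurrent ?_
    rintro _ ⟨z, rfl⟩
    simp only [D, pow_poisson_zhuCurrent]
    exact hasGeometricGrowth_pow (ad ℂ 𝔤 y) (χ.toLinearMap ∘ₗ zhuCurrent k) z
  refine ⟨flow hD hgrowth 1, ⟨zhuCurrent k y, flow hD hgrowth, flow_zero hD hgrowth, rfl,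
    fun t _ h => (hasDerivAt_flow hD hgrowth t h).hasDerivWithinAt⟩, point_eq fun z => ?_⟩
  have hσ' : σ ∈ innerGroup 𝔤 := mem_innerGroup_of_isExp hσ
  -- The time-one flow evaluates z at χ as χ(exp(ad y) z). Invariance of the form moves σ to the
  -- other argument, which is why the inverse of σ acts on the point.
  rw [← normalizedForm_map_innerGroup hσ', LinearEquiv.apply_symm_apply, normalizedForm_point,
    flow_apply]
  refine (HasSum.tsum_eq (hσ (χ.toLinearMap ∘ₗ zhuCurrent k) z)).symm.trans
    (tsum_congr fun n => ?_)
  rw [Complex.ofReal_one, one_pow, mul_one]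
  exact congrArg (fun r => (n.factorial : ℂ)⁻¹ * χ r) (pow_poisson_zhuCurrent y z n).symm

/-- This contains both the stability of X_V under the inner group and the inclusion of orbits in
leaves. Treating σ and its inverse together makes the inverse step of the induction on the generated
group a mere swap. -/
lemma exists_leaf_eq_of_mem_innerGroup {σ : 𝔤 ≃ₗ[ℂ] 𝔤} (hσ : σ ∈ innerGroup 𝔤) :
    (∀ χ : AssociatedVariety (Simple 𝔤 k), ∃ χ' : AssociatedVariety (Simple 𝔤 k),
      Quot.mk HamiltonianPath χ = Quot.mk HamiltonianPath χ' ∧ point χ' = σ (point χ)) ∧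
    ∀ χ : AssociatedVariety (Simple 𝔤 k), ∃ χ' : AssociatedVariety (Simple 𝔤 k),
      Quot.mk HamiltonianPath χ = Quot.mk HamiltonianPath χ' ∧ point χ' = σ.symm (point χ) := by
  induction hσ using Subgroup.closure_induction with
  | mem σ hσ =>
    obtain ⟨y, hy⟩ := hσ
    refine ⟨fun χ => ?_, fun χ => ?_⟩
    · obtain ⟨τ, hτ⟩ := exists_equiv_isExp (-(ad ℂ 𝔤 y))
      have h := hy.neg_mul_cancel hτ
      rw [← map_neg] at hτ
      obtain ⟨χ', h1, h2⟩ := exists_hamiltonianPath χ hτ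
      refine ⟨χ', Quot.sound h1, h2.trans (τ.symm_apply_eq.mpr ?_)⟩
      exact (LinearMap.congr_fun h (point χ)).symm
    · obtain ⟨χ', h1, h2⟩ := exists_hamiltonianPath χ hy
      exact ⟨χ', Quot.sound h1, h2⟩
  | one => exact ⟨fun χ => ⟨χ, rfl, rfl⟩, fun χ => ⟨χ, rfl, rfl⟩⟩
  | mul σ τ _ _ hσ hτ =>
    refine ⟨fun χ => ?_, fun χ => ?_⟩
    · obtain ⟨χ₁, h1, h1'⟩ := hτ.1 χ
      obtain ⟨χ₂, h2, h2'⟩ := hσ.1 χ₁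
      exact ⟨χ₂, h1.trans h2, by rw [h2', h1']; rfl⟩
    · obtain ⟨χ₁, h1, h1'⟩ := hσ.2 χ
      obtain ⟨χ₂, h2, h2'⟩ := hτ.2 χ₁
      exact ⟨χ₂, h1.trans h2, by rw [h2', h1']; rfl⟩
  | inv σ _ hσ => exact ⟨hσ.2, hσ.1⟩

lemma finite_symplecticLeaf
    (h : ∀ χ : AssociatedVariety (Simple 𝔤 k), IsNilpotent (ad ℂ 𝔤 (point χ))) :
    Finite (SymplecticLeaf (Simple 𝔤 k)) := by
  obtain ⟨F, c, hF, hcF, hc⟩ := exists_finite_nilpotent_classification 𝔤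
  have := hF.to_subtype
  let rep : SymplecticLeaf (Simple 𝔤 k) → AssociatedVariety (Simple 𝔤 k) := Quot.out
  -- Each leaf is labelled by the class of a chosen representative. Equal labels give conjugate
  -- representatives, and these lie in the same leaf.
  refine Finite.of_injective (β := F) (fun q => ⟨c (point (rep q)), hcF _ (h _)⟩) ?_
  intro q q' hq
  obtain ⟨σ, hσ, hσ'⟩ := hc _ _ (h _) (h _) (congrArg Subtype.val hq)
  obtain ⟨χ', h1, h2⟩ := (exists_leaf_eq_of_mem_innerGroup (k := k) hσ).1 (rep q)
  rw [hσ'] at h2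
  rw [point_injective h2] at h1
  exact (Quot.out_eq q).symm.trans (h1.trans (Quot.out_eq q'))

/-! ### Traces of powers of ad as Casimir functions -/

section Invariants

/-- The entries of the matrix of `ad x` are given by pairing `x` with elements of `𝔤`. -/
lemma exists_adjoint_matrix {ι : Type*} [Fintype ι] [DecidableEq ι] (b : Basis ι ℂ 𝔤) :
    ∃ u : ι → ι → 𝔤, ∀ x p q, normalizedForm 𝔤 x (u p q) =
      LinearMap.toMatrixAlgEquiv b (ad ℂ 𝔤 x) p q := by
  have h : ∀ p q, ∃ u, ∀ x, normalizedForm 𝔤 x u =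
      LinearMap.toMatrixAlgEquiv b (ad ℂ 𝔤 x) p q := by
    intro p q
    obtain ⟨u, hu⟩ := exists_normalizedForm_eq (Matrix.entryLinearMap ℂ ℂ p q ∘ₗ
      (LinearMap.toMatrixAlgEquiv b).toLinearMap ∘ₗ (ad ℂ 𝔤 : 𝔤 →ₗ[ℂ] End ℂ 𝔤))
    exact ⟨u, fun x => (normalizedForm_comm x u).trans (hu x)⟩
  choose u hu using h
  exact ⟨u, fun x p q => hu p q x⟩

lemma map_mul_of_leibniz {ι : Type*} [Fintype ι] {R : Type*} [CommRing R] [Algebra ℂ R] {D : End ℂ R}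
    (hD : ∀ f g, D (f * g) = D f * g + f * D g) (P Q : Matrix ι ι R) :
    (P * Q).map D = P.map D * Q + P * Q.map D := by
  ext p q
  simp only [Matrix.map_apply, Matrix.mul_apply, Matrix.add_apply, map_sum, hD,
    Finset.sum_add_distrib]

variable {ι : Type*} [Fintype ι] [DecidableEq ι] {b : Basis ι ℂ 𝔤} {u : ι → ι → 𝔤}

/-- Paired with x, this is the (p, q) entry of -[ad y, ad x], by invariance of the form;
nondegeneracy lifts the matrix identity to 𝔤. -/
lemma lie_adjoint_matrix (hu : ∀ x p q, normalizedForm 𝔤 x (u p q) =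
      LinearMap.toMatrixAlgEquiv b (ad ℂ 𝔤 x) p q) (y : 𝔤) (p q : ι) :
    ⁅y, u p q⁆ = ∑ r, (LinearMap.toMatrixAlgEquiv b (ad ℂ 𝔤 y) r q • u p r -
      LinearMap.toMatrixAlgEquiv b (ad ℂ 𝔤 y) p r • u r q) := by
  rw [← sub_eq_zero]
  refine eq_zero_of_normalizedForm fun x => ?_
  rw [normalizedForm_comm, map_sub, sub_eq_zero, map_sum, ← neg_inj, ← normalizedForm_lie_left, hu,
    LieHom.map_lie, LieRing.of_associative_ring_bracket, map_sub, map_mul, map_mul,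
    Matrix.sub_apply, Matrix.mul_apply, Matrix.mul_apply, ← Finset.sum_sub_distrib,
    ← Finset.sum_neg_distrib]
  refine Finset.sum_congr rfl fun r _ => ?_
  rw [map_sub, map_smul, map_smul, hu, hu, smul_eq_mul, smul_eq_mul]
  ring

variable (k) in
/-- The matrix over Zhu's algebra with entries `zhuCurrent (u p q)`. For `u` as in
`exists_adjoint_matrix` its value at `χ` is the matrix of `ad (point χ)`. -/
noncomputable def zhuMatrix (u : ι → ι → 𝔤) : Matrix ι ι (ZhuC2 (Simple 𝔤 k)) :=
  Matrix.of fun p q => zhuCurrent k (u p q)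

/-- Bracketing with a generator turns the matrix A into the commutator AY - YA with a scalar matrix
Y. By the Leibniz rule the same holds for A^m, so its trace is annihilated by all generators. -/
lemma trace_zhuMatrix_pow_central (hu : ∀ x p q, normalizedForm 𝔤 x (u p q) =
      LinearMap.toMatrixAlgEquiv b (ad ℂ 𝔤 x) p q) (m : ℕ) (f : ZhuC2 (Simple 𝔤 k)) :
    ZhuC2.poisson f (zhuMatrix k u ^ m).trace = 0 := by
  refine poisson_eq_zero_of_adjoin adjoin_range_zhuCurrent ?_ f
  rintro _ ⟨y, rfl⟩
  set D : End ℂ (ZhuC2 (Simple 𝔤 k)) := ZhuC2.poisson (zhuCurrent k y)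
  have hD : ∀ f g, D (f * g) = D f * g + f * D g := poisson_mul _
  set A := zhuMatrix k u with hA
  set Y : Matrix ι ι (ZhuC2 (Simple 𝔤 k)) :=
    (LinearMap.toMatrixAlgEquiv b (ad ℂ 𝔤 y)).map (algebraMap ℂ _) with hY
  have hA1 : A.map D = A * Y - Y * A := by
    ext p q
    rw [Matrix.map_apply, Matrix.sub_apply, Matrix.mul_apply, Matrix.mul_apply,
      ← Finset.sum_sub_distrib]
    change ZhuC2.poisson (zhuCurrent k y) (zhuCurrent k (u p q)) = _
    rw [poisson_zhuCurrent, lie_adjoint_matrix hu, map_sum]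
    refine Finset.sum_congr rfl fun r _ => ?_
    rw [map_sub, map_smul, map_smul, Algebra.smul_def, Algebra.smul_def, mul_comm]
    rfl
  have hAm : ∀ m : ℕ, (A ^ m).map D = A ^ m * Y - Y * A ^ m := by
    intro m
    induction m with
    | zero =>
      rw [pow_zero, one_mul, mul_one, sub_self]
      ext p q
      rw [Matrix.map_apply, Matrix.one_apply, Matrix.zero_apply]
      split_ifs
      · exact poisson_one _
      · exact map_zero D
    | succ m ih =>
      rw [pow_succ, map_mul_of_leibniz hD, ih, hA1]
      noncomm_ring
  have h : D (A ^ m).trace = ((A ^ m).map D).trace := by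
    simp only [Matrix.trace, Matrix.diag_apply, map_sum, Matrix.map_apply]
  change D (A ^ m).trace = 0
  rw [h, hAm, Matrix.trace_sub, Matrix.trace_mul_comm, sub_self]

lemma map_trace_zhuMatrix_pow (hu : ∀ x p q, normalizedForm 𝔤 x (u p q) =
      LinearMap.toMatrixAlgEquiv b (ad ℂ 𝔤 x) p q) (χ : AssociatedVariety (Simple 𝔤 k)) (m : ℕ) :
    χ (zhuMatrix k u ^ m).trace = LinearMap.trace ℂ 𝔤 (ad ℂ 𝔤 (point χ) ^ m) := by
  have h1 : χ.mapMatrix (zhuMatrix k u) = LinearMap.toMatrixAlgEquiv b (ad ℂ 𝔤 (point χ)) := by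
    ext p q
    rw [← hu, normalizedForm_point]
    rfl
  have h2 : χ (zhuMatrix k u ^ m).trace = (χ.mapMatrix (zhuMatrix k u ^ m)).trace := by
    simp only [Matrix.trace, Matrix.diag_apply, map_sum, AlgHom.mapMatrix_apply, Matrix.map_apply]
  rw [h2, map_pow, h1, ← map_pow, LinearMap.trace_eq_matrix_trace ℂ b]
  rfl

end Invariants

/-- A Poisson-central element has zero derivative along every Hamiltonian curve. -/
lemma HamiltonianPath.apply_eq {V : Type*} [AddCommGroup V] [Module ℂ V] [VertexAlgebra V]
    {χ χ' : AssociatedVariety V} (h : HamiltonianPath χ χ') {z : ZhuC2 V}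
    (hz : ∀ f, ZhuC2.poisson f z = 0) : χ z = χ' z := by
  obtain ⟨f, γ, rfl, rfl, hγ⟩ := h
  have hd : ∀ t ∈ Set.Icc (0 : ℝ) 1, HasDerivWithinAt (fun s => γ s z) 0 (Set.Icc 0 1) t := by
    intro t ht
    have := hγ t ht z
    rwa [hz, map_zero] at this
  refine (constant_of_derivWithin_zero (f := fun s => γ s z) (fun t ht =>
    (hd t ht).differentiableWithinAt) (fun t ht => ?_) 1 (Set.right_mem_Icc.mpr zero_le_one)).symm
  have ht' : t ∈ Set.Icc (0 : ℝ) 1 := Set.Ico_subset_Icc_self ht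
  exact (hd t ht').derivWithin (uniqueDiffOn_Icc zero_lt_one t ht')

/-- Composing a character with the rescaling automorphism of the C₂-algebra scales its point; thus
X_V is a cone. -/
lemma exists_point_eq_smul (χ : AssociatedVariety (Simple 𝔤 k)) {r : ℂ} (hr : r ≠ 0) :
    ∃ χ' : AssociatedVariety (Simple 𝔤 k), point χ' = r • point χ := by
  obtain ⟨θ, hθ⟩ := exists_algHom_zhuCurrent (𝔤 := 𝔤) (k := k) hr
  refine ⟨χ.comp θ, point_eq fun y => ?_⟩
  rw [map_smul, LinearMap.smul_apply, normalizedForm_point, AlgHom.comp_apply, hθ, map_smul]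

lemma isNilpotent_of_finite_symplecticLeaf [Finite (SymplecticLeaf (Simple 𝔤 k))]
    (χ : AssociatedVariety (Simple 𝔤 k)) : IsNilpotent (ad ℂ 𝔤 (point χ)) := by
  refine isNilpotent_of_forall_trace_pow fun m hm => ?_
  by_contra hne
  obtain ⟨u, hu⟩ := exists_adjoint_matrix (finBasis ℂ 𝔤)
  -- The trace of the m-th power descends to the set of leaves, so its range is finite. Scaling the
  -- point by n + 1, a nonzero scalar, multiplies the value by (n + 1)^m, so a nonzero trace would
  -- give infinitely many values.
  let φ : SymplecticLeaf (Simple 𝔤 k) → ℂ := Quot.lift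
    (fun χ : AssociatedVariety (Simple 𝔤 k) => χ (zhuMatrix k u ^ m).trace)
    fun _ _ h => HamiltonianPath.apply_eq h (trace_zhuMatrix_pow_central hu m)
  have hmem : ∀ n : ℕ, ((n + 1 : ℕ) : ℂ) ^ m * LinearMap.trace ℂ 𝔤 (ad ℂ 𝔤 (point χ) ^ m) ∈
      Set.range φ := by
    intro n
    obtain ⟨χ', hχ'⟩ := exists_point_eq_smul χ (r := ((n + 1 : ℕ) : ℂ))
      (Nat.cast_ne_zero.mpr n.succ_ne_zero)
    refine ⟨Quot.mk _ χ', (map_trace_zhuMatrix_pow hu χ' m).trans ?_⟩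
    rw [hχ', map_smul, smul_pow, map_smul, smul_eq_mul]
  refine Set.infinite_of_injective_forall_mem ?_ hmem (Set.finite_range φ)
  intro n n' h
  have h1 : ((n + 1 : ℕ) : ℂ) ^ m = ((n' + 1 : ℕ) : ℂ) ^ m := mul_right_cancel₀ hne h
  have h2 : (n + 1) ^ m = (n' + 1) ^ m := by exact_mod_cast h1
  exact Nat.succ_injective (Nat.pow_left_injective hm.ne' h2)

end Leaves

end QuasiLisse

theorem mainTheorem7 {𝔤 : Type*} [LieRing 𝔤] [LieAlgebra ℂ 𝔤] [FiniteDimensional ℂ 𝔤]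
    [LieAlgebra.IsSimple ℂ 𝔤] (k : ℂ) :
    VertexAlgebra.IsQuasiLisse (AffineVertexAlgebra.Simple 𝔤 k) ↔
      AffineVertexAlgebra.associatedVariety 𝔤 k ⊆ AffineVertexAlgebra.nilpotentCone 𝔤 := by
  refine ⟨?_, fun h => ⟨QuasiLisse.isFinitelyStronglyGenerated_simple,
    QuasiLisse.finite_symplecticLeaf fun χ => h ⟨χ, QuasiLisse.normalizedForm_point χ⟩⟩⟩
  rintro ⟨-, hfin⟩ x ⟨χ, hχ⟩
  have hx : QuasiLisse.point χ = x := QuasiLisse.point_eq hχ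
  rw [← hx]
  exact QuasiLisse.isNilpotent_of_finite_symplecticLeaf χ
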